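/- Let $\alpha\in(0,1)$, $a,x_a\in\mathbb R$, and $(M,N)\in\mathbb R^2\setminus\{(0,0)\}$. Let $L,f:[a,\infty)\times\mathbb R^2\to\mathbb R$ be continuously differentiable and let $\varphi:[a,\infty)\times\mathbb R\to\mathbb R$ be differentiable. Consider the problem $$J[x,u,T]=\int_a^T L(t,x(t),u(t))\,dt+\varphi(T,x(T))\longrightarrow\min$$ over all triplets $(x,u,T)$ with $$M\dot x(t)+N\;{}^C_aD^\alpha_t x(t)=f(t,x(t),u(t)),\qquad x(a)=x_a,\qquad a<T<\infty .$$ Here $${}^C_aD^\alpha_tx(t)=\frac1{\Gamma(1-\alpha)}\int_a^t(t-\tau)^{-\alpha}\dot x(\tau)\,d\tau,\qquad {}_tI_T^{1-\alpha}y(t)=\frac1{\Gamma(1-\alpha)}\int_t^T(\tau-t)^{-\alpha}y(\tau)\,d\tau,\qquad {}_tD_T^\alpha y=-\frac{d}{dt}\,{}_tI_T^{1-\alpha}y .$$ *Admissibility.* Fix a finite (possibly empty) set $D\subset\mathbb R$ of exceptional instants. A triplet is admissible if $a<T<\infty$, $x(a)=x_a$, $x$ is absolutely continuous on $[a,T]$,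 $u$ is piecewise continuous on $[a,T]$ (continuous off a finite set, with finite one-sided limits), and at every $t\in[a,T]\setminus D$ the state $x$ is differentiable (one-sidedly at the end points), the integral defining ${}^C_aD^\alpha_tx(t)$ converges absolutely if $N\ne0$, and the control system holds. For $D=\emptyset$ the state is differentiable and the system holds everywhere on $[a,T]$. Put $H(t,x,u,\lambda)=L(t,x,u)+\lambda f(t,x,u)$. **Theorem.** Let $(x,u,T)$ minimize $J$ among all admissible triplets, with $T\notin D$ and $u$ left-continuous at $T$. Write $\varphi_x^T=\frac{\partial\varphi}{\partial x}(T,x(T))$. Then there is a function $\lambda$, integrable on $[a,T]$ and continuous on $[a,T)$, which is moreover absolutely continuous on $[a,T]$ if $M\neq0$ and continuous on $[a,T]$ if $\varphi_x^T=0$, such that the following hold. * *Hamiltonian system.* The adjoint equation $$M\dot\lambda(t)-N\;{}_tD_T^\alpha\lambda(t)=-\frac{\partial H}{\partial x}(t,x(t),u(t),\lambda(t))$$ holds, with the derivatives that carry a non-zero coefficient existing (one-sided at $a$ and $T$), at every $t\in[a,T)$ at which $u$ is continuous, and also at $t=T$ if $N=0$ or $\varphi_x^T=0$. The state equation $$M\dot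 x(t)+N\;{}^C_aD_t^\alpha x(t)=\frac{\partial H}{\partial\lambda}(t,x(t),u(t),\lambda(t))$$ holds at every $t\in[a,T]\setminus D$. * *Stationarity condition.* $\frac{\partial H}{\partial u}(t,x(t),u(t),\lambda(t))=0$ at every $t\in[a,T)$ at which $u$ is continuous, and also at $t=T$ if $M\ne0$ or $\varphi_x^T=0$. * *Transversality conditions.* The limit $\ell=\lim_{t\to T^-}{}_tI_T^{1-\alpha}\lambda(t)$ exists and is finite; with $\left[{}_tI_T^{1-\alpha}\lambda(t)\right]_{t=T}$ understood as $\ell$, $$\Bigl[H(t,x(t),u(t),\lambda(t))-N\lambda(t)\,{}^C_aD_t^\alpha x(t)+N\dot x(t)\,{}_tI_T^{1-\alpha}\lambda(t)+\frac{\partial\varphi}{\partial t}(t,x(t))\Bigr]_{t=T}=0,$$ $$\Bigl[M\lambda(t)+N\,{}_tI_T^{1-\alpha}\lambda(t)-\frac{\partial\varphi}{\partial x}(t,x(t))\Bigr]_{t=T}=0 .$$ -/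

import Mathlib

open Set Filter Topology MeasureTheory

noncomputable section

namespace FracOC

/-- The left Caputo derivative of order `α ∈ (0,1)` with base point `a`,
`(1/Γ(1-α)) ∫_a^t (t-τ)^(-α) x'(τ) dτ`. -/
def caputoLeft (α a : ℝ) (x : ℝ → ℝ) (t : ℝ) : ℝ :=
  (Real.Gamma (1 - α))⁻¹ * ∫ τ in a..t, (t - τ) ^ (-α) * deriv x τ

/-- The integrand in the left Caputo derivative at `t` is integrable, so that the derivative
is defined at `t`. -/
def CaputoLeftExists (α a : ℝ) (x : ℝ → ℝ) (t : ℝ) : Prop :=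
  IntervalIntegrable (fun τ => (t - τ) ^ (-α) * deriv x τ) volume a t

/-- The right Riemann–Liouville integral of order `β > 0` with end point `T`,
`(1/Γ(β)) ∫_t^T (τ-t)^(β-1) y(τ) dτ`. -/
def rlIntegralRight (β T : ℝ) (y : ℝ → ℝ) (t : ℝ) : ℝ :=
  (Real.Gamma β)⁻¹ * ∫ τ in t..T, (τ - t) ^ (β - 1) * y τ

/-- The right Riemann–Liouville derivative of order `α ∈ (0,1)` with end point `T`, that is
`-(d/dt)` of the right integral of order `1-α`; the derivative is relative to `[a,T]`, hence
one-sided at the two end points. -/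
def rlDerivRight (α a T : ℝ) (y : ℝ → ℝ) (t : ℝ) : ℝ :=
  -derivWithin (rlIntegralRight (1 - α) T y) (Icc a T) t

/-- The right Riemann–Liouville derivative of order `α` exists at `t ∈ [a,T]`. -/
def RLDerivRightExists (α a T : ℝ) (y : ℝ → ℝ) (t : ℝ) : Prop :=
  DifferentiableWithinAt ℝ (rlIntegralRight (1 - α) T y) (Icc a T) t

/-- Piecewise continuity on `[a,b]`: continuity off a finite set, and finite one-sided limits
everywhere. -/
def PiecewiseContinuousOn (u : ℝ → ℝ) (a b : ℝ) : Prop :=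
  (∃ S : Finset ℝ, ∀ t ∈ Icc a b, t ∉ S → ContinuousWithinAt u (Icc a b) t) ∧
  (∀ t ∈ Ico a b, ∃ l, Tendsto u (𝓝[>] t) (𝓝 l)) ∧
  (∀ t ∈ Ioc a b, ∃ l, Tendsto u (𝓝[<] t) (𝓝 l))

/-- `(x,u,T)` is admissible for the control system `M x' + N ᶜD^α x = f(t,x,u)`, `x(a) = xa`:
`T > a`, the state `x` is absolutely continuous on `[a,T]`, the control `u` is piecewise
continuous on `[a,T]`, and at every `t ∈ [a,T]` outside the finite set `D` of exceptional
instants the state is differentiable (one-sidedly at the end points) and the equation holds. -/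
structure IsAdmissible (α a M N xa : ℝ) (f : ℝ → ℝ → ℝ → ℝ) (D : Finset ℝ)
    (x u : ℝ → ℝ) (T : ℝ) : Prop where
  lt : a < T
  absCont : AbsolutelyContinuousOnInterval x a T
  control : PiecewiseContinuousOn u a T
  init : x a = xa
  differentiable : ∀ t ∈ Icc a T, t ∉ D → DifferentiableWithinAt ℝ x (Icc a T) t
  caputo : N ≠ 0 → ∀ t ∈ Icc a T, t ∉ D → CaputoLeftExists α a x t
  dynamics : ∀ t ∈ Icc a T, t ∉ D →
    M * derivWithin x (Icc a T) t + N * caputoLeft α a x t = f t (x t) (u t)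

/-- The cost `J[x,u,T] = ∫_a^T L(t,x(t),u(t)) dt + φ(T,x(T))`. -/
def cost (a : ℝ) (L : ℝ → ℝ → ℝ → ℝ) (φ : ℝ → ℝ → ℝ) (x u : ℝ → ℝ) (T : ℝ) : ℝ :=
  (∫ t in a..T, L t (x t) (u t)) + φ T (x T)

/-- `(x,u,T)` minimizes the cost among all admissible triplets. -/
def IsMinimizer (α a M N xa : ℝ) (L f : ℝ → ℝ → ℝ → ℝ) (φ : ℝ → ℝ → ℝ) (D : Finset ℝ)
    (x u : ℝ → ℝ) (T : ℝ) : Prop :=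
  IsAdmissible α a M N xa f D x u T ∧
    ∀ (x' u' : ℝ → ℝ) (T' : ℝ), IsAdmissible α a M N xa f D x' u' T' →
      cost a L φ x u T ≤ cost a L φ x' u' T'

/-- The Hamiltonian `H(t,x,u,λ) = L(t,x,u) + λ f(t,x,u)`. -/
def hamiltonian (L f : ℝ → ℝ → ℝ → ℝ) (t x u p : ℝ) : ℝ :=
  L t x u + p * f t x u

end FracOC

end

noncomputable section

namespace FracOC

/-! The admissible class is too rigid for direct variations. A state must be differentiable at every
instant outside `D`, and a perturbed control with jumps, or for `M = 0` even a continuous one, need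
not produce such a state. The problem is therefore moved to a Volterra equation. Let `g(t) =
t^(-α)/Γ(1-α)` and let `k` solve `M k + N g * k = 1`. States of the control system solve `x = xa + k
* f(·,x,u)` (`IsAdmissible.eq_volterra`), and sufficiently regular solutions of this equation solve
the system (`IsResolvent.dynamics`). The Volterra form makes sense for bounded controls with
finitely many jumps. After the data are truncated outside a large box (`SmoothData.exists_tame`) it
is well posed, since an exponential weight makes weakly singular convolutions contractive.

Relaxation. The minimizer also beats every generalized trajectory that stays in the box
(`IsMinimizer.cost_le_traj`). Its control is a bounded almost everywhere limit of `C¹` controls with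
the value `u(a)` at `a`. Their trajectories are primitives of velocities continuous on `(a,b]`; for
`M = 0` this needs the Picard argument of `Tame.exists_velocity_power`. The fixed initial value
secures the state equation at `a` when `a ∉ D`. So these trajectories are admissible, and stability
carries the inequality to the limit.

Variation. Put `c = φ_x^T`. In reversed time `τ = T - t` the multiplier solves `μ = c k + k * (L_x +
f_x μ)`. If `w` is the exact increment of `f` under a variation of the control, then `δ = k * w` is
the exact increment of the state, and associativity of convolution gives the duality `∫ μ w = c δ(T)
+ ∫ (L_x + f_x μ) δ` (`IsCostate.integral_mul_eq`). No linearized state equation is needed: first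
order expansions of `L` and `f` suffice for `∫ (L_u + λ f_u) η = 0`, whence the stationarity
condition. Applying `M + N g *` to the costate equation yields `M μ + N g * μ = c + ∫ (L_x + f_x μ)`
(`IsCostate.conservation`). Its derivative is the adjoint equation and its limit at `τ = 0` is the
second transversality condition.

Final time. Continue `u` by a constant beyond `T`. The cost along the continued trajectory, as a
function of the final time, has a local minimum at `T`, so its derivative vanishes once the
continued state is known to be differentiable there. For `M ≠ 0` this holds because `k` is a
primitive. For `M = 0` the trajectory is compared with its tangent line: the Caputo derivative of
the linear continuation changes only by `o(h^(1-α))`, and convolution with `t^(α-1)` turns this into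
a deviation `o(h)` (`hasDerivWithinAt_Ici_of_power`). The state equation and the terminal identity
then give the first transversality condition. -/

/-! ### Beta integrals and exponential weights -/

theorem integral_beta_zero {P Q t : ℝ} (hP : 0 < P) (hQ : 0 < Q) (ht : 0 < t) :
    ∫ s in (0 : ℝ)..t, (t - s) ^ (P - 1) * s ^ (Q - 1)
      = t ^ (P + Q - 1) * ProbabilityTheory.beta P Q := by
  have h := Complex.betaIntegral_scaled (Q : ℂ) (P : ℂ) ht
  have hb : Complex.betaIntegral (Q : ℂ) (P : ℂ) = ((ProbabilityTheory.beta P Q : ℝ) : ℂ) := by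
    rw [Complex.betaIntegral_eq_Gamma_mul_div _ _ (by simpa) (by simpa), ProbabilityTheory.beta]
    push_cast [Complex.Gamma_ofReal]
    rw [← Complex.Gamma_ofReal, ← Complex.Gamma_ofReal, ← Complex.Gamma_ofReal]
    push_cast
    rw [mul_comm, add_comm]
  have h1 : ∫ s in (0 : ℝ)..t, (s : ℂ) ^ ((Q : ℂ) - 1) * ((t : ℂ) - s) ^ ((P : ℂ) - 1)
      = ∫ s in (0 : ℝ)..t, (((t - s) ^ (P - 1) * s ^ (Q - 1) : ℝ) : ℂ) := by
    apply intervalIntegral.integral_congr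
    intro s hs
    rw [uIcc_of_le ht.le] at hs
    simp only
    rw [Complex.ofReal_mul, Complex.ofReal_cpow (by linarith [hs.2]), Complex.ofReal_cpow hs.1]
    push_cast
    ring
  rw [h1, intervalIntegral.integral_ofReal, hb] at h
  have h2 : (t : ℂ) ^ ((Q : ℂ) + P - 1) = ((t ^ (P + Q - 1) : ℝ) : ℂ) := by
    rw [Complex.ofReal_cpow ht.le]
    push_cast
    ring_nf
  rw [h2] at h
  exact_mod_cast h

/-- The scaled beta integral. -/
theorem integral_beta {P Q a t : ℝ} (hP : 0 < P) (hQ : 0 < Q) (ht : a < t) :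
    ∫ s in a..t, (t - s) ^ (P - 1) * (s - a) ^ (Q - 1)
      = (t - a) ^ (P + Q - 1) * ProbabilityTheory.beta P Q := by
  rw [← integral_beta_zero hP hQ (sub_pos.2 ht)]
  have := intervalIntegral.integral_comp_sub_right (a := a) (b := t)
    (fun s => (t - a - s) ^ (P - 1) * s ^ (Q - 1)) a
  rw [sub_self] at this
  rw [← this]
  apply intervalIntegral.integral_congr
  intro s _
  simp

theorem intervalIntegrable_beta {P Q a t : ℝ} (hP : 0 < P) (hQ : 0 < Q) (ht : a ≤ t) :
    IntervalIntegrable (fun s => (t - s) ^ (P - 1) * (s - a) ^ (Q - 1)) volume a t := by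
  rcases ht.eq_or_lt with rfl | ht
  · simp
  -- The integral of a non-integrable function is zero by convention, so the positive value of the
  -- beta integral already proves integrability.
  apply intervalIntegral.intervalIntegrable_of_integral_ne_zero
  rw [integral_beta hP hQ ht]
  exact (mul_pos (Real.rpow_pos_of_pos (sub_pos.2 ht) _) (ProbabilityTheory.beta_pos hP hQ)).ne'

theorem intervalIntegrable_sub_rpow {Q a t : ℝ} (hQ : 0 < Q) (ht : a ≤ t) :
    IntervalIntegrable (fun s => (s - a) ^ (Q - 1)) volume a t := by
  simpa using intervalIntegrable_beta (P := 1) one_pos hQ ht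

theorem intervalIntegrable_rsub_rpow {P a t : ℝ} (hP : 0 < P) (ht : a ≤ t) :
    IntervalIntegrable (fun s => (t - s) ^ (P - 1)) volume a t := by
  simpa using intervalIntegrable_beta (Q := 1) hP one_pos ht

theorem integral_rsub_rpow {P a t : ℝ} (hP : 0 < P) :
    ∫ s in a..t, (t - s) ^ (P - 1) = (t - a) ^ P / P := by
  have := intervalIntegral.integral_comp_sub_left (a := a) (b := t) (fun s => s ^ (P - 1)) t
  rw [this, sub_self, integral_rpow (Or.inl (by linarith)), sub_add_cancel, Real.zero_rpow hP.ne',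
    sub_zero]

theorem exp_neg_mul_rpow_le_one {v p : ℝ} (hv : 0 ≤ v) (hp : 0 ≤ p) (hp1 : p ≤ 1) :
    Real.exp (-v) * v ^ p ≤ 1 := by
  have h1 : v ^ p ≤ Real.exp v := by
    rcases le_total v 1 with h | h
    · exact (Real.rpow_le_one hv h hp).trans (Real.one_le_exp hv)
    · calc v ^ p ≤ v ^ (1 : ℝ) := Real.rpow_le_rpow_of_exponent_le h hp1
        _ = v := Real.rpow_one v
        _ ≤ Real.exp v := by linarith [Real.add_one_le_exp v]
  calc Real.exp (-v) * v ^ p ≤ Real.exp (-v) * Real.exp v := by gcongr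
    _ = 1 := by rw [← Real.exp_add]; simp

/-- An exponential weight makes the weakly singular Volterra operator a contraction. -/
theorem exists_weight {P Q a b : ℝ} (hP : 0 < P) (hP1 : P ≤ 1) (hQ : 0 < Q) {C : ℝ} (hC : 0 ≤ C) :
    ∃ κ : ℝ, 0 ≤ κ ∧ ∀ t ∈ Ioc a b,
      IntervalIntegrable (fun s => (t - s) ^ (P - 1) * (s - a) ^ (Q - 1) * Real.exp (κ * (s - a)))
        volume a t ∧
      C * ((t - a) ^ (1 - Q) * ∫ s in a..t, (t - s) ^ (P - 1) * (s - a) ^ (Q - 1)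
        * Real.exp (κ * (s - a))) ≤ 2⁻¹ * Real.exp (κ * (t - a)) := by
  -- Half of the exponent is given up: the factor `(t-s)^(P/2)` against `exp(-κ(t-s))` gains
  -- `κ^(-P/2)`, while the remaining kernel `(t-s)^(P/2-1)` is still integrable. Then `κ` is chosen
  -- with `κ^(P/2) = 2(D+1)`.
  have hP2 : 0 < P / 2 := by linarith
  set D : ℝ := C * (|b - a| ^ (P / 2) * ProbabilityTheory.beta (P / 2) Q) with hD
  have hD0 : 0 ≤ D := by
    have := (ProbabilityTheory.beta_pos hP2 hQ).le
    positivity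
  set κ : ℝ := (2 * (D + 1)) ^ (2 / P) with hκ
  have hκ0 : 0 < κ := by positivity
  have hκP : κ ^ (P / 2) = 2 * (D + 1) := by
    rw [hκ, ← Real.rpow_mul (by positivity)]
    have : 2 / P * (P / 2) = 1 := by field_simp
    rw [this, Real.rpow_one]
  refine ⟨κ, hκ0.le, fun t ht => ?_⟩
  have hta : 0 < t - a := sub_pos.2 ht.1
  have hint : IntervalIntegrable
      (fun s => (t - s) ^ (P - 1) * (s - a) ^ (Q - 1) * Real.exp (κ * (s - a))) volume a t :=
    (intervalIntegrable_beta hP hQ ht.1.le).mul_continuousOn (by fun_prop)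
  refine ⟨hint, ?_⟩
  have key : ∫ s in a..t, (t - s) ^ (P - 1) * (s - a) ^ (Q - 1) * Real.exp (κ * (s - a))
      ≤ ∫ s in a..t, κ ^ (-(P / 2)) * Real.exp (κ * (t - a))
        * ((t - s) ^ (P / 2 - 1) * (s - a) ^ (Q - 1)) := by
    apply intervalIntegral.integral_mono_on_of_le_Ioo ht.1.le hint
      ((intervalIntegrable_beta hP2 hQ ht.1.le).const_mul _)
    intro s hs
    have hts : 0 < t - s := sub_pos.2 hs.2
    have h1 := exp_neg_mul_rpow_le_one (v := κ * (t - s)) (p := P / 2) (by positivity)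
      (by linarith) (by linarith)
    have h2 : (t - s) ^ (P - 1) = (t - s) ^ (P / 2 - 1) * (t - s) ^ (P / 2) := by
      rw [← Real.rpow_add hts]; ring_nf
    have h3 : Real.exp (κ * (s - a)) = Real.exp (κ * (t - a)) * Real.exp (-(κ * (t - s))) := by
      rw [← Real.exp_add]; ring_nf
    have h4 : (t - s) ^ (P / 2) * Real.exp (-(κ * (t - s))) ≤ κ ^ (-(P / 2)) := by
      rw [Real.rpow_neg hκ0.le, ← one_div, le_div_iff₀ (by positivity)]
      rw [Real.mul_rpow hκ0.le hts.le] at h1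
      linarith
    have h5 : 0 ≤ (t - s) ^ (P / 2 - 1) * (s - a) ^ (Q - 1) * Real.exp (κ * (t - a)) := by
      have : 0 ≤ s - a := by linarith [hs.1]
      positivity
    rw [h2, h3]
    calc _ = ((t - s) ^ (P / 2 - 1) * (s - a) ^ (Q - 1) * Real.exp (κ * (t - a)))
          * ((t - s) ^ (P / 2) * Real.exp (-(κ * (t - s)))) := by ring
      _ ≤ ((t - s) ^ (P / 2 - 1) * (s - a) ^ (Q - 1) * Real.exp (κ * (t - a)))
          * κ ^ (-(P / 2)) := by gcongr
      _ = _ := by ring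
  rw [intervalIntegral.integral_const_mul, integral_beta hP2 hQ ht.1] at key
  have hb0 := (ProbabilityTheory.beta_pos hP2 hQ).le
  calc C * ((t - a) ^ (1 - Q) * ∫ s in a..t, (t - s) ^ (P - 1) * (s - a) ^ (Q - 1)
        * Real.exp (κ * (s - a)))
      ≤ C * ((t - a) ^ (1 - Q) * (κ ^ (-(P / 2)) * Real.exp (κ * (t - a))
        * ((t - a) ^ (P / 2 + Q - 1) * ProbabilityTheory.beta (P / 2) Q))) := by gcongr
    _ = C * ((t - a) ^ (P / 2) * ProbabilityTheory.beta (P / 2) Q) * κ ^ (-(P / 2))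
        * Real.exp (κ * (t - a)) := by
        have : (t - a) ^ (1 - Q) * (t - a) ^ (P / 2 + Q - 1) = (t - a) ^ (P / 2) := by
          rw [← Real.rpow_add hta]; ring_nf
        rw [← this]; ring
    _ ≤ D * κ ^ (-(P / 2)) * Real.exp (κ * (t - a)) := by
        rw [hD]
        gcongr
        exact (sub_le_sub_right ht.2 a).trans (le_abs_self _)
    _ ≤ 2⁻¹ * Real.exp (κ * (t - a)) := by
        gcongr
        rw [Real.rpow_neg hκ0.le, hκP, ← div_eq_mul_inv, div_le_iff₀ (by positivity)]
        linarith

/-! ### Volterra convolutions of functions with power singularities -/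

/-- The Volterra convolution `∫_a^t p(t-s) w(s) ds`. -/
def cv (a : ℝ) (p w : ℝ → ℝ) (t : ℝ) : ℝ := ∫ s in a..t, p (t - s) * w s

@[simp] theorem cv_self (a : ℝ) (p w : ℝ → ℝ) : cv a p w a = 0 := by simp [cv]

theorem cv_comm (p q : ℝ → ℝ) (t : ℝ) : cv 0 p q t = cv 0 q p t := by
  have := intervalIntegral.integral_comp_sub_left (a := 0) (b := t) (fun s => p (t - s) * q s) t
  simp only [sub_self, sub_zero, sub_sub_cancel] at this
  rw [cv, ← this, cv]
  simp_rw [mul_comm]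

theorem cv_congr_right {a t : ℝ} {p w w' : ℝ → ℝ} (hat : a ≤ t)
    (h : ∀ s ∈ Ioc a t, w s = w' s) : cv a p w t = cv a p w' t := by
  apply intervalIntegral.integral_congr_ae
  rw [uIoc_of_le hat]
  exact Eventually.of_forall fun s hs => by rw [h s hs]

/-- The kernel is evaluated at `0` only for `s = t`, a null set, so its conventional value there is
irrelevant. -/
theorem cv_congr_left {a t : ℝ} {p p' w : ℝ → ℝ} (hat : a ≤ t)
    (h : ∀ s ∈ Ioc 0 (t - a), p s = p' s) : cv a p w t = cv a p' w t := by
  apply intervalIntegral.integral_congr_ae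
  rw [uIoc_of_le hat]
  filter_upwards [compl_mem_ae_iff.2 (measure_singleton t)] with s hst hs
  have : s ≠ t := hst
  rw [h _ ⟨sub_pos.2 (lt_of_le_of_ne hs.2 this), by linarith [hs.1]⟩]

/-- `p` is measurable and `O(s^(P-1))` on `(0,R]`. -/
structure SingBound (P a R : ℝ) (C : ℝ) (p : ℝ → ℝ) : Prop where
  meas : AEStronglyMeasurable p (volume.restrict (Ioc a R))
  bound : ∀ s ∈ Ioc a R, |p s| ≤ C * (s - a) ^ (P - 1)

theorem SingBound.mono {P a R R' C : ℝ} {p : ℝ → ℝ} (h : SingBound P a R C p) (hR : R' ≤ R) :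
    SingBound P a R' C p :=
  ⟨h.meas.mono_measure (Measure.restrict_mono (Ioc_subset_Ioc_right hR) le_rfl),
    fun s hs => h.bound s ⟨hs.1, hs.2.trans hR⟩⟩

theorem SingBound.const_nonneg {P a R C : ℝ} {p : ℝ → ℝ} (h : SingBound P a R C p) (hR : a < R) :
    0 ≤ C := by
  have h1 := (abs_nonneg _).trans (h.bound R ⟨hR, le_rfl⟩)
  exact nonneg_of_mul_nonneg_left h1 (Real.rpow_pos_of_pos (sub_pos.2 hR) _)

theorem SingBound.intervalIntegrable {P a R C : ℝ} {p : ℝ → ℝ} (h : SingBound P a R C p)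
    (hP : 0 < P) (hR : a ≤ R) : IntervalIntegrable p volume a R := by
  have h1 := (intervalIntegrable_sub_rpow hP hR).const_mul C
  rw [intervalIntegrable_iff_integrableOn_Ioc_of_le hR] at h1 ⊢
  refine Integrable.mono' h1 h.meas ?_
  exact (ae_restrict_mem measurableSet_Ioc).mono fun s hs => h.bound s hs

theorem aestronglyMeasurable_comp_rsub {a t : ℝ} {p : ℝ → ℝ}
    (hp : AEStronglyMeasurable p (volume.restrict (Ioc 0 (t - a)))) :
    AEStronglyMeasurable (fun s => p (t - s)) (volume.restrict (Ioc a t)) := by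
  have h1 : MeasurePreserving (fun s : ℝ => t - s) (volume.restrict (Ico a t))
      (volume.restrict (Ioc 0 (t - a))) := by
    have := (Measure.measurePreserving_sub_left volume t).restrict_preimage
      (measurableSet_Ioc (a := 0) (b := t - a))
    have h2 : (fun s : ℝ => t - s) ⁻¹' Ioc 0 (t - a) = Ico a t := by
      ext s
      simp only [mem_preimage, mem_Ioc, mem_Ico]
      constructor <;> intro h <;> constructor <;> linarith [h.1, h.2]
    rwa [h2] at this
  have h3 := hp.comp_measurePreserving h1
  rw [Measure.restrict_congr_set (Ico_ae_eq_Ioc (μ := volume) (a := a) (b := t)).symm]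
  exact h3

section
variable {p w : ℝ → ℝ} {a b t P Q Cp Cw : ℝ}

theorem SingBound.ae_mul_le (hp : SingBound P 0 (t - a) Cp p) (hw : SingBound Q a t Cw w) :
    ∀ᵐ s ∂(volume.restrict (Ioc a t)),
      ‖p (t - s) * w s‖ ≤ Cp * Cw * ((t - s) ^ (P - 1) * (s - a) ^ (Q - 1)) := by
  filter_upwards [ae_restrict_mem measurableSet_Ioc,
    ae_restrict_of_ae (compl_mem_ae_iff.2 (measure_singleton t))] with s hs hst
  have hst' : 0 < t - s := sub_pos.2 (lt_of_le_of_ne hs.2 hst)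
  have h1 := hp.bound (t - s) ⟨hst', by linarith [hs.1]⟩
  have h2 := hw.bound s hs
  rw [sub_zero] at h1
  rw [Real.norm_eq_abs, abs_mul]
  calc _ ≤ (Cp * (t - s) ^ (P - 1)) * (Cw * (s - a) ^ (Q - 1)) :=
        mul_le_mul h1 h2 (abs_nonneg _) ((abs_nonneg _).trans h1)
    _ = _ := by ring

theorem SingBound.aestronglyMeasurable_mul (hp : SingBound P 0 (t - a) Cp p)
    (hw : SingBound Q a t Cw w) :
    AEStronglyMeasurable (fun s => p (t - s) * w s) (volume.restrict (Ioc a t)) :=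
  (aestronglyMeasurable_comp_rsub hp.meas).mul hw.meas

theorem cv_intervalIntegrable (hP : 0 < P) (hQ : 0 < Q) (hat : a ≤ t)
    (hp : SingBound P 0 (t - a) Cp p) (hw : SingBound Q a t Cw w) :
    IntervalIntegrable (fun s => p (t - s) * w s) volume a t := by
  have h1 := (intervalIntegrable_beta hP hQ hat).const_mul (Cp * Cw)
  rw [intervalIntegrable_iff_integrableOn_Ioc_of_le hat] at h1 ⊢
  exact Integrable.mono' h1 (hp.aestronglyMeasurable_mul hw) (hp.ae_mul_le hw)

theorem abs_cv_le (hP : 0 < P) (hQ : 0 < Q) (hat : a < t)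
    (hp : SingBound P 0 (t - a) Cp p) (hw : SingBound Q a t Cw w) :
    |cv a p w t| ≤ Cp * Cw * ProbabilityTheory.beta P Q * (t - a) ^ (P + Q - 1) := by
  have h1 := (intervalIntegrable_beta hP hQ hat.le).const_mul (Cp * Cw)
  have h2 := intervalIntegral.norm_integral_le_of_norm_le hat.le
    ((ae_restrict_iff' measurableSet_Ioc).1 (hp.ae_mul_le hw)) h1
  rw [intervalIntegral.integral_const_mul, integral_beta hP hQ hat] at h2
  calc _ ≤ _ := h2
    _ = _ := by ring

/-- Dropping the part of the kernel with `t - s ≤ ρ` leaves an integral continuous in `t` by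
dominated convergence, because `p` is bounded away from its singularity. Near `t₀ > a` the dropped
part is `O(ρ^P)` uniformly in `t`, so the convolution is a locally uniform limit of continuous
functions. -/
theorem continuousWithinAt_cv (hP : 0 < P) (hP1 : P ≤ 1) (hQ : 0 < Q) (hQ1 : Q ≤ 1)
    (hpc : ContinuousOn p (Ioi 0)) (hp : SingBound P 0 (b - a) Cp p) (hw : SingBound Q a b Cw w)
    {t₀ : ℝ} (ht₀ : t₀ ∈ Ioc a b) : ContinuousWithinAt (cv a p w) (Icc a b) t₀ := by
  have hab : a < b := ht₀.1.trans_le ht₀.2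
  have hCp := hp.const_nonneg (by linarith)
  have hCw := hw.const_nonneg hab
  -- For `t > t₀ - c` and `ρ < c` the strip `(t - ρ, t)` stays at distance at least `c` from `a`,
  -- where `w` is bounded by a constant.
  set c : ℝ := (t₀ - a) / 4 with hc
  have hc0 : 0 < c := by have := ht₀.1; simp only [hc]; linarith
  have hwi := hw.intervalIntegrable hQ hab.le
  rw [intervalIntegrable_iff_integrableOn_Ioc_of_le hab.le] at hwi
  refine continuousWithinAt_of_locally_uniform_approx_of_continuousWithinAt
    (show t₀ ∈ Icc a b from ⟨ht₀.1.le, ht₀.2⟩) ?_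
  intro U hU
  obtain ⟨ε, hε, hεU⟩ := Metric.mem_uniformity_dist.1 hU
  set D : ℝ := Cp * (Cw * c ^ (Q - 1)) / P with hD
  have hlim : Tendsto (fun ρ : ℝ => D * ρ ^ P) (𝓝[>] 0) (𝓝 0) := by
    have : Tendsto (fun ρ : ℝ => D * ρ ^ P) (𝓝 0) (𝓝 (D * 0 ^ P)) :=
      ((Real.continuous_rpow_const hP.le).tendsto 0).const_mul D
    rw [Real.zero_rpow hP.ne', mul_zero] at this
    exact this.mono_left nhdsWithin_le_nhds
  obtain ⟨ρ, hρε, hρ0, hρc⟩ := ((hlim.eventually_lt_const hε).and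
    (Ioo_mem_nhdsGT hc0)).exists
  let F : ℝ → ℝ := fun t => ∫ s in Ioc a b, (if ρ < t - s then p (t - s) else 0) * w s
  have hF : ContinuousWithinAt F (Icc a b) t₀ := by
    apply continuousWithinAt_of_dominated (bound := fun s => Cp * ρ ^ (P - 1) * |w s|)
    · filter_upwards [self_mem_nhdsWithin] with t ht
      refine AEStronglyMeasurable.mul ?_ hw.meas
      have hm : MeasurableSet {s : ℝ | ρ < t - s} :=
        measurableSet_lt measurable_const (by fun_prop)
      have hcont : ContinuousOn (fun s => p (t - s)) {s : ℝ | ρ < t - s} :=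
        hpc.comp (by fun_prop) fun s hs => hρ0.trans hs
      have := (hcont.aestronglyMeasurable (μ := volume) hm)
      have h2 := (aestronglyMeasurable_indicator_iff (μ := volume) hm).2 this
      exact h2.restrict
    · filter_upwards [self_mem_nhdsWithin] with t ht
      filter_upwards [ae_restrict_mem measurableSet_Ioc] with s hs
      rw [norm_mul, Real.norm_eq_abs, Real.norm_eq_abs]
      gcongr
      split_ifs with h
      · refine (hp.bound (t - s) ⟨hρ0.trans h, by linarith [ht.2, hs.1]⟩).trans ?_
        rw [sub_zero]
        gcongr ?_ * ?_
        exact Real.rpow_le_rpow_of_nonpos hρ0 h.le (by linarith)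
      · rw [abs_zero]; positivity
    · exact hwi.abs.const_mul _
    · filter_upwards [ae_restrict_of_ae (compl_mem_ae_iff.2 (measure_singleton (t₀ - ρ)))]
        with s hs
      apply ContinuousWithinAt.mul _ continuousWithinAt_const
      apply ContinuousAt.continuousWithinAt
      have hs' : s ≠ t₀ - ρ := hs
      rcases lt_or_gt_of_ne hs' with h | h
      · have h1 : ∀ᶠ t in 𝓝 t₀, p (t - s) = if ρ < t - s then p (t - s) else 0 := by
          filter_upwards [lt_mem_nhds (show s + ρ < t₀ by linarith)] with t ht
          rw [if_pos (by linarith)]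
        refine ContinuousAt.congr ?_ h1
        refine ContinuousAt.comp (g := p) (f := fun t => t - s) ?_ (by fun_prop)
        exact hpc.continuousAt (Ioi_mem_nhds (by linarith))
      · have h1 : ∀ᶠ t in 𝓝 t₀, (0 : ℝ) = if ρ < t - s then p (t - s) else 0 := by
          filter_upwards [gt_mem_nhds (show t₀ < s + ρ by linarith)] with t ht
          rw [if_neg (by linarith)]
        exact continuousAt_const.congr h1
  refine ⟨Icc a b ∩ Ioi (t₀ - c), inter_mem self_mem_nhdsWithin
    (mem_nhdsWithin_of_mem_nhds (Ioi_mem_nhds (by linarith))), F, hF, fun t ht => hεU ?_⟩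
  have ht1 : t₀ - c < t := ht.2
  have hta : a < t - ρ := by have : t₀ = a + 4 * c := by rw [hc]; ring
                             linarith
  have htb : t ≤ b := ht.1.2
  have hint := cv_intervalIntegrable hP hQ (by linarith) (hp.mono (R' := t - a) (by linarith))
    (hw.mono htb)
  have hI1 : IntervalIntegrable (fun s => p (t - s) * w s) volume a (t - ρ) :=
    hint.mono_set (by rw [uIcc_of_le hta.le, uIcc_of_le (by linarith)]
                      exact Icc_subset_Icc_right (by linarith))
  have hI2 : IntervalIntegrable (fun s => p (t - s) * w s) volume (t - ρ) t :=
    hint.mono_set (by rw [uIcc_of_le (by linarith : t - ρ ≤ t), uIcc_of_le (by linarith)]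
                      exact Icc_subset_Icc_left (by linarith))
  have hFt : F t = ∫ s in a..(t - ρ), p (t - s) * w s := by
    rw [intervalIntegral.integral_of_le hta.le, integral_Ioc_eq_integral_Ioo]
    have : ∀ s ∈ Ioc a b, (if ρ < t - s then p (t - s) else 0) * w s
        = (Ioo a (t - ρ)).indicator (fun s => p (t - s) * w s) s := by
      intro s hs
      by_cases h : ρ < t - s
      · rw [if_pos h, indicator_of_mem]
        exact ⟨hs.1, by linarith⟩
      · rw [if_neg h, indicator_of_notMem, zero_mul]
        exact fun h2 => h (by linarith [h2.2])
    simp only [F]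
    rw [setIntegral_congr_fun measurableSet_Ioc this, setIntegral_indicator measurableSet_Ioo]
    congr 2
    exact inter_eq_self_of_subset_right fun s hs => ⟨hs.1, by linarith [hs.2]⟩
  have hdiff : cv a p w t - F t = ∫ s in (t - ρ)..t, p (t - s) * w s := by
    rw [hFt, cv, ← intervalIntegral.integral_add_adjacent_intervals hI1 hI2]
    ring
  rw [Real.dist_eq, hdiff]
  have hb : ∀ᵐ s, s ∈ Ioc (t - ρ) t →
      ‖p (t - s) * w s‖ ≤ Cp * (Cw * c ^ (Q - 1)) * (t - s) ^ (P - 1) := by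
    filter_upwards [compl_mem_ae_iff.2 (measure_singleton t)] with s hst hs
    have hst' : 0 < t - s := sub_pos.2 (lt_of_le_of_ne hs.2 hst)
    have h1 := hp.bound (t - s) ⟨hst', by linarith [hs.1]⟩
    have h2 := hw.bound s ⟨by linarith [hs.1], hs.2.trans htb⟩
    have h3 : (s - a) ^ (Q - 1) ≤ c ^ (Q - 1) := by
      apply Real.rpow_le_rpow_of_nonpos hc0 _ (by linarith)
      have : t₀ = a + 4 * c := by rw [hc]; ring
      linarith [hs.1]
    rw [sub_zero] at h1
    rw [Real.norm_eq_abs, abs_mul]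
    calc _ ≤ (Cp * (t - s) ^ (P - 1)) * (Cw * c ^ (Q - 1)) :=
          mul_le_mul h1 (h2.trans (by gcongr)) (abs_nonneg _) ((abs_nonneg _).trans h1)
      _ = _ := by ring
  have h4 := intervalIntegral.norm_integral_le_of_norm_le (by linarith : t - ρ ≤ t) hb
    ((intervalIntegrable_rsub_rpow hP (by linarith)).const_mul _)
  rw [intervalIntegral.integral_const_mul, integral_rsub_rpow hP, sub_sub_cancel] at h4
  calc _ ≤ _ := h4
    _ = D * ρ ^ P := by rw [hD]; ring
    _ < ε := hρε

/-- Away from `a` this is `continuousWithinAt_cv`. At `a` the weight turns the bound `(t-a)^(P+Q-1)`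
of `abs_cv_le` into `(t-a)^P`, which tends to zero. -/
theorem continuousOn_weighted_cv (hP : 0 < P) (hP1 : P ≤ 1) (hQ : 0 < Q) (hQ1 : Q ≤ 1)
    (hpc : ContinuousOn p (Ioi 0)) (hp : SingBound P 0 (b - a) Cp p) (hw : SingBound Q a b Cw w) :
    ContinuousOn (fun t => (t - a) ^ (1 - Q) * cv a p w t) (Icc a b) := by
  intro t ht
  rcases ht.1.eq_or_lt with rfl | hat
  · rw [ContinuousWithinAt, cv_self, mul_zero]
    have hlim : Tendsto (fun t : ℝ => Cp * Cw * ProbabilityTheory.beta P Q * (t - a) ^ P)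
        (𝓝[Icc a b] a) (𝓝 0) := by
      have h1 : Continuous (fun t : ℝ => Cp * Cw * ProbabilityTheory.beta P Q * (t - a) ^ P) :=
        continuous_const.mul ((Real.continuous_rpow_const hP.le).comp (by fun_prop))
      have := h1.tendsto a
      rw [sub_self, Real.zero_rpow hP.ne', mul_zero] at this
      exact this.mono_left nhdsWithin_le_nhds
    refine squeeze_zero_norm' ?_ hlim
    filter_upwards [self_mem_nhdsWithin] with t ht
    rcases ht.1.eq_or_lt with rfl | hat
    · simp [Real.zero_rpow hP.ne']
    · have hta := sub_pos.2 hat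
      rw [norm_mul, Real.norm_eq_abs, abs_of_nonneg (by positivity), Real.norm_eq_abs]
      have := abs_cv_le hP hQ hat (hp.mono (by linarith [ht.2])) (hw.mono ht.2)
      calc _ ≤ (t - a) ^ (1 - Q) * (Cp * Cw * ProbabilityTheory.beta P Q
            * (t - a) ^ (P + Q - 1)) := by gcongr
        _ = Cp * Cw * ProbabilityTheory.beta P Q
            * ((t - a) ^ (1 - Q) * (t - a) ^ (P + Q - 1)) := by ring
        _ = _ := by rw [← Real.rpow_add hta]; ring_nf
  · refine ContinuousWithinAt.mul (ContinuousAt.continuousWithinAt ?_)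
      (continuousWithinAt_cv hP hP1 hQ hQ1 hpc hp hw ⟨hat, ht.2⟩)
    exact (Real.continuousAt_rpow_const _ _ (Or.inl (sub_pos.2 hat).ne')).comp
      (f := fun t => t - a) (by fun_prop)

end

/-- Fubini on the triangle `τ < s ≤ t`. The inner integral of the absolute values is a beta integral
of size `(t-τ)^(P+Q-1)`, which `hwi` makes integrable against `w`. No pointwise bound on `w` is
asked for, so `w` may be the derivative of an absolutely continuous state. -/
theorem cv_assoc {p q w : ℝ → ℝ} {a t P Q Cp Cq : ℝ} (hP : 0 < P) (hQ : 0 < Q) (hat : a ≤ t)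
    (hp : SingBound P 0 (t - a) Cp p) (hqm : Measurable q) (hq : SingBound Q 0 (t - a) Cq q)
    (hw : AEStronglyMeasurable w (volume.restrict (Ioc a t)))
    (hwi : IntervalIntegrable (fun τ => (t - τ) ^ (P + Q - 1) * |w τ|) volume a t) :
    cv a p (cv a q w) t = cv a (cv 0 p q) w t := by
  set μ : Measure ℝ := volume.restrict (Ioc a t) with hμ
  let Φ : ℝ → ℝ → ℝ := fun s τ => if τ < s then p (t - s) * (q (s - τ) * w τ) else 0
  have hΦm : AEStronglyMeasurable (Function.uncurry Φ) (μ.prod μ) := by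
    have hs : MeasurableSet {z : ℝ × ℝ | z.2 < z.1} := measurableSet_lt measurable_snd measurable_fst
    have h1 : AEStronglyMeasurable (fun z : ℝ × ℝ => p (t - z.1) * (q (z.1 - z.2) * w z.2))
        (μ.prod μ) := by
      refine AEStronglyMeasurable.mul (aestronglyMeasurable_comp_rsub hp.meas).comp_fst
        (AEStronglyMeasurable.mul ?_ hw.comp_snd)
      exact (hqm.comp (measurable_fst.sub measurable_snd)).aestronglyMeasurable
    exact h1.indicator hs
  have hb : ∀ τ ∈ Ioc a t, ∀ᵐ s ∂μ, ‖Φ s τ‖ ≤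
      (Ioc τ t).indicator (fun s => Cp * Cq * |w τ| * ((t - s) ^ (P - 1) * (s - τ) ^ (Q - 1))) s := by
    intro τ hτ
    filter_upwards [ae_restrict_mem measurableSet_Ioc,
      ae_restrict_of_ae (compl_mem_ae_iff.2 (measure_singleton t))] with s hs hst
    simp only [Φ]
    split_ifs with h
    · have hst' : 0 < t - s := sub_pos.2 (lt_of_le_of_ne hs.2 hst)
      rw [indicator_of_mem (show s ∈ Ioc τ t from ⟨h, hs.2⟩), Real.norm_eq_abs, abs_mul, abs_mul]
      have h1 := hp.bound (t - s) ⟨hst', by linarith [hs.1]⟩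
      have h2 := hq.bound (s - τ) ⟨by linarith, by linarith [hs.2, hτ.1]⟩
      rw [sub_zero] at h1 h2
      calc _ ≤ (Cp * (t - s) ^ (P - 1)) * ((Cq * (s - τ) ^ (Q - 1)) * |w τ|) := by
            apply mul_le_mul h1 _ (by positivity) ((abs_nonneg _).trans h1)
            gcongr
        _ = _ := by ring
    · rw [indicator_of_notMem (fun h2 => h h2.1)]; simp
  have hbi : ∀ τ ∈ Ioc a t, Integrable ((Ioc τ t).indicator
      (fun s => Cp * Cq * |w τ| * ((t - s) ^ (P - 1) * (s - τ) ^ (Q - 1)))) μ := by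
    intro τ hτ
    rw [integrable_indicator_iff measurableSet_Ioc, IntegrableOn, hμ,
      Measure.restrict_restrict measurableSet_Ioc,
      inter_eq_self_of_subset_left (Ioc_subset_Ioc_left hτ.1.le)]
    have := (intervalIntegrable_beta hP hQ hτ.2).const_mul (Cp * Cq * |w τ|)
    rwa [intervalIntegrable_iff_integrableOn_Ioc_of_le hτ.2] at this
  have hint : Integrable (Function.uncurry Φ) (μ.prod μ) := by
    rw [integrable_prod_iff' hΦm]
    constructor
    · have h1 := hΦm.prod_swap.prodMk_left
      filter_upwards [ae_restrict_mem measurableSet_Ioc, h1] with τ hτ h1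
      exact Integrable.mono' (hbi τ hτ) h1 (hb τ hτ)
    · have h3 : Integrable (fun τ => Cp * Cq * ProbabilityTheory.beta P Q
          * ((t - τ) ^ (P + Q - 1) * |w τ|)) μ := by
        have := hwi.const_mul (Cp * Cq * ProbabilityTheory.beta P Q)
        rwa [intervalIntegrable_iff_integrableOn_Ioc_of_le hat] at this
      refine Integrable.mono' h3 hΦm.norm.prod_swap.integral_prod_right' ?_
      filter_upwards [ae_restrict_mem measurableSet_Ioc,
        ae_restrict_of_ae (compl_mem_ae_iff.2 (measure_singleton t))] with τ hτ hτt
      have hτt' : τ < t := lt_of_le_of_ne hτ.2 hτt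
      rw [Real.norm_eq_abs, abs_of_nonneg (integral_nonneg fun s => norm_nonneg _)]
      calc ∫ s, ‖Φ s τ‖ ∂μ ≤ ∫ s, (Ioc τ t).indicator
            (fun s => Cp * Cq * |w τ| * ((t - s) ^ (P - 1) * (s - τ) ^ (Q - 1))) s ∂μ :=
            integral_mono_of_nonneg (Eventually.of_forall fun s => norm_nonneg _) (hbi τ hτ)
              (hb τ hτ)
        _ = ∫ s in τ..t, Cp * Cq * |w τ| * ((t - s) ^ (P - 1) * (s - τ) ^ (Q - 1)) := by
            rw [integral_indicator measurableSet_Ioc, hμ,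
              Measure.restrict_restrict measurableSet_Ioc,
              inter_eq_self_of_subset_left (Ioc_subset_Ioc_left hτ.1.le),
              intervalIntegral.integral_of_le hτ.2]
        _ = _ := by
            rw [intervalIntegral.integral_const_mul, integral_beta hP hQ hτt']; ring
  have hswap := integral_integral_swap hint
  have hL : cv a p (cv a q w) t = ∫ s, ∫ τ, Φ s τ ∂μ ∂μ := by
    rw [cv, intervalIntegral.integral_of_le hat]
    refine setIntegral_congr_fun measurableSet_Ioc fun s hs => ?_
    simp only [cv]
    rw [intervalIntegral.integral_of_le hs.1.le, ← integral_const_mul,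
      integral_Ioc_eq_integral_Ioo]
    have : ∀ τ, Φ s τ = (Iio s).indicator (fun τ => p (t - s) * (q (s - τ) * w τ)) τ := by
      intro τ
      simp only [Φ, indicator, mem_Iio]
    simp_rw [this]
    rw [integral_indicator measurableSet_Iio, hμ, Measure.restrict_restrict measurableSet_Iio]
    congr 2
    ext τ
    simp only [mem_Ioo, mem_inter_iff, mem_Iio, mem_Ioc]
    constructor
    · rintro ⟨h1, h2⟩; exact ⟨h2, h1, h2.le.trans hs.2⟩
    · rintro ⟨h1, h2, -⟩; exact ⟨h2, h1⟩
  have hR : cv a (cv 0 p q) w t = ∫ τ, ∫ s, Φ s τ ∂μ ∂μ := by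
    rw [cv, intervalIntegral.integral_of_le hat]
    refine setIntegral_congr_fun measurableSet_Ioc fun τ hτ => ?_
    simp only [cv]
    have h1 := intervalIntegral.integral_comp_sub_right (a := τ) (b := t)
      (fun s => p (t - τ - s) * q s) τ
    rw [sub_self] at h1
    rw [← h1, intervalIntegral.integral_of_le hτ.2, ← integral_mul_const]
    have : ∀ s, Φ s τ = (Ioi τ).indicator (fun s => p (t - s) * (q (s - τ) * w τ)) s := by
      intro s
      simp only [Φ, indicator, mem_Ioi]
    simp_rw [this]
    rw [integral_indicator measurableSet_Ioi, hμ, Measure.restrict_restrict measurableSet_Ioi,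
      show Ioi τ ∩ Ioc a t = Ioc τ t from ?_]
    · refine setIntegral_congr_fun measurableSet_Ioc fun s _ => ?_
      rw [show t - τ - (s - τ) = t - s by ring]
      ring
    · ext s
      simp only [mem_inter_iff, mem_Ioi, mem_Ioc]
      constructor
      · rintro ⟨h1, h2, h3⟩; exact ⟨h1, h3⟩
      · rintro ⟨h1, h2⟩; exact ⟨h1, hτ.1.trans h1, h2⟩
  rw [hL, hR, hswap]

/-- `e^(κ(t-a))` is a weight in which the Volterra operator with kernel `C s^(P-1)` acting on
functions of size `(s-a)^(Q-1)` has norm at most one half. -/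
def IsWeight (P Q a b C κ : ℝ) : Prop :=
  ∀ t ∈ Ioc a b,
    IntervalIntegrable (fun s => (t - s) ^ (P - 1) * (s - a) ^ (Q - 1) * Real.exp (κ * (s - a)))
      volume a t ∧
    C * ((t - a) ^ (1 - Q) * ∫ s in a..t, (t - s) ^ (P - 1) * (s - a) ^ (Q - 1)
      * Real.exp (κ * (s - a))) ≤ 2⁻¹ * Real.exp (κ * (t - a))

section
variable {p w w₁ w₂ : ℝ → ℝ} {a b t P Q C Λ K κ D₁ D₂ : ℝ}

/-- One application of the kernel halves the weighted size `K`. The fixed point argument and the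
convergence of the Picard iterates both rest on this. -/
theorem IsWeight.abs_cv_le (hκ : IsWeight P Q a b (C * Λ) κ) (hat : a < t) (htb : t ≤ b)
    (hK : 0 ≤ K) (hp : ∀ s ∈ Ioc 0 (t - a), |p s| ≤ C * s ^ (P - 1))
    (hw : ∀ s ∈ Ioc a t, |w s| ≤ Λ * (s - a) ^ (Q - 1) * (K * Real.exp (κ * (s - a)))) :
    (t - a) ^ (1 - Q) * |cv a p w t| ≤ 2⁻¹ * (K * Real.exp (κ * (t - a))) := by
  obtain ⟨hi, hle⟩ := hκ t ⟨hat, htb⟩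
  have hb : ∀ᵐ s, s ∈ Ioc a t → ‖p (t - s) * w s‖ ≤ C * Λ * K
      * ((t - s) ^ (P - 1) * (s - a) ^ (Q - 1) * Real.exp (κ * (s - a))) := by
    filter_upwards [compl_mem_ae_iff.2 (measure_singleton t)] with s hst hs
    have hst' : 0 < t - s := sub_pos.2 (lt_of_le_of_ne hs.2 hst)
    have h1 := hp (t - s) ⟨hst', by linarith [hs.1]⟩
    have h2 := hw s hs
    rw [Real.norm_eq_abs, abs_mul]
    calc _ ≤ (C * (t - s) ^ (P - 1)) * (Λ * (s - a) ^ (Q - 1) * (K * Real.exp (κ * (s - a)))) :=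
          mul_le_mul h1 h2 (abs_nonneg _) ((abs_nonneg _).trans h1)
      _ = _ := by ring
  have h := intervalIntegral.norm_integral_le_of_norm_le hat.le hb (hi.const_mul _)
  rw [intervalIntegral.integral_const_mul] at h
  have hta := sub_pos.2 hat
  calc (t - a) ^ (1 - Q) * |cv a p w t|
      ≤ (t - a) ^ (1 - Q) * (C * Λ * K * ∫ s in a..t, (t - s) ^ (P - 1) * (s - a) ^ (Q - 1)
        * Real.exp (κ * (s - a))) := by gcongr; exact h
    _ = K * (C * Λ * ((t - a) ^ (1 - Q) * ∫ s in a..t, (t - s) ^ (P - 1) * (s - a) ^ (Q - 1)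
        * Real.exp (κ * (s - a)))) := by ring
    _ ≤ K * (2⁻¹ * Real.exp (κ * (t - a))) := by gcongr
    _ = _ := by ring

theorem cv_sub (hP : 0 < P) (hQ : 0 < Q) (hat : a ≤ t) (hp : SingBound P 0 (t - a) C p)
    (h₁ : SingBound Q a t D₁ w₁) (h₂ : SingBound Q a t D₂ w₂) :
    cv a p (fun s => w₁ s - w₂ s) t = cv a p w₁ t - cv a p w₂ t := by
  simp only [cv, mul_sub]
  exact intervalIntegral.integral_sub (cv_intervalIntegrable hP hQ hat hp h₁)
    (cv_intervalIntegrable hP hQ hat hp h₂)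

theorem cv_add (hP : 0 < P) (hQ : 0 < Q) (hat : a ≤ t) (hp : SingBound P 0 (t - a) C p)
    (h₁ : SingBound Q a t D₁ w₁) (h₂ : SingBound Q a t D₂ w₂) :
    cv a p (fun s => w₁ s + w₂ s) t = cv a p w₁ t + cv a p w₂ t := by
  simp only [cv, mul_add]
  exact intervalIntegral.integral_add (cv_intervalIntegrable hP hQ hat hp h₁)
    (cv_intervalIntegrable hP hQ hat hp h₂)

theorem cv_const_mul (a c : ℝ) (p w : ℝ → ℝ) (t : ℝ) :
    cv a p (fun s => c * w s) t = c * cv a p w t := by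
  simp only [cv, ← intervalIntegral.integral_const_mul]
  congr 1; ext s; ring

theorem cv_const_mul_left (a c : ℝ) (p w : ℝ → ℝ) (t : ℝ) :
    cv a (fun s => c * p s) w t = c * cv a p w t := by
  simp only [cv, ← intervalIntegral.integral_const_mul]
  congr 1; ext s; ring

end

/-! ### Nonlinear Volterra equations and a singular Gronwall inequality -/

/-- Existence for the nonlinear weakly singular Volterra equation
`y(t) = y₀(t) + (t-a)^(1-Q) ∫_a^t p(t-s) G(s,y(s)) ds`. -/
theorem exists_volterra {p : ℝ → ℝ} {a b P Q C Λ D : ℝ} (hab : a ≤ b) (hP : 0 < P) (hP1 : P ≤ 1)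
    (hQ : 0 < Q) (hQ1 : Q ≤ 1) (hC : 0 ≤ C) (hΛ : 0 ≤ Λ) (hpc : ContinuousOn p (Ioi 0))
    (hp : SingBound P 0 (b - a) C p) {y₀ : ℝ → ℝ} (hy₀ : ContinuousOn y₀ (Icc a b))
    {G : ℝ → ℝ → ℝ}
    (hGm : ∀ y : ℝ → ℝ, Continuous y →
      AEStronglyMeasurable (fun s => G s (y s)) (volume.restrict (Ioc a b)))
    (hG0 : ∀ s ∈ Ioc a b, |G s 0| ≤ D * (s - a) ^ (Q - 1))
    (hGL : ∀ s ∈ Ioc a b, ∀ y y', |G s y - G s y'| ≤ Λ * (s - a) ^ (Q - 1) * |y - y'|) :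
    ∃ y : ℝ → ℝ, Continuous y ∧
      ∀ t ∈ Icc a b, y t = y₀ t + (t - a) ^ (1 - Q) * cv a p (fun s => G s (y s)) t := by
  obtain ⟨κ, hκ0, hκ⟩ : ∃ κ : ℝ, 0 ≤ κ ∧ IsWeight P Q a b (C * Λ) κ :=
    exists_weight hP hP1 hQ (by positivity)
  let E := C(Icc a b, ℝ)
  have : Nonempty (Icc a b) := ⟨⟨a, le_rfl, hab⟩⟩
  -- Writing `y = exp(κ(t-a)) η` makes the sup norm of `η` a weighted norm of `y`, in which the
  -- Volterra map contracts by `1/2` on the whole interval.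
  let ext : E → ℝ → ℝ := fun η s => Real.exp (κ * (s - a)) * IccExtend hab η s
  have hext : ∀ η : E, Continuous (ext η) := fun η => by
    have : Continuous (IccExtend hab η) := η.continuous.Icc_extend'
    exact (by fun_prop : Continuous fun s => Real.exp (κ * (s - a))).mul this
  have hsing : ∀ η : E, ∃ D', SingBound Q a b D' (fun s => G s (ext η s)) := by
    intro η
    obtain ⟨B, hB⟩ := isCompact_Icc.exists_bound_of_continuousOn
      (s := Icc a b) ((hext η).continuousOn)
    refine ⟨D + Λ * B, hGm _ (hext η), fun s hs => ?_⟩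
    have h1 := hGL s hs (ext η s) 0
    have h2 := hG0 s hs
    have h3 := hB s ⟨hs.1.le, hs.2⟩
    rw [sub_zero] at h1
    rw [Real.norm_eq_abs] at h3
    have hsa := sub_pos.2 hs.1
    calc |G s (ext η s)| = |(G s (ext η s) - G s 0) + G s 0| := by ring_nf
      _ ≤ |G s (ext η s) - G s 0| + |G s 0| := abs_add_le _ _
      _ ≤ Λ * (s - a) ^ (Q - 1) * B + D * (s - a) ^ (Q - 1) := by
          refine add_le_add (h1.trans ?_) h2
          gcongr
      _ = _ := by ring
  let Ψ0 : E → ℝ → ℝ := fun η t => Real.exp (-(κ * (t - a))) *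
    (y₀ t + (t - a) ^ (1 - Q) * cv a p (fun s => G s (ext η s)) t)
  have hΨ0 : ∀ η, ContinuousOn (Ψ0 η) (Icc a b) := by
    intro η
    obtain ⟨D', hD'⟩ := hsing η
    exact ContinuousOn.mul (by fun_prop)
      (hy₀.add (continuousOn_weighted_cv hP hP1 hQ hQ1 hpc hp hD'))
  let Ψ : E → E := fun η => ⟨(Icc a b).domRestrict (Ψ0 η), (hΨ0 η).domRestrict⟩
  have hcontr : ContractingWith (2⁻¹ : NNReal) Ψ := by
    refine ⟨by simpa using (inv_lt_one_of_one_lt₀ (one_lt_two : (1 : NNReal) < 2)),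
      LipschitzWith.of_dist_le_mul fun η ζ => ?_⟩
    rw [ContinuousMap.dist_le (by positivity)]
    rintro ⟨t, ht⟩
    have hd0 : 0 ≤ dist η ζ := dist_nonneg
    change |Ψ0 η t - Ψ0 ζ t| ≤ _
    rcases ht.1.eq_or_lt with rfl | hat
    · simp only [Ψ0, cv_self, sub_self, abs_zero]
      positivity
    · obtain ⟨D₁, hD₁⟩ := hsing η
      obtain ⟨D₂, hD₂⟩ := hsing ζ
      have hta := sub_pos.2 hat
      have h1 := cv_sub hP hQ hat.le (hp.mono (by linarith [ht.2])) (hD₁.mono ht.2)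
        (hD₂.mono ht.2)
      have h2 : Ψ0 η t - Ψ0 ζ t = Real.exp (-(κ * (t - a))) * ((t - a) ^ (1 - Q)
          * cv a p (fun s => G s (ext η s) - G s (ext ζ s)) t) := by
        rw [h1]; simp only [Ψ0]; ring
      have h3 := hκ.abs_cv_le (K := dist η ζ) (p := p)
        (w := fun s => G s (ext η s) - G s (ext ζ s)) hat ht.2 hd0
        (fun s hs => by simpa using hp.bound s ⟨hs.1, by linarith [hs.2, ht.2]⟩)
        (fun s hs => by
          refine (hGL s ⟨hs.1, hs.2.trans ht.2⟩ _ _).trans ?_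
          have hsa := sub_pos.2 hs.1
          gcongr
          simp only [ext]
          rw [← mul_sub, abs_mul, abs_of_pos (Real.exp_pos _), mul_comm]
          gcongr
          rw [IccExtend_of_mem hab _ ⟨hs.1.le, hs.2.trans ht.2⟩,
            IccExtend_of_mem hab _ ⟨hs.1.le, hs.2.trans ht.2⟩]
          exact ContinuousMap.dist_apply_le_dist (f := η) (g := ζ) _)
      rw [h2, abs_mul, abs_of_pos (Real.exp_pos _), abs_mul,
        abs_of_nonneg (by positivity : 0 ≤ (t - a) ^ (1 - Q))]
      calc _ ≤ Real.exp (-(κ * (t - a))) * (2⁻¹ * (dist η ζ * Real.exp (κ * (t - a)))) := by gcongr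
        _ = 2⁻¹ * dist η ζ * (Real.exp (-(κ * (t - a))) * Real.exp (κ * (t - a))) := by ring
        _ = _ := by rw [← Real.exp_add]; simp
  obtain ⟨η, hη⟩ : ∃ η, Ψ η = η := ⟨hcontr.fixedPoint Ψ, hcontr.fixedPoint_isFixedPt⟩
  refine ⟨ext η, hext η, fun t ht => ?_⟩
  have h1 : Ψ0 η t = η ⟨t, ht⟩ := congrArg (fun ζ : E => ζ ⟨t, ht⟩) hη
  calc ext η t = Real.exp (κ * (t - a)) * Ψ0 η t := by
        simp only [ext]; rw [IccExtend_of_mem hab _ ht, h1]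
    _ = (Real.exp (κ * (t - a)) * Real.exp (-(κ * (t - a))))
        * (y₀ t + (t - a) ^ (1 - Q) * cv a p (fun s => G s (ext η s)) t) := by
        simp only [Ψ0]; ring
    _ = _ := by rw [← Real.exp_add]; simp

/-- Gronwall's inequality for weakly singular kernels. -/
theorem exists_gronwall {a b P C : ℝ} (hP : 0 < P) (hP1 : P ≤ 1) (hC : 0 ≤ C) :
    ∃ K : ℝ, 0 ≤ K ∧ ∀ (b' D : ℝ) (w : ℝ → ℝ), b' ≤ b → ContinuousOn w (Icc a b') →
      (∀ t ∈ Icc a b', |w t| ≤ D + C * ∫ s in a..t, (t - s) ^ (P - 1) * |w s|) →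
      ∀ t ∈ Icc a b', |w t| ≤ K * D := by
  obtain ⟨κ, hκ0, hκ⟩ := exists_weight (a := a) (b := b) hP hP1 one_pos hC
  refine ⟨2 * Real.exp (κ * |b - a|), by positivity, fun b' D w hb' hw h t ht => ?_⟩
  have hab : a ≤ b' := ht.1.trans ht.2
  -- At a maximum point of `exp(-κ(t-a)) |w|` the integral term is at most half of the left-hand
  -- side and can be absorbed.
  obtain ⟨t₁, ht₁, hmax⟩ := isCompact_Icc.exists_isMaxOn (nonempty_Icc.2 hab)
    (f := fun t => Real.exp (-(κ * (t - a))) * |w t|)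
    (ContinuousOn.mul (by fun_prop) hw.abs)
  set W : ℝ := Real.exp (-(κ * (t₁ - a))) * |w t₁| with hW
  have hle : ∀ s ∈ Icc a b', |w s| ≤ W * Real.exp (κ * (s - a)) := by
    intro s hs
    have h1 : Real.exp (-(κ * (s - a))) * |w s| ≤ W := hmax hs
    calc |w s| = (Real.exp (-(κ * (s - a))) * |w s|) * Real.exp (κ * (s - a)) := by
          rw [mul_right_comm, ← Real.exp_add]; simp
      _ ≤ _ := by gcongr
  have hW0 : 0 ≤ W := by positivity
  have hw1 : |w t₁| = W * Real.exp (κ * (t₁ - a)) := by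
    rw [hW, mul_right_comm, ← Real.exp_add]; simp
  have hhalf : C * ∫ s in a..t₁, (t₁ - s) ^ (P - 1) * |w s|
      ≤ 2⁻¹ * (W * Real.exp (κ * (t₁ - a))) := by
    rcases ht₁.1.eq_or_lt with h0 | h0
    · rw [← h0, intervalIntegral.integral_same, mul_zero]; positivity
    obtain ⟨hi, hle'⟩ := hκ t₁ ⟨h0, ht₁.2.trans hb'⟩
    simp only [sub_self, Real.rpow_zero, mul_one, one_mul] at hi hle'
    have h2 : ∫ s in a..t₁, (t₁ - s) ^ (P - 1) * |w s|
        ≤ ∫ s in a..t₁, W * ((t₁ - s) ^ (P - 1) * Real.exp (κ * (s - a))) := by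
      apply intervalIntegral.integral_mono_on h0.le
      · refine (intervalIntegrable_rsub_rpow hP h0.le).mul_continuousOn ?_
        rw [uIcc_of_le h0.le]
        exact hw.abs.mono (Icc_subset_Icc_right ht₁.2)
      · exact hi.const_mul W
      · intro s hs
        have h3 := hle s ⟨hs.1, hs.2.trans ht₁.2⟩
        have h4 : 0 ≤ (t₁ - s) ^ (P - 1) := Real.rpow_nonneg (sub_nonneg.2 hs.2) _
        calc _ ≤ (t₁ - s) ^ (P - 1) * (W * Real.exp (κ * (s - a))) := by gcongr
          _ = _ := by ring
    rw [intervalIntegral.integral_const_mul] at h2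
    calc _ ≤ C * (W * ∫ s in a..t₁, (t₁ - s) ^ (P - 1) * Real.exp (κ * (s - a))) := by gcongr
      _ = W * (C * ∫ s in a..t₁, (t₁ - s) ^ (P - 1) * Real.exp (κ * (s - a))) := by ring
      _ ≤ W * (2⁻¹ * Real.exp (κ * (t₁ - a))) := by gcongr
      _ = _ := by ring
  have h5 := h t₁ ht₁
  have hexp1 : 1 ≤ Real.exp (κ * (t₁ - a)) :=
    Real.one_le_exp (mul_nonneg hκ0 (sub_nonneg.2 ht₁.1))
  have hWD : W ≤ 2 * D := by
    have : W ≤ W * Real.exp (κ * (t₁ - a)) := le_mul_of_one_le_right hW0 hexp1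
    linarith
  have hD : 0 ≤ D := by linarith
  calc |w t| ≤ W * Real.exp (κ * (t - a)) := hle t ht
    _ ≤ (2 * D) * Real.exp (κ * |b - a|) := by
        gcongr
        exact (sub_le_sub_right (ht.2.trans hb') a).trans (le_abs_self _)
    _ = _ := by ring

/-! ### The Caputo kernel and its resolvent -/

/-- The kernel `t^(-α)/Γ(1-α)` of the fractional integral of order `1-α`. -/
def gker (α t : ℝ) : ℝ := (Real.Gamma (1 - α))⁻¹ * t ^ (-α)

theorem measurable_gker (α : ℝ) : Measurable (gker α) :=
  (measurable_id.pow_const (-α)).const_mul _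

theorem continuousOn_gker (α : ℝ) : ContinuousOn (gker α) (Ioi 0) := fun t ht =>
  (continuousAt_const.mul
    (Real.continuousAt_rpow_const t (-α) (Or.inl (ne_of_gt ht)))).continuousWithinAt

theorem singBound_gker {α : ℝ} (hα : α ∈ Ioo (0 : ℝ) 1) (R : ℝ) :
    SingBound (1 - α) 0 R (Real.Gamma (1 - α))⁻¹ (gker α) := by
  refine ⟨(measurable_gker α).aestronglyMeasurable, fun s hs => ?_⟩
  have h1 : 0 < Real.Gamma (1 - α) := Real.Gamma_pos_of_pos (by linarith [hα.2])
  have hs0 : 0 < s := hs.1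
  rw [gker, abs_of_nonneg (by positivity), sub_zero, show 1 - α - 1 = -α by ring]

theorem singBound_one (a R : ℝ) : SingBound 1 a R 1 (fun _ => 1) :=
  ⟨aestronglyMeasurable_const, fun s _ => by simp⟩

theorem cv_one (a : ℝ) (w : ℝ → ℝ) (t : ℝ) : cv a (fun _ => 1) w t = ∫ s in a..t, w s := by
  simp [cv]

theorem intervalIntegrable_rpow_mul {P a t : ℝ} {w : ℝ → ℝ} (hP : 1 ≤ P)
    (hw : IntervalIntegrable w volume a t) :
    IntervalIntegrable (fun τ => (t - τ) ^ (P - 1) * |w τ|) volume a t := by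
  refine hw.abs.continuousOn_mul ?_
  exact ((Real.continuous_rpow_const (by linarith)).comp (by fun_prop)).continuousOn

/-- Swapping a fractional kernel with integration. -/
theorem cv_integral {p w : ℝ → ℝ} {a t P C : ℝ} (hP : 0 < P) (hat : a ≤ t) (hpm : Measurable p)
    (hp : SingBound P 0 (t - a) C p) (hw : IntervalIntegrable w volume a t) :
    cv a p (fun s => ∫ τ in a..s, w τ) t = ∫ s in a..t, cv a p w s := by
  have hwm : AEStronglyMeasurable w (volume.restrict (Ioc a t)) := by
    rw [intervalIntegrable_iff_integrableOn_Ioc_of_le hat] at hw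
    exact hw.aestronglyMeasurable
  have h1 : (fun s => ∫ τ in a..s, w τ) = cv a (fun _ => 1) w := by
    ext s; rw [cv_one]
  rw [h1, ← cv_one, cv_assoc hP one_pos hat hp measurable_const (singBound_one 0 _) hwm
    (intervalIntegrable_rpow_mul (by linarith) hw),
    cv_assoc one_pos hP hat (singBound_one 0 _) hpm hp hwm
    (intervalIntegrable_rpow_mul (by linarith) hw)]
  congr 1
  ext s
  exact cv_comm _ _ _

/-- `k` is the fundamental solution of `M x' + N ᶜD^α x`: `M k + N g * k = 1` on `(0,R]`. -/
structure IsResolvent (α M N R C : ℝ) (k : ℝ → ℝ) : Prop where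
  meas : Measurable k
  cont : ContinuousOn k (Ioi 0)
  sing : SingBound α 0 R C k
  eq : ∀ t ∈ Ioc 0 R, M * k t + N * cv 0 (gker α) k t = 1

/-- Abel inversion: the convolution of `t^(-α)` with `t^(α-1)` is a beta integral whose power of `t`
is zero, hence the constant `Γ(1-α) Γ(α)`. -/
theorem isResolvent_of_eq_zero {α N : ℝ} (hα : α ∈ Ioo (0 : ℝ) 1) (hN : N ≠ 0) (R : ℝ) :
    IsResolvent α 0 N R (|N|⁻¹ * (Real.Gamma α)⁻¹)
      (fun t => N⁻¹ * (Real.Gamma α)⁻¹ * t ^ (α - 1)) := by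
  have h1 : 0 < Real.Gamma α := Real.Gamma_pos_of_pos hα.1
  have h2 : 0 < Real.Gamma (1 - α) := Real.Gamma_pos_of_pos (by linarith [hα.2])
  refine ⟨(measurable_id.pow_const _).const_mul _, fun t ht => ?_, ⟨?_, fun s hs => ?_⟩,
    fun t ht => ?_⟩
  · exact (continuousAt_const.mul
      (Real.continuousAt_rpow_const t (α - 1) (Or.inl (ne_of_gt ht)))).continuousWithinAt
  · exact ((measurable_id.pow_const _).const_mul _).aestronglyMeasurable
  · have hs0 : 0 < s := hs.1
    rw [sub_zero, abs_mul, abs_mul, abs_inv, abs_inv, abs_of_pos h1,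
      abs_of_pos (Real.rpow_pos_of_pos hs0 _)]
  · have h3 := integral_beta_zero (P := 1 - α) (Q := α) (by linarith [hα.2]) hα.1 ht.1
    rw [show 1 - α + α - 1 = 0 by ring, Real.rpow_zero, one_mul, ProbabilityTheory.beta,
      show 1 - α + α = 1 by ring, Real.Gamma_one, div_one, show 1 - α - 1 = -α by ring] at h3
    have h4 : cv 0 (gker α) (fun t => N⁻¹ * (Real.Gamma α)⁻¹ * t ^ (α - 1)) t
        = (Real.Gamma (1 - α))⁻¹ * (N⁻¹ * (Real.Gamma α)⁻¹)
          * ∫ s in (0 : ℝ)..t, (t - s) ^ (-α) * s ^ (α - 1) := by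
      rw [cv, ← intervalIntegral.integral_const_mul]
      congr 1; ext s; rw [gker]; ring
    rw [h4, h3]
    field_simp
    ring

/-- Seeking `k` as a primitive with initial value `1/M` reduces `M k + N g * k = 1` to the Volterra
equation `M r + N (g/M + g * r) = 0` for its derivative. It is solved for the continuous function `y
= s^α r`. That `k` is a primitive is what later gives velocities and the absolute continuity of the
multiplier when `M ≠ 0`. -/
theorem exists_resolvent_of_ne_zero {α M : ℝ} (hα : α ∈ Ioo (0 : ℝ) 1) (hM : M ≠ 0) (N : ℝ)
    {R : ℝ} (hR : 0 < R) :
    ∃ (k r : ℝ → ℝ) (C : ℝ), IsResolvent α M N R C k ∧ Measurable r ∧ ContinuousOn r (Ioi 0) ∧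
      SingBound (1 - α) 0 R C r ∧ (N = 0 → r = 0) ∧ Continuous k ∧
      ∀ t, k t = M⁻¹ + ∫ s in (0 : ℝ)..t, r s := by
  have hα' : 0 < 1 - α := by linarith [hα.2]
  have hΓ : 0 < Real.Gamma (1 - α) := Real.Gamma_pos_of_pos hα'
  obtain ⟨y, hyc, hy⟩ := exists_volterra (p := gker α) (a := 0) (b := R) (P := 1 - α) (Q := 1 - α)
    (C := (Real.Gamma (1 - α))⁻¹) (Λ := |N / M|) (D := 0)
    (G := fun s y => -(N / M) * (s ^ (-α) * y))
    (y₀ := fun _ => -(N / M) * (M⁻¹ * (Real.Gamma (1 - α))⁻¹)) hR.le hα' (by linarith [hα.1]) hα'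
    (by linarith [hα.1]) (by positivity) (abs_nonneg _) (continuousOn_gker α)
    (by rw [sub_zero]; exact singBound_gker hα R) continuousOn_const
    (fun y hy => (((measurable_id.pow_const (-α)).mul hy.measurable).const_mul
      _).aestronglyMeasurable)
    (fun s hs => by simp)
    (fun s hs y y' => by
      have hs0 : 0 < s := hs.1
      rw [← mul_sub, ← mul_sub, abs_mul, abs_mul, abs_neg, sub_zero,
        abs_of_pos (Real.rpow_pos_of_pos hs0 _), show 1 - α - 1 = -α by ring, mul_assoc])
  -- The Volterra solution is controlled only on `[0,R]`, whereas for `N = 0` the derivative `r` has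
  -- to vanish identically; the constants are supplied directly.
  by_cases hN : N = 0
  · refine ⟨fun _ => M⁻¹, 0, |M⁻¹| * R ^ (1 - α), ⟨measurable_const, continuousOn_const,
      ⟨aestronglyMeasurable_const, fun s hs => ?_⟩, fun t ht => ?_⟩, measurable_const,
      continuousOn_const, ⟨aestronglyMeasurable_const, fun s hs => ?_⟩, fun _ => rfl,
      continuous_const, fun t => by simp⟩
    · have hs0 : 0 < s := hs.1
      rw [sub_zero, mul_assoc]
      apply le_mul_of_one_le_right (abs_nonneg _)
      calc (1 : ℝ) = s ^ (1 - α) * s ^ (α - 1) := by rw [← Real.rpow_add hs0]; simp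
        _ ≤ R ^ (1 - α) * s ^ (α - 1) := by gcongr; exact hs.2
    · simp [hN, hM]
    · have hs0 : 0 < s := hs.1
      rw [sub_zero, Pi.zero_apply, abs_zero]
      positivity
  set r : ℝ → ℝ := fun s => s ^ (-α) * y s with hr
  have hri : ∀ c d, IntervalIntegrable r volume c d := fun c d =>
    (intervalIntegral.intervalIntegrable_rpow' (by linarith [hα.2])).mul_continuousOn
      hyc.continuousOn
  have hrm : Measurable r := (measurable_id.pow_const (-α)).mul hyc.measurable
  have hrc : ContinuousOn r (Ioi 0) := fun t ht =>
    ((Real.continuousAt_rpow_const t (-α) (Or.inl (ne_of_gt ht))).mul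
      hyc.continuousAt).continuousWithinAt
  set k : ℝ → ℝ := fun t => M⁻¹ + ∫ s in (0 : ℝ)..t, r s with hk
  have hkc : Continuous k := continuous_const.add (intervalIntegral.continuous_primitive hri 0)
  obtain ⟨B, hB⟩ := isCompact_Icc.exists_bound_of_continuousOn (s := Icc 0 R) hyc.continuousOn
  obtain ⟨B', hB'⟩ := isCompact_Icc.exists_bound_of_continuousOn (s := Icc 0 R) hkc.continuousOn
  have hB'0 : 0 ≤ B' := (norm_nonneg _).trans (hB' 0 ⟨le_rfl, hR.le⟩)
  have hB0 : 0 ≤ B := (norm_nonneg _).trans (hB 0 ⟨le_rfl, hR.le⟩)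
  have hrs : SingBound (1 - α) 0 R (max B (B' * R ^ (1 - α))) r := by
    refine ⟨hrm.aestronglyMeasurable, fun s hs => ?_⟩
    have hs0 : 0 < s := hs.1
    rw [hr, sub_zero, show 1 - α - 1 = -α by ring, abs_mul,
      abs_of_pos (Real.rpow_pos_of_pos hs0 _), mul_comm]
    gcongr
    exact (hB s ⟨hs.1.le, hs.2⟩).trans (le_max_left _ _)
  have hks : SingBound α 0 R (max B (B' * R ^ (1 - α))) k := by
    refine ⟨hkc.aestronglyMeasurable, fun s hs => ?_⟩
    have hs0 : 0 < s := hs.1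
    rw [sub_zero]
    calc |k s| ≤ B' := hB' s ⟨hs.1.le, hs.2⟩
      _ = B' * (s ^ (1 - α) * s ^ (α - 1)) := by rw [← Real.rpow_add hs0]; simp
      _ ≤ B' * (R ^ (1 - α) * s ^ (α - 1)) := by gcongr; exact hs.2
      _ = B' * R ^ (1 - α) * s ^ (α - 1) := by ring
      _ ≤ _ := by gcongr; exact le_max_right _ _
  refine ⟨k, r, _, ⟨hkc.measurable, hkc.continuousOn, hks, fun t ht => ?_⟩, hrm, hrc, hrs,
    fun h => absurd h hN, hkc, fun t => rfl⟩
  -- The equation of `y` multiplied by `s^(-α)` is the differentiated resolvent identity;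
  -- integrating it from `0` gives the identity itself.
  have hreq : ∀ s ∈ Ioc 0 t, M * r s + N * (M⁻¹ * gker α s + cv 0 (gker α) r s) = 0 := by
    intro s hs
    have hs0 : 0 < s := hs.1
    have h1 := hy s ⟨hs.1.le, hs.2.trans ht.2⟩
    rw [cv_const_mul, sub_zero, show 1 - (1 - α) = α by ring] at h1
    have h2 : s ^ (-α) * s ^ α = 1 := by rw [← Real.rpow_add hs0]; simp
    have h3 : r s = -(N / M) * (M⁻¹ * gker α s) + -(N / M) * cv 0 (gker α) r s := by
      simp only [hr, gker] at h1 ⊢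
      calc s ^ (-α) * y s = s ^ (-α) * (-(N / M) * (M⁻¹ * (Real.Gamma (1 - α))⁻¹))
          + (s ^ (-α) * s ^ α) * (-(N / M) * cv 0 (gker α) (fun s => s ^ (-α) * y s) s) := by
            rw [h1]; ring_nf
        _ = _ := by rw [h2]; ring_nf
    rw [h3]
    field_simp
    ring
  have hgs : SingBound (1 - α) 0 (t - 0) (Real.Gamma (1 - α))⁻¹ (gker α) := by
    rw [sub_zero]; exact singBound_gker hα t
  have hgi : IntervalIntegrable (gker α) volume 0 t :=
    (singBound_gker hα t).intervalIntegrable hα' ht.1.le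
  have hrb := hrs.mono ht.2
  have h4 : cv 0 (gker α) k t = ∫ s in (0 : ℝ)..t, (M⁻¹ * gker α s + cv 0 (gker α) r s) := by
    have hp1 : SingBound 1 0 t (|M⁻¹|) (fun _ => M⁻¹) :=
      ⟨aestronglyMeasurable_const, fun s _ => by simp⟩
    have hc : Continuous (fun s => ∫ τ in (0 : ℝ)..s, r τ) :=
      intervalIntegral.continuous_primitive hri 0
    obtain ⟨B₂, hB₂⟩ := isCompact_Icc.exists_bound_of_continuousOn (s := Icc 0 t) hc.continuousOn
    have hp2 : SingBound 1 0 t B₂ (fun s => ∫ τ in (0 : ℝ)..s, r τ) :=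
      ⟨hc.aestronglyMeasurable, fun s hs => by simpa using hB₂ s ⟨hs.1.le, hs.2⟩⟩
    rw [hk, cv_add hα' one_pos ht.1.le hgs hp1 hp2,
      cv_integral hα' ht.1.le (measurable_gker α) hgs (hri 0 t),
      intervalIntegral.integral_add (hgi.const_mul _),
      intervalIntegral.integral_const_mul, ← cv_one 0 (gker α), cv_comm (fun _ => 1),
      ← cv_const_mul]
    · simp
    · have h5 : IntervalIntegrable (fun s => -(N⁻¹ * (M * r s)) - M⁻¹ * gker α s) volume 0 t :=
        (((hri 0 t).const_mul M).const_mul N⁻¹).neg.sub (hgi.const_mul _)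
      refine h5.congr_ae ?_
      rw [uIoc_of_le ht.1.le]
      filter_upwards [ae_restrict_mem measurableSet_Ioc] with s hs
      have := hreq s hs
      field_simp at this ⊢
      linarith
  have h6 : M * k t + N * cv 0 (gker α) k t
      = 1 + ∫ s in (0 : ℝ)..t, (M * r s + N * (M⁻¹ * gker α s + cv 0 (gker α) r s)) := by
    rw [h4, intervalIntegral.integral_add ((hri 0 t).const_mul M),
      intervalIntegral.integral_const_mul, intervalIntegral.integral_const_mul, hk]
    · simp only
      rw [mul_add, mul_inv_cancel₀ hM]; ring
    · refine ((hri 0 t).const_mul M).neg.congr_ae ?_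
      rw [uIoc_of_le ht.1.le]
      filter_upwards [ae_restrict_mem measurableSet_Ioc] with s hs
      have := hreq s hs
      simp only [Pi.neg_apply]
      linarith
  rw [h6, intervalIntegral.integral_congr_ae (g := fun _ => 0), intervalIntegral.integral_zero,
    add_zero]
  rw [uIoc_of_le ht.1.le]
  exact Eventually.of_forall hreq

/-! ### From the control system to a Volterra equation and back -/

theorem eqOn_zero_of_integral_eq_zero {φ : ℝ → ℝ} {a b : ℝ} (hc : ContinuousOn φ (Ioc a b))
    (hi : IntervalIntegrable φ volume a b) (h : ∀ t ∈ Icc a b, ∫ s in a..t, φ s = 0) :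
    ∀ t ∈ Ioc a b, φ t = 0 := by
  intro t ht
  have hab : a < b := ht.1.trans_le ht.2
  have h1 : ∀ t ∈ Ioo a b, φ t = 0 := by
    intro t ht
    have hcd : ContinuousAt φ t := hc.continuousAt (Ioc_mem_nhds ht.1 ht.2)
    have hit : IntervalIntegrable φ volume a t := hi.mono_set (by
      rw [uIcc_of_le ht.1.le, uIcc_of_le hab.le]; exact Icc_subset_Icc_right ht.2.le)
    have hd : HasDerivAt (fun t => ∫ s in a..t, φ s) (φ t) t :=
      intervalIntegral.integral_hasDerivAt_right hit
        (hc.mono Ioo_subset_Ioc_self |>.stronglyMeasurableAtFilter isOpen_Ioo t ht) hcd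
    have h0 : HasDerivAt (fun t => ∫ s in a..t, φ s) 0 t := by
      refine (hasDerivAt_const t (0 : ℝ)).congr_of_eventuallyEq ?_
      filter_upwards [Icc_mem_nhds ht.1 ht.2] with s hs using h s hs
    exact hd.unique h0
  rcases ht.2.eq_or_lt with rfl | htb
  · have h2 : Tendsto φ (𝓝[<] t) (𝓝 (φ t)) :=
      (hc t ht).mono_left (nhdsWithin_le_of_mem (by
        filter_upwards [Ioo_mem_nhdsLT hab] with s hs using ⟨hs.1, hs.2.le⟩))
    have h3 : Tendsto φ (𝓝[<] t) (𝓝 0) := by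
      refine tendsto_const_nhds.congr' ?_
      filter_upwards [Ioo_mem_nhdsLT hab] with s hs using (h1 s hs).symm
    exact tendsto_nhds_unique h2 h3
  · exact h1 t ⟨ht.1, htb⟩

section
variable {p w : ℝ → ℝ} {a b t P Q Cp Cw : ℝ}

theorem SingBound.cv (hP : 0 < P) (hP1 : P ≤ 1) (hQ : 0 < Q) (hQ1 : Q ≤ 1)
    (hpc : ContinuousOn p (Ioi 0)) (hp : SingBound P 0 (b - a) Cp p) (hw : SingBound Q a b Cw w) :
    SingBound (P + Q) a b (Cp * Cw * ProbabilityTheory.beta P Q) (cv a p w) := by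
  refine ⟨?_, fun s hs => abs_cv_le hP hQ hs.1 (hp.mono (by linarith [hs.2])) (hw.mono hs.2)⟩
  have hc : ContinuousOn (FracOC.cv a p w) (Ioc a b) := fun s hs =>
    (continuousWithinAt_cv hP hP1 hQ hQ1 hpc hp hw hs).mono Ioc_subset_Icc_self
  exact hc.aestronglyMeasurable measurableSet_Ioc

end

section
variable {α M N R C : ℝ} {k : ℝ → ℝ} {a t Q Cw : ℝ} {w : ℝ → ℝ}

/-- The resolvent identity at `t - s` is integrated against `w(s)`. The next two lemmas are the same
identity with the triple convolution bracketed in the two possible ways. -/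
theorem IsResolvent.cv_kernel (hk : IsResolvent α M N R C k) (hα : α ∈ Ioo (0 : ℝ) 1)
    (hat : a ≤ t) (htR : t - a ≤ R) (hQ : 0 < Q) (hw : SingBound Q a t Cw w) :
    M * cv a k w t + N * cv a (cv 0 (gker α) k) w t = ∫ s in a..t, w s := by
  have hα' : 0 < 1 - α := by linarith [hα.2]
  have hks : SingBound α 0 (t - a) C k := hk.sing.mono htR
  have hgk : SingBound (1 - α + α) 0 (t - a) _ (cv 0 (gker α) k) :=
    SingBound.cv hα' (by linarith [hα.1]) hα.1 hα.2.le (continuousOn_gker α)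
      (by rw [sub_zero]; exact singBound_gker hα _) hks
  rw [cv, cv, ← intervalIntegral.integral_const_mul, ← intervalIntegral.integral_const_mul,
    ← intervalIntegral.integral_add
      ((cv_intervalIntegrable hα.1 hQ hat hks hw).const_mul M)
      ((cv_intervalIntegrable (by linarith) hQ hat hgk hw).const_mul N)]
  apply intervalIntegral.integral_congr_ae
  rw [uIoc_of_le hat]
  filter_upwards [compl_mem_ae_iff.2 (measure_singleton t)] with s hst hs
  have hst' : 0 < t - s := sub_pos.2 (lt_of_le_of_ne hs.2 hst)
  have := hk.eq (t - s) ⟨hst', by linarith [hs.1]⟩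
  linear_combination (w s) * this

theorem IsResolvent.cv_gker_cv (hk : IsResolvent α M N R C k) (hα : α ∈ Ioo (0 : ℝ) 1)
    (hat : a ≤ t) (htR : t - a ≤ R) (hQ : 0 < Q) (hw : SingBound Q a t Cw w) :
    M * cv a k w t + N * cv a (gker α) (cv a k w) t = ∫ s in a..t, w s := by
  rw [cv_assoc (P := 1 - α) (Q := α) (by linarith [hα.2]) hα.1 hat (singBound_gker hα _) hk.meas
    (hk.sing.mono htR) hw.meas
    (intervalIntegrable_rpow_mul (by linarith) (hw.intervalIntegrable hQ hat))]
  exact hk.cv_kernel hα hat htR hQ hw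

theorem IsResolvent.cv_cv_gker (hk : IsResolvent α M N R C k) (hα : α ∈ Ioo (0 : ℝ) 1)
    (hat : a ≤ t) (htR : t - a ≤ R) (hQ : 0 < Q) (hw : SingBound Q a t Cw w) :
    M * cv a k w t + N * cv a k (cv a (gker α) w) t = ∫ s in a..t, w s := by
  rw [cv_assoc (P := α) (Q := 1 - α) hα.1 (by linarith [hα.2]) hat (hk.sing.mono htR)
    (measurable_gker α) (singBound_gker hα _) hw.meas
    (intervalIntegrable_rpow_mul (by linarith) (hw.intervalIntegrable hQ hat))]
  have : cv 0 k (gker α) = cv 0 (gker α) k := by ext s; exact cv_comm _ _ _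
  rw [this]
  exact hk.cv_kernel hα hat htR hQ hw

end

theorem caputoLeft_eq_cv (α a : ℝ) (x : ℝ → ℝ) (t : ℝ) :
    caputoLeft α a x t = cv a (gker α) (deriv x) t := by
  rw [caputoLeft, cv, ← intervalIntegral.integral_const_mul]
  congr 1; ext s; rw [gker]; ring

theorem singBound_one_of_bound {a b B : ℝ} {w : ℝ → ℝ}
    (hm : AEStronglyMeasurable w (volume.restrict (Ioc a b))) (hB : ∀ s ∈ Ioc a b, |w s| ≤ B) :
    SingBound 1 a b B w := ⟨hm, fun s hs => by simpa using hB s hs⟩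

theorem exists_singBound_one_of_continuousOn {a b : ℝ} {w : ℝ → ℝ}
    (hw : ContinuousOn w (Icc a b)) : ∃ B, SingBound 1 a b B w := by
  obtain ⟨B, hB⟩ := isCompact_Icc.exists_bound_of_continuousOn hw
  exact ⟨B, singBound_one_of_bound
    ((hw.mono Ioc_subset_Icc_self).aestronglyMeasurable measurableSet_Ioc)
    fun s hs => hB s ⟨hs.1.le, hs.2⟩⟩

theorem derivWithin_Icc_eq_deriv {x : ℝ → ℝ} {a T t : ℝ} (ht : t ∈ Ioo a T) :
    derivWithin x (Icc a T) t = deriv x t :=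
  derivWithin_of_mem_nhds (Icc_mem_nhds ht.1 ht.2)

/-- Admissible trajectories solve the Volterra equation with the resolvent kernel. -/
theorem IsAdmissible.eq_volterra {α a M N xa R C B : ℝ} {f : ℝ → ℝ → ℝ → ℝ} {D : Finset ℝ}
    {x u k F : ℝ → ℝ} {T : ℝ} (h : IsAdmissible α a M N xa f D x u T) (hα : α ∈ Ioo (0 : ℝ) 1)
    (hk : IsResolvent α M N R C k) (hTR : T - a ≤ R) (hF : SingBound 1 a T B F)
    (hFf : ∀ t ∈ Icc a T, F t = f t (x t) (u t)) :
    ∀ t ∈ Icc a T, x t = xa + cv a k F t := by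
  have hα' : 0 < 1 - α := by linarith [hα.2]
  have haT : a < T := h.lt
  have hdi : IntervalIntegrable (deriv x) volume a T := h.absCont.intervalIntegrable_deriv
  have hxc : ContinuousOn x (Icc a T) := by
    have := h.absCont.continuousOn
    rwa [uIcc_of_le haT.le] at this
  have hint : ∀ t ∈ Icc a T, ∫ s in a..t, deriv x s = x t - xa := by
    intro t ht
    rw [← h.init]
    refine (h.absCont.mono ?_).integral_deriv_eq_sub
    rw [uIcc_of_le ht.1, uIcc_of_le haT.le]
    exact Icc_subset_Icc_right ht.2
  -- The system is needed only almost everywhere, so the set `D` and the end point, where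
  -- derivatives are one-sided, play no role.
  have hae : ∀ᵐ s, s ∈ Ioc a T → M * deriv x s + N * cv a (gker α) (deriv x) s = F s := by
    filter_upwards [compl_mem_ae_iff.2 (measure_singleton T),
      compl_mem_ae_iff.2 (D.finite_toSet.measure_zero volume)] with s hsT hsD hs
    have hs' : s ∈ Ioo a T := ⟨hs.1, lt_of_le_of_ne hs.2 hsT⟩
    rw [hFf s ⟨hs.1.le, hs.2⟩, ← h.dynamics s ⟨hs.1.le, hs.2⟩ (by simpa using hsD),
      derivWithin_Icc_eq_deriv hs', caputoLeft_eq_cv]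
  have hFi := hF.intervalIntegrable one_pos haT.le
  obtain ⟨BX, hBX⟩ := exists_singBound_one_of_continuousOn (w := fun s => x s - xa)
    (hxc.sub continuousOn_const)
  -- Integrating once, with `X = x - xa`, gives `∫ F = M X + N g * X` and removes the derivative of
  -- `x`, which is merely integrable.
  have hFX : ∀ t ∈ Icc a T, ∫ s in a..t, F s
      = M * (x t - xa) + N * cv a (gker α) (fun s => x s - xa) t := by
    intro t ht
    have hsub : uIcc a t ⊆ uIcc a T := by
      rw [uIcc_of_le ht.1, uIcc_of_le haT.le]; exact Icc_subset_Icc_right ht.2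
    have h1 : cv a (gker α) (fun s => x s - xa) t = ∫ s in a..t, cv a (gker α) (deriv x) s := by
      rw [← cv_integral hα' ht.1 (measurable_gker α) (singBound_gker hα _) (hdi.mono_set hsub)]
      exact cv_congr_right ht.1 fun s hs => (hint s ⟨hs.1.le, hs.2.trans ht.2⟩).symm
    have h2 : IntervalIntegrable (fun s => N * cv a (gker α) (deriv x) s) volume a t := by
      refine ((hFi.sub (hdi.const_mul M)).mono_set hsub).congr_ae ?_
      rw [uIoc_of_le ht.1]
      filter_upwards [ae_restrict_mem measurableSet_Ioc, ae_restrict_of_ae hae] with s hs hs2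
      rw [← hs2 ⟨hs.1, hs.2.trans ht.2⟩]; ring
    rw [h1, ← hint t ht, ← intervalIntegral.integral_const_mul,
      ← intervalIntegral.integral_const_mul,
      ← intervalIntegral.integral_add ((hdi.mono_set hsub).const_mul M) h2]
    apply intervalIntegral.integral_congr_ae
    rw [uIoc_of_le ht.1]
    filter_upwards [hae] with s hs hs2 using (hs ⟨hs2.1, hs2.2.trans ht.2⟩).symm
  have hkTR : SingBound α 0 (T - a) C k := hk.sing.mono hTR
  have hcvc : ContinuousOn (cv a k F) (Icc a T) := by
    have := continuousOn_weighted_cv hα.1 hα.2.le one_pos le_rfl hk.cont hkTR hF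
    simpa using this
  have hcvi : ∀ t ∈ Icc a T, IntervalIntegrable (cv a k F) volume a t := fun t ht =>
    (hcvc.mono (Icc_subset_Icc_right ht.2)).intervalIntegrable_of_Icc ht.1
  have hXi : ∀ t ∈ Icc a T, IntervalIntegrable (fun s => x s - xa) volume a t := fun t ht =>
    ((hxc.sub continuousOn_const).mono (Icc_subset_Icc_right ht.2)).intervalIntegrable_of_Icc ht.1
  -- Convolution with `k` gives `∫ (k * F) = k * ∫ F = M k * X + N k * (g * X) = ∫ X`, so the
  -- continuous functions `k * F` and `X` have the same primitive.
  have hzero : ∀ t ∈ Icc a T, ∫ s in a..t, (cv a k F s - (x s - xa)) = 0 := by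
    intro t ht
    have hsub : uIcc a t ⊆ uIcc a T := by
      rw [uIcc_of_le ht.1, uIcc_of_le haT.le]; exact Icc_subset_Icc_right ht.2
    rw [intervalIntegral.integral_sub (hcvi t ht) (hXi t ht),
      ← cv_integral hα.1 ht.1 hk.meas (hkTR.mono (by linarith [ht.2])) (hFi.mono_set hsub),
      cv_congr_right ht.1 (fun s hs => hFX s ⟨hs.1.le, hs.2.trans ht.2⟩)]
    have hXt := hBX.mono ht.2
    have hgX : SingBound (1 - α + 1) a t _ (cv a (gker α) (fun s => x s - xa)) :=
      SingBound.cv hα' (by linarith [hα.1]) one_pos le_rfl (continuousOn_gker α)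
        (singBound_gker hα _) hXt
    have hs1 : SingBound 1 a t (|M| * BX) (fun s => M * (x s - xa)) :=
      singBound_one_of_bound (hXt.meas.const_mul M) fun s hs => by
        rw [abs_mul]; gcongr; simpa using hXt.bound s hs
    have hs2 : SingBound (1 - α + 1) a t
        (|N| * ((Real.Gamma (1 - α))⁻¹ * BX * ProbabilityTheory.beta (1 - α) 1))
        (fun s => N * cv a (gker α) (fun s => x s - xa) s) :=
      ⟨hgX.meas.const_mul N, fun s hs => by
        rw [abs_mul, mul_assoc]; gcongr; exact hgX.bound s hs⟩
    have hkt := hkTR.mono (show t - a ≤ T - a by linarith [ht.2])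
    have hadd : cv a k (fun s => M * (x s - xa) + N * cv a (gker α) (fun s => x s - xa) s) t
        = M * cv a k (fun s => x s - xa) t
          + N * cv a k (cv a (gker α) (fun s => x s - xa)) t := by
      rw [← cv_const_mul, ← cv_const_mul]
      simp only [cv, mul_add]
      exact intervalIntegral.integral_add (cv_intervalIntegrable hα.1 one_pos ht.1 hkt hs1)
        (cv_intervalIntegrable hα.1 (by linarith) ht.1 hkt hs2)
    rw [hadd, hk.cv_cv_gker hα ht.1 (by linarith [ht.2]) one_pos hXt, sub_self]
  intro t ht
  rcases ht.1.eq_or_lt with rfl | hat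
  · simp [h.init]
  · have := eqOn_zero_of_integral_eq_zero
      ((hcvc.sub (hxc.sub continuousOn_const)).mono Ioc_subset_Icc_self)
      ((hcvi T ⟨haT.le, le_rfl⟩).sub (hXi T ⟨haT.le, le_rfl⟩)) hzero t ⟨hat, ht.2⟩
    simp only [Pi.sub_apply] at this
    linarith

/-- Differentiable solutions of the Volterra equation satisfy the control system. -/
theorem IsResolvent.dynamics {α M N R C B Q Cz a b xa : ℝ} {k x z F : ℝ → ℝ}
    (hk : IsResolvent α M N R C k) (hα : α ∈ Ioo (0 : ℝ) 1) (hbR : b - a ≤ R) (hQ : 0 < Q)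
    (hQ1 : Q ≤ 1) (hF : SingBound 1 a b B F) (hFc : ContinuousOn F (Ioc a b))
    (hx : ∀ t ∈ Icc a b, x t = xa + cv a k F t) (hz : SingBound Q a b Cz z)
    (hzc : ContinuousOn z (Ioc a b)) (hxz : ∀ t ∈ Icc a b, x t = xa + ∫ s in a..t, z s) :
    ∀ t ∈ Ioc a b, M * z t + N * cv a (gker α) z t = F t := by
  intro t₀ ht₀
  have hab : a < b := ht₀.1.trans_le ht₀.2
  have hα' : 0 < 1 - α := by linarith [hα.2]
  have hgz : SingBound (1 - α + Q) a b _ (cv a (gker α) z) :=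
    SingBound.cv hα' (by linarith [hα.1]) hQ hQ1 (continuousOn_gker α) (singBound_gker hα _) hz
  have hgzc : ContinuousOn (cv a (gker α) z) (Ioc a b) := fun s hs =>
    (continuousWithinAt_cv hα' (by linarith [hα.1]) hQ hQ1 (continuousOn_gker α)
      (singBound_gker hα _) hz hs).mono Ioc_subset_Icc_self
  have hzi := hz.intervalIntegrable hQ hab.le
  have hgzi := hgz.intervalIntegrable (by linarith) hab.le
  have hFi := hF.intervalIntegrable one_pos hab.le
  -- The primitive of the residual is `M (k * F) + N g * (k * F) - ∫ F`, which vanishes by the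
  -- resolvent identity; the residual is continuous on `(a,b]`.
  have := eqOn_zero_of_integral_eq_zero (φ := fun s => M * z s + N * cv a (gker α) z s - F s)
    (((continuousOn_const.mul hzc).add (continuousOn_const.mul hgzc)).sub hFc)
    (((hzi.const_mul M).add (hgzi.const_mul N)).sub hFi) (fun t ht => ?_) t₀ ht₀
  · linarith
  · have hsub : uIcc a t ⊆ uIcc a b := by
      rw [uIcc_of_le ht.1, uIcc_of_le hab.le]; exact Icc_subset_Icc_right ht.2
    have hX : ∀ s ∈ Icc a b, ∫ τ in a..s, z τ = cv a k F s := fun s hs => by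
      have h1 := hx s hs
      have h2 := hxz s hs
      linarith
    have h3 : ∫ s in a..t, cv a (gker α) z s = cv a (gker α) (cv a k F) t := by
      rw [← cv_integral hα' ht.1 (measurable_gker α) (singBound_gker hα _) (hzi.mono_set hsub)]
      exact cv_congr_right ht.1 fun s hs => hX s ⟨hs.1.le, hs.2.trans ht.2⟩
    have h4 := hk.cv_gker_cv hα ht.1 (by linarith [ht.2]) one_pos (hF.mono ht.2)
    rw [intervalIntegral.integral_sub
        (((hzi.mono_set hsub).const_mul M).add ((hgzi.mono_set hsub).const_mul N))
        (hFi.mono_set hsub),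
      intervalIntegral.integral_add ((hzi.mono_set hsub).const_mul M)
        ((hgzi.mono_set hsub).const_mul N), intervalIntegral.integral_const_mul,
      intervalIntegral.integral_const_mul, hX t ht, h3, h4, sub_self]

/-! ### Smooth data and their truncation -/

/-- The domain `[a,∞) × ℝ²` of the data. -/
abbrev dom (a : ℝ) : Set (ℝ × ℝ × ℝ) := Ici a ×ˢ (univ : Set (ℝ × ℝ))

/-- A function of time, state and control that is `C¹` on `[a,∞) × ℝ²`. -/
abbrev SmoothData (a : ℝ) (f : ℝ → ℝ → ℝ → ℝ) : Prop :=
  ContDiffOn ℝ 1 (fun p : ℝ × ℝ × ℝ => f p.1 p.2.1 p.2.2) (dom a)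

/-- The derivative of `f` in the direction `w`, relative to `[a,∞) × ℝ²`. -/
def pd (a : ℝ) (f : ℝ → ℝ → ℝ → ℝ) (w : ℝ × ℝ × ℝ) (t x u : ℝ) : ℝ :=
  fderivWithin ℝ (fun p : ℝ × ℝ × ℝ => f p.1 p.2.1 p.2.2) (dom a) (t, x, u) w

theorem uniqueDiffOn_dom (a : ℝ) : UniqueDiffOn ℝ (dom a) :=
  (uniqueDiffOn_Ici a).prod uniqueDiffOn_univ

section
variable {a : ℝ} {f : ℝ → ℝ → ℝ → ℝ} {s : Set ℝ} {x v : ℝ → ℝ}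

theorem mem_dom {t x u : ℝ} : (t, x, u) ∈ dom a ↔ a ≤ t := by simp [dom]

theorem continuousOn_pd (hf : SmoothData a f) (w : ℝ × ℝ × ℝ) :
    ContinuousOn (fun p : ℝ × ℝ × ℝ => pd a f w p.1 p.2.1 p.2.2) (dom a) :=
  (hf.continuousOn_fderivWithin (uniqueDiffOn_dom a) le_rfl).clm_apply continuousOn_const

theorem SmoothData.hasFDerivWithinAt (hf : SmoothData a f) {t x u : ℝ} (ht : a ≤ t) :
    HasFDerivWithinAt (fun p : ℝ × ℝ × ℝ => f p.1 p.2.1 p.2.2)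
      (fderivWithin ℝ (fun p : ℝ × ℝ × ℝ => f p.1 p.2.1 p.2.2) (dom a) (t, x, u)) (dom a)
      (t, x, u) :=
  ((hf.differentiableOn one_ne_zero) (t, x, u) (mem_dom.2 ht)).hasFDerivWithinAt

theorem SmoothData.continuousOn_comp (hf : SmoothData a f) (hs : s ⊆ Ici a)
    (hx : ContinuousOn x s) (hv : ContinuousOn v s) :
    ContinuousOn (fun t => f t (x t) (v t)) s :=
  hf.continuousOn.comp (f := fun t => (t, x t, v t)) (by fun_prop)
    fun t ht => mem_dom.2 (hs ht)

theorem SmoothData.continuousWithinAt_comp (hf : SmoothData a f) (hs : s ⊆ Ici a) {t : ℝ}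
    (ht : t ∈ s)
    (hx : ContinuousWithinAt x s t) (hv : ContinuousWithinAt v s t) :
    ContinuousWithinAt (fun t => f t (x t) (v t)) s t :=
  (hf.continuousOn (t, x t, v t) (mem_dom.2 (hs ht))).comp (f := fun t => (t, x t, v t))
    (continuousWithinAt_id.prodMk (hx.prodMk hv)) fun _ ht => mem_dom.2 (hs ht)

theorem continuousWithinAt_pd_comp (hf : SmoothData a f) (w : ℝ × ℝ × ℝ) (hs : s ⊆ Ici a) {t : ℝ}
    (ht : t ∈ s)
    (hx : ContinuousWithinAt x s t) (hv : ContinuousWithinAt v s t) :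
    ContinuousWithinAt (fun t => pd a f w t (x t) (v t)) s t :=
  (continuousOn_pd hf w (t, x t, v t) (mem_dom.2 (hs ht))).comp (f := fun t => (t, x t, v t))
    (continuousWithinAt_id.prodMk (hx.prodMk hv)) fun _ ht => mem_dom.2 (hs ht)

theorem pd_eq (a : ℝ) (f : ℝ → ℝ → ℝ → ℝ) (t x u p q r : ℝ) :
    fderivWithin ℝ (fun p : ℝ × ℝ × ℝ => f p.1 p.2.1 p.2.2) (dom a) (t, x, u) (p, q, r)
      = p * pd a f (1, 0, 0) t x u + q * pd a f (0, 1, 0) t x u + r * pd a f (0, 0, 1) t x u := by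
  have : ((p, q, r) : ℝ × ℝ × ℝ) = p • ((1, 0, 0) : ℝ × ℝ × ℝ) + q • ((0, 1, 0) : ℝ × ℝ × ℝ)
      + r • ((0, 0, 1) : ℝ × ℝ × ℝ) := by ext <;> simp
  rw [this, map_add, map_add, map_smul, map_smul, map_smul]
  simp [pd]

/-- The chain rule along a curve. -/
theorem SmoothData.hasDerivAt_comp (hf : SmoothData a f) {t x' v' : ℝ} (ht : a < t)
    (hx : HasDerivAt x x' t) (hv : HasDerivAt v v' t) :
    HasDerivAt (fun t => f t (x t) (v t)) (pd a f (1, 0, 0) t (x t) (v t)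
      + pd a f (0, 1, 0) t (x t) (v t) * x' + pd a f (0, 0, 1) t (x t) (v t) * v') t := by
  have h1 := (hf.hasFDerivWithinAt (x := x t) (u := v t) ht.le).hasFDerivAt
    (prod_mem_nhds (Ici_mem_nhds ht) univ_mem)
  have h2 : HasDerivAt (fun t => (t, x t, v t)) ((1 : ℝ), x', v') t :=
    (hasDerivAt_id t).prodMk (hx.prodMk hv)
  have h3 := h1.comp_hasDerivAt t h2
  rw [pd_eq] at h3
  convert! h3 using 1
  ring

/-- Differentiability in state and control at a fixed time. -/
theorem SmoothData.hasFDerivAt_slice (hf : SmoothData a f) {t : ℝ} (ht : a ≤ t) (x u : ℝ) :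
    HasFDerivAt (fun p : ℝ × ℝ => f t p.1 p.2)
      ((pd a f (0, 1, 0) t x u) • ContinuousLinearMap.fst ℝ ℝ ℝ
        + (pd a f (0, 0, 1) t x u) • ContinuousLinearMap.snd ℝ ℝ ℝ) (x, u) := by
  have h2 : HasFDerivAt (fun p : ℝ × ℝ => (t, p.1, p.2))
      ((0 : ℝ × ℝ →L[ℝ] ℝ).prod (ContinuousLinearMap.id ℝ (ℝ × ℝ))) (x, u) :=
    (hasFDerivAt_const t _).prodMk (hasFDerivAt_id _)
  have h3 := (hf.hasFDerivWithinAt (x := x) (u := u) ht).comp_hasFDerivAt (x, u)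
    (f := fun p : ℝ × ℝ => (t, p.1, p.2)) h2 (Eventually.of_forall fun p => mem_dom.2 ht)
  convert! h3 using 1
  ext
  · simp [pd]
  · simp [pd]

theorem SmoothData.hasDerivAt_state (hf : SmoothData a f) {t : ℝ} (ht : a ≤ t) (x u : ℝ) :
    HasDerivAt (fun ξ => f t ξ u) (pd a f (0, 1, 0) t x u) x := by
  have h2 : HasDerivAt (fun ξ : ℝ => (ξ, u)) ((1 : ℝ), (0 : ℝ)) x :=
    (hasDerivAt_id x).prodMk (hasDerivAt_const x u)
  have := (hf.hasFDerivAt_slice ht x u).comp_hasDerivAt x h2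
  convert! this using 1
  simp

theorem SmoothData.hasDerivAt_control (hf : SmoothData a f) {t : ℝ} (ht : a ≤ t) (x u : ℝ) :
    HasDerivAt (fun v => f t x v) (pd a f (0, 0, 1) t x u) u := by
  have h2 : HasDerivAt (fun v : ℝ => (x, v)) ((0 : ℝ), (1 : ℝ)) u :=
    (hasDerivAt_const u x).prodMk (hasDerivAt_id u)
  have := (hf.hasFDerivAt_slice ht x u).comp_hasDerivAt u h2
  convert! this using 1
  simp

/-- `C¹` data are bounded and Lipschitz on compact sets. -/
theorem SmoothData.exists_bounds (hf : SmoothData a f) (R B : ℝ) :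
    ∃ Λ : ℝ, 0 ≤ Λ ∧ (∀ t ∈ Icc a R, ∀ x u, |x| ≤ B → |u| ≤ B → |f t x u| ≤ Λ) ∧
      ∀ t ∈ Icc a R, ∀ x u x' u', |x| ≤ B → |u| ≤ B → |x'| ≤ B → |u'| ≤ B →
        |f t x u - f t x' u'| ≤ Λ * (|x - x'| + |u - u'|) := by
  set K : Set (ℝ × ℝ × ℝ) := Icc a R ×ˢ (Icc (-B) B ×ˢ Icc (-B) B) with hK
  have hKc : IsCompact K := isCompact_Icc.prod (isCompact_Icc.prod isCompact_Icc)
  have hKd : K ⊆ dom a := fun p hp => ⟨hp.1.1, mem_univ _⟩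
  obtain ⟨C₀, hC₀⟩ := hKc.exists_bound_of_continuousOn (hf.continuousOn.mono hKd)
  obtain ⟨C₁, hC₁⟩ := hKc.exists_bound_of_continuousOn ((continuousOn_pd hf (0, 1, 0)).mono hKd)
  obtain ⟨C₂, hC₂⟩ := hKc.exists_bound_of_continuousOn ((continuousOn_pd hf (0, 0, 1)).mono hKd)
  have hmem : ∀ t ∈ Icc a R, ∀ x u, |x| ≤ B → |u| ≤ B → (t, x, u) ∈ K := fun t ht x u hx hu =>
    ⟨ht, abs_le.1 hx, abs_le.1 hu⟩
  refine ⟨max 0 (max C₀ (max C₁ C₂)), le_max_left _ _, fun t ht x u hx hu => ?_,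
    fun t ht x u x' u' hx hu hx' hu' => ?_⟩
  · exact (hC₀ _ (hmem t ht x u hx hu)).trans ((le_max_left _ _).trans (le_max_right _ _))
  · set Λ := max 0 (max C₀ (max C₁ C₂))
    have h1 : |f t x u - f t x' u| ≤ Λ * |x - x'| := by
      refine (convex_Icc (-B) B).norm_image_sub_le_of_norm_hasDerivWithin_le
        (f := fun ξ => f t ξ u) (f' := fun ξ => pd a f (0, 1, 0) t ξ u)
        (fun ξ _ => (hf.hasDerivAt_state ht.1 ξ u).hasDerivWithinAt)
        (fun ξ hξ => ?_) (abs_le.1 hx') (abs_le.1 hx)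
      exact (hC₁ _ (hmem t ht ξ u (abs_le.2 hξ) hu)).trans
        ((le_max_left _ _).trans ((le_max_right _ _).trans (le_max_right _ _)))
    have h2 : |f t x' u - f t x' u'| ≤ Λ * |u - u'| := by
      refine (convex_Icc (-B) B).norm_image_sub_le_of_norm_hasDerivWithin_le
        (f := fun v => f t x' v) (f' := fun v => pd a f (0, 0, 1) t x' v)
        (fun v _ => (hf.hasDerivAt_control ht.1 x' v).hasDerivWithinAt)
        (fun v hv => ?_) (abs_le.1 hu') (abs_le.1 hu)
      exact (hC₂ _ (hmem t ht x' v hx' (abs_le.2 hv))).trans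
        ((le_max_right _ _).trans ((le_max_right _ _).trans (le_max_right _ _)))
    calc |f t x u - f t x' u'| ≤ |f t x u - f t x' u| + |f t x' u - f t x' u'| :=
          abs_sub_le _ _ _
      _ ≤ Λ * |x - x'| + Λ * |u - u'| := add_le_add h1 h2
      _ = _ := by ring

end

/-- Composing the data with `χ` in state and control makes them globally bounded and Lipschitz in
these variables while leaving them unchanged on the box of size `B`. -/
theorem exists_cutoff {B : ℝ} (hB : 0 < B) :
    ∃ χ : ℝ → ℝ, ContDiff ℝ 1 χ ∧ (∀ x, |x| ≤ B → χ x = x) ∧ (∃ A, ∀ x, |χ x| ≤ A) ∧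
      ∃ Λ : ℝ, 0 ≤ Λ ∧ ∀ x y, |χ x - χ y| ≤ Λ * |x - y| := by
  let φ : ContDiffBump (0 : ℝ) := ⟨B, B + 1, hB, by linarith⟩
  have hφ : ContDiff ℝ 1 (φ : ℝ → ℝ) := φ.contDiff
  have hχ : ContDiff ℝ 1 (fun x => x * φ x) := contDiff_id.mul hφ
  have hsupp : HasCompactSupport (fun x => x * φ x) := φ.hasCompactSupport.mul_left
  refine ⟨fun x => x * φ x, hχ, fun x hx => ?_, ?_, ?_⟩
  · change x * φ x = x
    rw [φ.one_of_mem_closedBall, mul_one]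
    simpa [φ] using hx
  · obtain ⟨A, hA⟩ := hsupp.exists_bound_of_continuous hχ.continuous
    exact ⟨A, hA⟩
  · obtain ⟨Λ, hΛ⟩ := hχ.lipschitzWith_of_hasCompactSupport hsupp one_ne_zero
    exact ⟨Λ, Λ.2, fun x y => by simpa [Real.dist_eq] using hΛ.dist_le_mul x y⟩

/-- `C¹` data that are bounded and Lipschitz in state and control, uniformly on `[a,R]`. -/
structure Tame (a R Λ : ℝ) (F : ℝ → ℝ → ℝ → ℝ) : Prop where
  smooth : SmoothData a F
  nonneg : 0 ≤ Λ
  bound : ∀ t ∈ Icc a R, ∀ x u, |F t x u| ≤ Λ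
  lip : ∀ t ∈ Icc a R, ∀ x u x' u', |F t x u - F t x' u'| ≤ Λ * (|x - x'| + |u - u'|)

theorem SmoothData.exists_tame {a : ℝ} {f : ℝ → ℝ → ℝ → ℝ} (hf : SmoothData a f) (R : ℝ) {B : ℝ}
    (hB : 0 < B) :
    ∃ (F : ℝ → ℝ → ℝ → ℝ) (Λ : ℝ), Tame a R Λ F ∧
      ∀ t x u, |x| ≤ B → |u| ≤ B → F t x u = f t x u := by
  obtain ⟨χ, hχ, hχB, ⟨A, hA⟩, Λ₁, hΛ₁, hlip⟩ := exists_cutoff hB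
  obtain ⟨Λ₂, hΛ₂, hb, hl⟩ := hf.exists_bounds R A
  refine ⟨fun t x u => f t (χ x) (χ u), max Λ₂ (Λ₂ * Λ₁), ⟨?_, by positivity, ?_, ?_⟩, ?_⟩
  · have h1 : ContDiff ℝ 1 (fun p : ℝ × ℝ × ℝ => (p.1, χ p.2.1, χ p.2.2)) := by fun_prop
    exact ContDiffOn.comp (g := fun p : ℝ × ℝ × ℝ => f p.1 p.2.1 p.2.2) hf h1.contDiffOn
      fun p hp => ⟨hp.1, mem_univ _⟩
  · exact fun t ht x u => (hb t ht _ _ (hA x) (hA u)).trans (le_max_left _ _)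
  · intro t ht x u x' u'
    calc _ ≤ Λ₂ * (|χ x - χ x'| + |χ u - χ u'|) := hl t ht _ _ _ _ (hA _) (hA _) (hA _) (hA _)
      _ ≤ Λ₂ * (Λ₁ * |x - x'| + Λ₁ * |u - u'|) := by gcongr <;> exact hlip _ _
      _ = Λ₂ * Λ₁ * (|x - x'| + |u - u'|) := by ring
      _ ≤ _ := by gcongr; exact le_max_right _ _
  · intro t x u hx hu
    simp only [hχB x hx, hχB u hu]

theorem Tame.abs_pd_state_le {a R Λ : ℝ} {F : ℝ → ℝ → ℝ → ℝ} (hF : Tame a R Λ F) {t : ℝ}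
    (ht : t ∈ Icc a R) (x u : ℝ) : |pd a F (0, 1, 0) t x u| ≤ Λ := by
  have h := (hF.smooth.hasDerivAt_state ht.1 x u).le_of_lip' hF.nonneg
    (Eventually.of_forall fun ξ => by simpa using hF.lip t ht ξ u x u)
  simpa using h

theorem Tame.abs_pd_control_le {a R Λ : ℝ} {F : ℝ → ℝ → ℝ → ℝ} (hF : Tame a R Λ F) {t : ℝ}
    (ht : t ∈ Icc a R) (x u : ℝ) : |pd a F (0, 0, 1) t x u| ≤ Λ := by
  have h := (hF.smooth.hasDerivAt_control ht.1 x u).le_of_lip' hF.nonneg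
    (Eventually.of_forall fun v => by simpa using hF.lip t ht x v x u)
  simpa using h

/-! ### Controls, generalized trajectories and stability -/

/-- A bounded control with finitely many discontinuities. -/
structure IsControl (B : ℝ) (v : ℝ → ℝ) : Prop where
  bound : ∀ t, |v t| ≤ B
  cont : ∃ S : Finset ℝ, ∀ t ∉ S, ContinuousAt v t

theorem aestronglyMeasurable_of_continuousOn_diff {g : ℝ → ℝ} {s : Set ℝ} (hs : MeasurableSet s)
    (S : Finset ℝ) (h : ContinuousOn g (s \ S)) :
    AEStronglyMeasurable g (volume.restrict s) := by
  have h1 := h.aestronglyMeasurable (μ := volume) (hs.diff S.measurableSet)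
  rwa [Measure.restrict_congr_set (sdiff_null_ae_eq_self (S.finite_toSet.measure_zero volume))] at h1

theorem IsControl.aestronglyMeasurable {B : ℝ} {v : ℝ → ℝ} (hv : IsControl B v) :
    AEStronglyMeasurable v volume := by
  obtain ⟨S, hS⟩ := hv.cont
  have := aestronglyMeasurable_of_continuousOn_diff (g := v) MeasurableSet.univ S
    fun t ht => (hS t ht.2).continuousWithinAt
  rwa [Measure.restrict_univ] at this

theorem IsControl.aestronglyMeasurable_comp {a b B : ℝ} {v x : ℝ → ℝ} {F : ℝ → ℝ → ℝ → ℝ}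
    (hv : IsControl B v)
    (hF : ContinuousOn (fun p : ℝ × ℝ × ℝ => F p.1 p.2.1 p.2.2) (dom a))
    (hx : ContinuousOn x (Icc a b)) :
    AEStronglyMeasurable (fun s => F s (x s) (v s)) (volume.restrict (Ioc a b)) := by
  obtain ⟨S, hS⟩ := hv.cont
  refine aestronglyMeasurable_of_continuousOn_diff measurableSet_Ioc S ?_
  refine hF.comp (f := fun t => (t, x t, v t)) ?_ fun t ht => mem_dom.2 ht.1.1.le
  refine continuousOn_id.prodMk ((hx.mono fun t ht => ⟨ht.1.1.le, ht.1.2⟩).prodMk fun t ht => ?_)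
  exact (hS t ht.2).continuousWithinAt

/-- `x` solves the Volterra form of the control system on `[a,b]`. -/
structure IsTraj (a b xa : ℝ) (k : ℝ → ℝ) (F : ℝ → ℝ → ℝ → ℝ) (x v : ℝ → ℝ) : Prop where
  cont : ContinuousOn x (Icc a b)
  eq : ∀ t ∈ Icc a b, x t = xa + cv a k (fun s => F s (x s) (v s)) t

theorem IsTraj.mono {a b b' xa : ℝ} {k : ℝ → ℝ} {F : ℝ → ℝ → ℝ → ℝ} {x v : ℝ → ℝ}
    (h : IsTraj a b xa k F x v) (hb : b' ≤ b) : IsTraj a b' xa k F x v :=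
  ⟨h.cont.mono (Icc_subset_Icc_right hb), fun t ht => h.eq t ⟨ht.1, ht.2.trans hb⟩⟩

theorem Tame.singBound {a b R Λ B : ℝ} {F : ℝ → ℝ → ℝ → ℝ} {x v : ℝ → ℝ} (hF : Tame a R Λ F)
    (hv : IsControl B v) (hbR : b ≤ R) (hx : ContinuousOn x (Icc a b)) :
    SingBound 1 a b Λ (fun s => F s (x s) (v s)) :=
  singBound_one_of_bound (hv.aestronglyMeasurable_comp hF.smooth.continuousOn hx)
    fun s hs => hF.bound s ⟨hs.1.le, hs.2.trans hbR⟩ _ _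

theorem Tame.exists_traj {α M N a R C Λ B : ℝ} {F : ℝ → ℝ → ℝ → ℝ} {k v : ℝ → ℝ}
    (hα : α ∈ Ioo (0 : ℝ) 1) (hk : IsResolvent α M N (R - a) C k) (haR : a < R)
    (hF : Tame a R Λ F) (hv : IsControl B v) (xa : ℝ) :
    ∃ x, Continuous x ∧ IsTraj a R xa k F x v := by
  have hC : 0 ≤ C := hk.sing.const_nonneg (by linarith)
  obtain ⟨y, hy, h⟩ := exists_volterra (p := k) (a := a) (b := R) (P := α) (Q := 1) (C := C)
    (Λ := Λ) (D := Λ) (G := fun s y => F s y (v s)) (y₀ := fun _ => xa) haR.le hα.1 hα.2.le one_pos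
    le_rfl hC hF.nonneg hk.cont hk.sing continuousOn_const
    (fun y hy => hv.aestronglyMeasurable_comp hF.smooth.continuousOn hy.continuousOn)
    (fun s hs => by simpa using hF.bound s ⟨hs.1.le, hs.2⟩ 0 (v s))
    (fun s hs y y' => by simpa using hF.lip s ⟨hs.1.le, hs.2⟩ y (v s) y' (v s))
  exact ⟨y, hy, hy.continuousOn, fun t ht => by simpa using h t ht⟩

theorem abs_cv_le_integral {a t P C : ℝ} {p w : ℝ → ℝ} (hat : a ≤ t)
    (hp : ∀ s ∈ Ioc 0 (t - a), |p s| ≤ C * s ^ (P - 1)) {m : ℝ → ℝ}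
    (hm : ∀ s ∈ Ioc a t, |w s| ≤ m s)
    (hi : IntervalIntegrable (fun s => (t - s) ^ (P - 1) * m s) volume a t) :
    |cv a p w t| ≤ C * ∫ s in a..t, (t - s) ^ (P - 1) * m s := by
  rw [← intervalIntegral.integral_const_mul]
  refine intervalIntegral.norm_integral_le_of_norm_le (f := fun s => p (t - s) * w s) hat ?_
    (hi.const_mul C)
  filter_upwards [compl_mem_ae_iff.2 (measure_singleton t)] with s hst hs
  have hst' : 0 < t - s := sub_pos.2 (lt_of_le_of_ne hs.2 hst)
  rw [Real.norm_eq_abs, abs_mul, ← mul_assoc]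
  have h1 := hp (t - s) ⟨hst', by linarith [hs.1]⟩
  exact mul_le_mul h1 (hm s hs) (abs_nonneg _) ((abs_nonneg _).trans h1)

theorem intervalIntegrable_rsub_rpow_mul {a t P B : ℝ} {m : ℝ → ℝ} (hP : 0 < P) (hat : a ≤ t)
    (hm : AEStronglyMeasurable m (volume.restrict (Ioc a t))) (hB : ∀ s ∈ Ioc a t, |m s| ≤ B) :
    IntervalIntegrable (fun s => (t - s) ^ (P - 1) * m s) volume a t := by
  have h1 := intervalIntegrable_rsub_rpow (a := a) (t := t) hP hat
  rw [intervalIntegrable_iff_integrableOn_Ioc_of_le hat] at h1 ⊢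
  refine h1.mul_bdd (c := B) hm ?_
  exact (ae_restrict_mem measurableSet_Ioc).mono fun s hs => hB s hs

/-- Continuous dependence of trajectories on the control. -/
theorem Tame.exists_stability {α M N a R C Λ : ℝ} {F : ℝ → ℝ → ℝ → ℝ} {k : ℝ → ℝ}
    (hα : α ∈ Ioo (0 : ℝ) 1) (hk : IsResolvent α M N (R - a) C k) (haR : a < R)
    (hF : Tame a R Λ F) :
    ∃ K : ℝ, 0 ≤ K ∧ ∀ (b B D xa : ℝ) (x v x' v' : ℝ → ℝ), b ≤ R → IsControl B v →
      IsControl B v' → IsTraj a b xa k F x v → IsTraj a b xa k F x' v' →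
      (∀ t ∈ Icc a b, ∫ s in a..t, (t - s) ^ (α - 1) * |v s - v' s| ≤ D) →
      ∀ t ∈ Icc a b, |x t - x' t| ≤ K * D := by
  have hC : 0 ≤ C := hk.sing.const_nonneg (by linarith)
  have hΛ := hF.nonneg
  obtain ⟨K, hK, hgr⟩ := exists_gronwall (a := a) (b := R) (C := C * Λ) hα.1 hα.2.le (by positivity)
  -- The state difference is at most `C Λ` times the singular integrals of the state and control
  -- differences, and the control part serves as the constant in Gronwall's inequality. Controls are
  -- compared through this integral rather than uniformly, because smooth approximations of a jump
  -- do not converge uniformly.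
  refine ⟨K * (C * Λ), by positivity, fun b B D xa x v x' v' hbR hv hv' hx hx' hD t ht => ?_⟩
  rw [mul_assoc]
  refine hgr b (C * Λ * D) (fun t => x t - x' t) hbR (hx.cont.sub hx'.cont) (fun t ht => ?_) t ht
  have htR : t ≤ R := ht.2.trans hbR
  have hsub : Icc a t ⊆ Icc a b := Icc_subset_Icc_right ht.2
  have hsing := hk.sing.mono (R' := t - a) (by linarith)
  have h1 : x t - x' t = cv a k (fun s => F s (x s) (v s) - F s (x' s) (v' s)) t := by
    rw [cv_sub hα.1 one_pos ht.1 hsing (hF.singBound hv htR (hx.cont.mono hsub))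
      (hF.singBound hv' htR (hx'.cont.mono hsub)), hx.eq t ht, hx'.eq t ht]
    ring
  have hi1 : IntervalIntegrable (fun s => (t - s) ^ (α - 1) * |x s - x' s|) volume a t := by
    refine (intervalIntegrable_rsub_rpow hα.1 ht.1).mul_continuousOn ?_
    rw [uIcc_of_le ht.1]
    exact (hx.cont.sub hx'.cont).abs.mono hsub
  have hi2 : IntervalIntegrable (fun s => (t - s) ^ (α - 1) * |v s - v' s|) volume a t := by
    refine intervalIntegrable_rsub_rpow_mul (B := B + B) hα.1 ht.1
      (hv.aestronglyMeasurable.sub hv'.aestronglyMeasurable).norm.restrict fun s _ => ?_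
    rw [abs_abs]
    exact (abs_sub _ _).trans (add_le_add (hv.bound s) (hv'.bound s))
  have hi : IntervalIntegrable
      (fun s => (t - s) ^ (α - 1) * (Λ * (|x s - x' s| + |v s - v' s|))) volume a t := by
    convert! (hi1.add hi2).const_mul Λ using 1
    ext s; ring
  have h2 := abs_cv_le_integral (p := k) (P := α) (C := C)
    (w := fun s => F s (x s) (v s) - F s (x' s) (v' s)) ht.1
    (fun s hs => by simpa using hsing.bound s hs)
    (fun s hs => hF.lip s ⟨hs.1.le, hs.2.trans htR⟩ _ _ _ _) hi
  have h3 : ∫ s in a..t, (t - s) ^ (α - 1) * (Λ * (|x s - x' s| + |v s - v' s|))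
      = Λ * ((∫ s in a..t, (t - s) ^ (α - 1) * |x s - x' s|)
        + ∫ s in a..t, (t - s) ^ (α - 1) * |v s - v' s|) := by
    rw [← intervalIntegral.integral_add hi1 hi2, ← intervalIntegral.integral_const_mul]
    congr 1; ext s; ring
  rw [h1]
  calc _ ≤ _ := h2
    _ = C * Λ * (∫ s in a..t, (t - s) ^ (α - 1) * |v s - v' s|)
        + C * Λ * ∫ s in a..t, (t - s) ^ (α - 1) * |x s - x' s| := by rw [h3]; ring
    _ ≤ _ := by gcongr; exact hD t ht

/-! ### Velocities of trajectories with smooth controls -/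

/-- If the kernel is a primitive, the Volterra convolution is a primitive as well. -/
theorem cv_eq_integral {α M R C B a t : ℝ} {k r w : ℝ → ℝ} (hα : α ∈ Ioo (0 : ℝ) 1)
    (hk : ∀ t, k t = M⁻¹ + ∫ s in (0 : ℝ)..t, r s) (hrm : Measurable r)
    (hrc : ContinuousOn r (Ioi 0)) (hr : SingBound (1 - α) 0 R C r) (hat : a ≤ t)
    (htR : t - a ≤ R) (hw : SingBound 1 a t B w) :
    cv a k w t = ∫ s in a..t, (M⁻¹ * w s + cv a r w s) := by
  have hα' : 0 < 1 - α := by linarith [hα.2]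
  have hrt := hr.mono htR
  have hwi := hw.intervalIntegrable one_pos hat
  have h1r : SingBound (1 + (1 - α)) 0 (t - a) _ (cv 0 (fun _ => 1) r) :=
    SingBound.cv one_pos le_rfl hα' (by linarith [hα.1]) continuousOn_const (singBound_one 0 _) hrt
  have hcr : SingBound (1 - α + 1) a t _ (cv a r w) :=
    SingBound.cv hα' (by linarith [hα.1]) one_pos le_rfl hrc hrt hw
  rw [intervalIntegral.integral_add (hwi.const_mul _)
      (hcr.intervalIntegrable (by linarith) hat), ← cv_one a (cv a r w),
    cv_assoc one_pos hα' hat (singBound_one 0 _) hrm hrt hw.meas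
      (intervalIntegrable_rpow_mul (by linarith) hwi), cv, cv,
    ← intervalIntegral.integral_add (hwi.const_mul _)
      (cv_intervalIntegrable (by linarith) one_pos hat h1r hw)]
  congr 1
  ext s
  rw [hk, cv_one]
  ring

/-- Differentiability data for a trajectory on `[a,b]`: it is a primitive of `z`, which is
continuous on `(a,b]`, weakly singular at `a` and regular at `a` when `reg` holds. -/
structure HasVelocity (a b xa c : ℝ) (reg : Prop) (x z : ℝ → ℝ) : Prop where
  sing : ∃ Q C, 0 < Q ∧ Q ≤ 1 ∧ SingBound Q a b C z
  cont : ContinuousOn z (Ioc a b)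
  cont_left : reg → ContinuousWithinAt z (Icc a b) a ∧ z a = c
  eq : ∀ t ∈ Icc a b, x t = xa + ∫ s in a..t, z s

/-- For `M ≠ 0` the velocity is `M⁻¹ F + r * F`, continuous up to `a` whatever the control does
there, so the condition `reg` costs nothing. -/
theorem hasVelocity_of_ne_zero {α M a b xa C' : ℝ} {k r F x : ℝ → ℝ}
    (hα : α ∈ Ioo (0 : ℝ) 1) (hab : a < b)
    (hkr : ∀ t, k t = M⁻¹ + ∫ s in (0 : ℝ)..t, r s) (hrm : Measurable r)
    (hrc : ContinuousOn r (Ioi 0)) (hr : SingBound (1 - α) 0 (b - a) C' r)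
    (hF : ContinuousOn F (Icc a b)) (hx : ∀ t ∈ Icc a b, x t = xa + cv a k F t) (reg : Prop) :
    HasVelocity a b xa (M⁻¹ * F a) reg x (fun s => M⁻¹ * F s + cv a r F s) := by
  have hα' : 0 < 1 - α := by linarith [hα.2]
  obtain ⟨B, hB⟩ := exists_singBound_one_of_continuousOn hF
  have hc : ContinuousOn (fun s => M⁻¹ * F s + cv a r F s) (Icc a b) := by
    have := continuousOn_weighted_cv hα' (by linarith [hα.1]) one_pos le_rfl hrc hr hB
    exact (continuousOn_const.mul hF).add (by simpa using this)
  obtain ⟨B', hB'⟩ := exists_singBound_one_of_continuousOn hc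
  refine ⟨⟨1, B', one_pos, le_rfl, hB'⟩, hc.mono Ioc_subset_Icc_self,
    fun _ => ⟨hc a ⟨le_rfl, hab.le⟩, by simp⟩, fun t ht => ?_⟩
  rw [hx t ht, cv_eq_integral hα hkr hrm hrc hr ht.1 (by linarith [ht.2]) (hB.mono ht.2)]

theorem Tame.continuousOn_pd_control {a R Λ : ℝ} {F : ℝ → ℝ → ℝ → ℝ} (hF : Tame a R Λ F)
    {v : ℝ → ℝ} (hv : Continuous v) (w : ℝ × ℝ × ℝ) :
    ContinuousOn (fun p : ℝ × ℝ => pd a F w p.1 p.2 (v p.1)) (Ici a ×ˢ univ) :=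
  (continuousOn_pd hF.smooth w).comp (f := fun p : ℝ × ℝ => (p.1, p.2, v p.1)) (by fun_prop)
    fun p hp => mem_dom.2 hp.1

/-- Composition with a uniformly convergent sequence. -/
theorem eventually_abs_sub_comp_lt {A : ℝ → ℝ → ℝ} {a b : ℝ}
    (hA : ContinuousOn (fun p : ℝ × ℝ => A p.1 p.2) (Ici a ×ˢ univ)) {X : ℕ → ℝ → ℝ} {x : ℝ → ℝ}
    (hx : ContinuousOn x (Icc a b))
    (hX : ∀ ε > 0, ∃ n₀, ∀ n ≥ n₀, ∀ t ∈ Icc a b, |X n t - x t| ≤ ε) :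
    ∀ ε > 0, ∃ n₀, ∀ n ≥ n₀, ∀ t ∈ Icc a b, |A t (X n t) - A t (x t)| ≤ ε := by
  intro ε hε
  obtain ⟨B, hB⟩ := isCompact_Icc.exists_bound_of_continuousOn hx
  have hKc : IsCompact (Icc a b ×ˢ Icc (-(B + 1)) (B + 1)) := isCompact_Icc.prod isCompact_Icc
  have hu := hKc.uniformContinuousOn_of_continuous
    (hA.mono fun p hp => ⟨hp.1.1, mem_univ _⟩)
  obtain ⟨δ, hδ, h⟩ := Metric.uniformContinuousOn_iff.1 hu ε hε
  obtain ⟨n₀, hn₀⟩ := hX (min (δ / 2) 1) (by positivity)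
  refine ⟨n₀, fun n hn t ht => ?_⟩
  have h1 := hn₀ n hn t ht
  have h2 : |x t| ≤ B := hB t ht
  have h3 : |X n t - x t| ≤ 1 := h1.trans (min_le_right _ _)
  have h4 : |X n t - x t| < δ := (h1.trans (min_le_left _ _)).trans_lt (by linarith)
  have h5 := abs_le.1 h2
  have h6 := abs_le.1 h3
  have h7 := h (t, X n t) ⟨ht, by constructor <;> dsimp only <;> linarith⟩ (t, x t)
    ⟨ht, by constructor <;> dsimp only <;> linarith⟩ (by
      rw [Prod.dist_eq, dist_self, Real.dist_eq]
      exact max_lt hδ h4)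
  exact h7.le

/-- A perturbed halving recursion for bounds tends to zero. -/
theorem exists_le_of_halving {P : ℕ → ℝ → Prop} (hmono : ∀ n K K', K ≤ K' → P n K → P n K')
    (hex : ∀ n, ∃ K, P n K)
    (hstep : ∀ ε > 0, ∃ n₀, ∀ n ≥ n₀, ∀ K, 0 ≤ K → P n K → P (n + 1) (2⁻¹ * (K + ε))) :
    ∀ ε > 0, ∃ n₀, ∀ n ≥ n₀, P n ε := by
  intro ε hε
  obtain ⟨n₀, h₀⟩ := hstep (ε / 2) (by positivity)
  obtain ⟨K, hK⟩ := hex n₀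
  -- The map `K ↦ (K + ε/2)/2` has fixed point `ε/2`, and the excess over it is halved at every
  -- step.
  have hind : ∀ m : ℕ, P (n₀ + m) ((2⁻¹ : ℝ) ^ m * |K| + ε / 2) := by
    intro m
    induction m with
    | zero => exact hmono _ _ _ (by simp; linarith [le_abs_self K]) hK
    | succ m ih =>
      have := h₀ (n₀ + m) (by omega) _ (by positivity) ih
      have e : 2⁻¹ * ((2⁻¹ : ℝ) ^ m * |K| + ε / 2 + ε / 2)
          = (2⁻¹ : ℝ) ^ (m + 1) * |K| + ε / 2 := by rw [pow_succ]; ring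
      rwa [e] at this
  have hlim : Tendsto (fun m : ℕ => (2⁻¹ : ℝ) ^ m * |K|) atTop (𝓝 0) := by
    simpa using (tendsto_pow_atTop_nhds_zero_of_lt_one (r := (2⁻¹ : ℝ)) (by norm_num)
      (by norm_num)).mul_const |K|
  obtain ⟨m₀, hm₀⟩ := eventually_atTop.1 (hlim.eventually_lt_const (half_pos hε))
  refine ⟨n₀ + m₀, fun n hn => ?_⟩
  obtain ⟨m, rfl⟩ : ∃ m, n = n₀ + m := ⟨n - n₀, by omega⟩
  exact hmono _ _ _ (by linarith [hm₀ m (by omega)]) (hind m)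

/-- The integrand of the linearized Volterra equation. -/
def linRhs (a Q : ℝ) (A B : ℝ → ℝ → ℝ) (ξ y : ℝ → ℝ) (s : ℝ) : ℝ :=
  A s (ξ s) + B s (ξ s) * ((s - a) ^ (Q - 1) * y s)

theorem one_le_rpow_mul {a b s Q : ℝ} (hQ1 : Q ≤ 1) (hs : s ∈ Ioc a b) :
    1 ≤ (b - a) ^ (1 - Q) * (s - a) ^ (Q - 1) := by
  have hsa := sub_pos.2 hs.1
  calc (1 : ℝ) = (s - a) ^ (1 - Q) * (s - a) ^ (Q - 1) := by rw [← Real.rpow_add hsa]; simp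
    _ ≤ _ := by gcongr; exact hs.2

theorem continuousOn_linRhs {a b Q : ℝ} {A B : ℝ → ℝ → ℝ}
    (hA : ContinuousOn (fun p : ℝ × ℝ => A p.1 p.2) (Ici a ×ˢ univ))
    (hB : ContinuousOn (fun p : ℝ × ℝ => B p.1 p.2) (Ici a ×ˢ univ)) {ξ y : ℝ → ℝ}
    (hξ : ContinuousOn ξ (Icc a b)) (hy : ContinuousOn y (Icc a b)) :
    ContinuousOn (linRhs a Q A B ξ y) (Ioc a b) := by
  have hξ' := hξ.mono Ioc_subset_Icc_self
  have hcomp : ContinuousOn (fun s => (s, ξ s)) (Ioc a b) := continuousOn_id.prodMk hξ'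
  have hmaps : MapsTo (fun s => (s, ξ s)) (Ioc a b) (Ici a ×ˢ univ) :=
    fun s hs => ⟨hs.1.le, mem_univ _⟩
  refine (hA.comp hcomp hmaps).add ((hB.comp hcomp hmaps).mul
    (ContinuousOn.mul (fun s hs => ?_) (hy.mono Ioc_subset_Icc_self)))
  exact ((Real.continuousAt_rpow_const _ _ (Or.inl (sub_pos.2 hs.1).ne')).comp
    (f := fun t => t - a) (by fun_prop)).continuousWithinAt

theorem exists_singBound_linRhs {a b Q : ℝ} (hQ1 : Q ≤ 1) {A B : ℝ → ℝ → ℝ}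
    (hA : ContinuousOn (fun p : ℝ × ℝ => A p.1 p.2) (Ici a ×ˢ univ))
    (hB : ContinuousOn (fun p : ℝ × ℝ => B p.1 p.2) (Ici a ×ˢ univ)) {ξ y : ℝ → ℝ}
    (hξ : ContinuousOn ξ (Icc a b)) (hy : ContinuousOn y (Icc a b)) :
    ∃ D, SingBound Q a b D (linRhs a Q A B ξ y) := by
  have hcomp : ContinuousOn (fun s => (s, ξ s)) (Icc a b) := continuousOn_id.prodMk hξ
  have hmaps : MapsTo (fun s => (s, ξ s)) (Icc a b) (Ici a ×ˢ univ) :=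
    fun s hs => ⟨hs.1, mem_univ _⟩
  obtain ⟨D₁, hD₁⟩ := isCompact_Icc.exists_bound_of_continuousOn (hA.comp hcomp hmaps)
  obtain ⟨D₂, hD₂⟩ := isCompact_Icc.exists_bound_of_continuousOn ((hB.comp hcomp hmaps).mul hy)
  refine ⟨D₁ * (b - a) ^ (1 - Q) + D₂, (continuousOn_linRhs hA hB hξ hy).aestronglyMeasurable
    measurableSet_Ioc, fun s hs => ?_⟩
  have h1 : |A s (ξ s)| ≤ D₁ := hD₁ s ⟨hs.1.le, hs.2⟩
  have h2 : |B s (ξ s) * y s| ≤ D₂ := hD₂ s ⟨hs.1.le, hs.2⟩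
  have hsa := sub_pos.2 hs.1
  have h3 : 0 ≤ D₁ := (abs_nonneg _).trans h1
  calc |linRhs a Q A B ξ y s| ≤ |A s (ξ s)| + |B s (ξ s) * y s * (s - a) ^ (Q - 1)| := by
        rw [linRhs, show B s (ξ s) * ((s - a) ^ (Q - 1) * y s)
          = B s (ξ s) * y s * (s - a) ^ (Q - 1) by ring]
        exact abs_add_le _ _
    _ ≤ D₁ * ((b - a) ^ (1 - Q) * (s - a) ^ (Q - 1)) + D₂ * (s - a) ^ (Q - 1) := by
        rw [abs_mul (B s (ξ s) * y s), abs_of_pos (Real.rpow_pos_of_pos hsa _)]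
        gcongr
        exact h1.trans (le_mul_of_one_le_right h3 (one_le_rpow_mul hQ1 hs))
    _ = _ := by ring

section
variable {α a b c₀ Q Λ Bv xa : ℝ} {F : ℝ → ℝ → ℝ → ℝ} {v : ℝ → ℝ}

theorem singBound_power (α c₀ R : ℝ) : SingBound α 0 R |c₀| (fun t => c₀ * t ^ (α - 1)) := by
  refine ⟨((measurable_id.pow_const _).const_mul _).aestronglyMeasurable, fun s hs => ?_⟩
  rw [sub_zero, abs_mul, abs_of_pos (Real.rpow_pos_of_pos hs.1 _)]

theorem continuousOn_power (α c₀ : ℝ) : ContinuousOn (fun t : ℝ => c₀ * t ^ (α - 1)) (Ioi 0) :=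
  fun t ht => (continuousAt_const.mul
      (Real.continuousAt_rpow_const t (α - 1) (Or.inl (ne_of_gt ht)))).continuousWithinAt

/-- One Picard step, at the level of velocities. -/
theorem Tame.cv_power_eq_integral (hα : α ∈ Ioo (0 : ℝ) 1) (hF : Tame a b Λ F)
    (hv : ContDiff ℝ 1 v) (hQ0 : 0 < Q) (hQ1 : Q ≤ 1)
    (hQ : Q = α ∨ F a xa (v a) = 0) {ξ y : ℝ → ℝ} (hy : ContinuousOn y (Icc a b))
    (hξc : ContinuousOn ξ (Icc a b))
    (hξ : ∀ t ∈ Icc a b, ξ t = xa + ∫ s in a..t, (s - a) ^ (Q - 1) * y s) :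
    ∀ t ∈ Icc a b, cv a (fun t => c₀ * t ^ (α - 1)) (fun s => F s (ξ s) (v s)) t
      = ∫ s in a..t, (s - a) ^ (Q - 1) * (F a xa (v a) * c₀ + (s - a) ^ (1 - Q)
        * cv a (fun t => c₀ * t ^ (α - 1)) (linRhs a Q
          (fun t ξ => pd a F (1, 0, 0) t ξ (v t) + pd a F (0, 0, 1) t ξ (v t) * deriv v t)
          (fun t ξ => pd a F (0, 1, 0) t ξ (v t)) ξ y) s) := by
  intro t ht
  set k : ℝ → ℝ := fun t => c₀ * t ^ (α - 1) with hk
  set A : ℝ → ℝ → ℝ := fun t ξ => pd a F (1, 0, 0) t ξ (v t)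
    + pd a F (0, 0, 1) t ξ (v t) * deriv v t with hA
  set B : ℝ → ℝ → ℝ := fun t ξ => pd a F (0, 1, 0) t ξ (v t) with hB
  have hv' : Continuous (deriv v) := hv.continuous_deriv le_rfl
  have hAc : ContinuousOn (fun p : ℝ × ℝ => A p.1 p.2) (Ici a ×ˢ univ) :=
    (hF.continuousOn_pd_control hv.continuous _).add
      ((hF.continuousOn_pd_control hv.continuous _).mul (hv'.comp continuous_fst).continuousOn)
  have hBc : ContinuousOn (fun p : ℝ × ℝ => B p.1 p.2) (Ici a ×ˢ univ) :=
    hF.continuousOn_pd_control hv.continuous _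
  set w : ℝ → ℝ := linRhs a Q A B ξ y with hw
  obtain ⟨D, hD⟩ := exists_singBound_linRhs hQ1 hAc hBc hξc hy
  have hab : a ≤ b := ht.1.trans ht.2
  have hwi := hD.intervalIntegrable hQ0 hab
  have hsub : uIcc a t ⊆ uIcc a b := by
    rw [uIcc_of_le ht.1, uIcc_of_le hab]; exact Icc_subset_Icc_right ht.2
  have hyi : ∀ s ∈ Icc a b, IntervalIntegrable (fun s => (s - a) ^ (Q - 1) * y s) volume a s := by
    intro s hs
    refine (intervalIntegrable_sub_rpow hQ0 hs.1).mul_continuousOn ?_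
    rw [uIcc_of_le hs.1]
    exact hy.mono (Icc_subset_Icc_right hs.2)
  -- The chain rule gives `linRhs` as the derivative of `F` along the curve. The velocity may be
  -- singular at `a` but is integrable, so differentiability in the open interval is enough.
  have hFw : ∀ s ∈ Icc a t, F s (ξ s) (v s) = F a xa (v a) + ∫ τ in a..s, w τ := by
    intro s hs
    have hsb : s ≤ b := hs.2.trans ht.2
    have h1 : ContinuousOn (fun s => F s (ξ s) (v s)) (Icc a s) :=
      hF.smooth.continuousOn_comp (fun s hs => hs.1) (hξc.mono (Icc_subset_Icc_right hsb))
        hv.continuous.continuousOn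
    have h2 := intervalIntegral.integral_eq_sub_of_hasDerivAt_of_le hs.1 h1 (f' := w)
      (fun τ hτ => ?_) (hwi.mono_set ?_)
    · rw [h2, hξ a ⟨le_rfl, hab⟩]; simp
    · have hτb : τ < b := hτ.2.trans_le hsb
      have hcy : ContinuousAt (fun s => (s - a) ^ (Q - 1) * y s) τ :=
        ((Real.continuousAt_rpow_const _ _ (Or.inl (sub_pos.2 hτ.1).ne')).comp
          (f := fun t => t - a) (by fun_prop)).mul (hy.continuousAt (Icc_mem_nhds hτ.1 hτb))
      have hmeas : StronglyMeasurableAtFilter (fun s => (s - a) ^ (Q - 1) * y s) (𝓝 τ) := by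
        refine ContinuousOn.stronglyMeasurableAtFilter (s := Ioo a b) isOpen_Ioo
          (fun σ hσ => ?_) τ ⟨hτ.1, hτb⟩
        exact (((Real.continuousAt_rpow_const _ _ (Or.inl (sub_pos.2 hσ.1).ne')).comp
          (f := fun t => t - a) (by fun_prop)).mul
          (hy.continuousAt (Icc_mem_nhds hσ.1 hσ.2))).continuousWithinAt
      have h3 : HasDerivAt ξ ((τ - a) ^ (Q - 1) * y τ) τ := by
        refine ((intervalIntegral.integral_hasDerivAt_right (hyi τ ⟨hτ.1.le, hτb.le⟩) hmeas
          hcy).const_add xa).congr_of_eventuallyEq ?_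
        filter_upwards [Icc_mem_nhds hτ.1 hτb] with σ hσ using hξ σ hσ
      have h4 := hF.smooth.hasDerivAt_comp hτ.1 h3
        (hv.differentiable one_ne_zero τ).hasDerivAt
      convert! h4 using 1
      simp only [hw, linRhs, hA, hB]
      ring
    · rw [uIcc_of_le hs.1, uIcc_of_le hab]; exact Icc_subset_Icc_right hsb
  have hks : SingBound α 0 (t - a) |c₀| k := singBound_power α c₀ _
  have hkm : Measurable k := (measurable_id.pow_const _).const_mul _
  have hc : ContinuousOn (fun s => ∫ τ in a..s, w τ) (Icc a t) := by
    have := intervalIntegral.continuousOn_primitive_interval (μ := volume) (f := w) (a := a) (b := t)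
      (by
        rw [← intervalIntegrable_iff']
        exact hwi.mono_set hsub)
    rwa [uIcc_of_le ht.1] at this
  obtain ⟨D', hD'⟩ := exists_singBound_one_of_continuousOn hc
  have hcc : SingBound 1 a t |F a xa (v a)| (fun _ => F a xa (v a)) :=
    singBound_one_of_bound aestronglyMeasurable_const fun s _ => le_rfl
  rw [cv_congr_right ht.1 (fun s hs => hFw s ⟨hs.1.le, hs.2⟩),
    cv_add hα.1 one_pos ht.1 hks hcc hD', cv_integral hα.1 ht.1 hkm hks (hwi.mono_set hsub)]
  have h5 : cv a k (fun _ => F a xa (v a)) t = ∫ s in a..t, F a xa (v a) * k (s - a) := by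
    have e1 := intervalIntegral.integral_comp_sub_left (a := a) (b := t)
      (fun s => F a xa (v a) * k s) t
    have e2 := intervalIntegral.integral_comp_sub_right (a := a) (b := t)
      (fun s => F a xa (v a) * k s) a
    rw [sub_self] at e1 e2
    rw [e2, ← e1, cv]
    congr 1; ext s; ring
  have hki : IntervalIntegrable (fun s => F a xa (v a) * k (s - a)) volume a t :=
    ((intervalIntegrable_sub_rpow hα.1 ht.1).const_mul c₀).const_mul _
  have hcw : SingBound (α + Q) a t _ (cv a k w) :=
    SingBound.cv hα.1 hα.2.le hQ0 hQ1 (continuousOn_power α c₀) hks (hD.mono ht.2)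
  rw [h5, ← intervalIntegral.integral_add hki
    (hcw.intervalIntegrable (by linarith [hα.1]) ht.1)]
  apply intervalIntegral.integral_congr_ae
  rw [uIoc_of_le ht.1]
  refine Eventually.of_forall fun s hs => ?_
  have hsa := sub_pos.2 hs.1
  have e : (s - a) ^ (Q - 1) * (s - a) ^ (1 - Q) = 1 := by rw [← Real.rpow_add hsa]; simp
  rw [mul_add, ← mul_assoc ((s - a) ^ (Q - 1)) ((s - a) ^ (1 - Q)), e, one_mul]
  congr 1
  -- The term `F(a) k(s-a)` carries the singularity `(s-a)^(α-1)`: it matches the weight when `Q =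
  -- α` and is absent when `F(a) = 0`.
  rcases hQ with rfl | hQ
  · simp only [hk]; ring
  · rw [hQ]; ring

/-- Regularity of trajectories with smooth controls for the purely fractional equation. -/
theorem Tame.exists_velocity_power (hα : α ∈ Ioo (0 : ℝ) 1) (hab : a < b) (hF : Tame a b Λ F)
    (hv : ContDiff ℝ 1 v) (hQ0 : 0 < Q) (hQ1 : Q ≤ 1) (hQ : Q = α ∨ F a xa (v a) = 0)
    (hvc : IsControl Bv v) {x : ℝ → ℝ}
    (hx : IsTraj a b xa (fun t => c₀ * t ^ (α - 1)) F x v) :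
    ∃ y, Continuous y ∧ y a = F a xa (v a) * c₀ ∧
      ∀ t ∈ Icc a b, x t = xa + ∫ s in a..t, (s - a) ^ (Q - 1) * y s := by
  set k : ℝ → ℝ := fun t => c₀ * t ^ (α - 1) with hk
  set A : ℝ → ℝ → ℝ := fun t ξ => pd a F (1, 0, 0) t ξ (v t)
    + pd a F (0, 0, 1) t ξ (v t) * deriv v t with hA
  set B : ℝ → ℝ → ℝ := fun t ξ => pd a F (0, 1, 0) t ξ (v t) with hB
  have hv' : Continuous (deriv v) := hv.continuous_deriv le_rfl
  have hAc : ContinuousOn (fun p : ℝ × ℝ => A p.1 p.2) (Ici a ×ˢ univ) :=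
    (hF.continuousOn_pd_control hv.continuous _).add
      ((hF.continuousOn_pd_control hv.continuous _).mul (hv'.comp continuous_fst).continuousOn)
  have hBc : ContinuousOn (fun p : ℝ × ℝ => B p.1 p.2) (Ici a ×ˢ univ) :=
    hF.continuousOn_pd_control hv.continuous _
  have hBΛ : ∀ t ∈ Icc a b, ∀ ξ, |B t ξ| ≤ Λ := fun t ht ξ => hF.abs_pd_state_le ht ξ (v t)
  have hΛ := hF.nonneg
  have hks : ∀ R, SingBound α 0 R |c₀| k := singBound_power α c₀
  have hkc : ContinuousOn k (Ioi 0) := continuousOn_power α c₀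
  obtain ⟨D₀, hD₀⟩ := exists_singBound_linRhs hQ1 hAc hBc hx.cont (y := fun _ => 0)
    continuousOn_const
  -- This solves the formally differentiated equation along the given `x`, which is affine in the
  -- weighted velocity. That the primitive of the candidate really is `x` remains to be shown.
  obtain ⟨y, hyc, hy⟩ := exists_volterra (p := k) (P := α) (Q := Q) (C := |c₀|) (Λ := Λ)
    (D := D₀) (G := fun s η => linRhs a Q A B x (fun _ => η) s)
    (y₀ := fun _ => F a xa (v a) * c₀) hab.le hα.1 hα.2.le hQ0 hQ1 (abs_nonneg _) hΛ hkc (hks _)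
    continuousOn_const
    (fun y hy => (continuousOn_linRhs hAc hBc hx.cont hy.continuousOn).aestronglyMeasurable
      measurableSet_Ioc)
    hD₀.bound
    (fun s hs η η' => by
      have hsa := sub_pos.2 hs.1
      simp only [linRhs]
      rw [show A s (x s) + B s (x s) * ((s - a) ^ (Q - 1) * η) - (A s (x s)
        + B s (x s) * ((s - a) ^ (Q - 1) * η')) = B s (x s) * (s - a) ^ (Q - 1) * (η - η') by ring,
        abs_mul, abs_mul, abs_of_pos (Real.rpow_pos_of_pos hsa _)]
      gcongr
      exact hBΛ s ⟨hs.1.le, hs.2⟩ _)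
  change ∀ t ∈ Icc a b, y t = F a xa (v a) * c₀
    + (t - a) ^ (1 - Q) * cv a k (linRhs a Q A B x y) t at hy
  -- Picard iterates of the pair (state, weighted velocity). At each stage the state is the
  -- primitive of the velocity; the two components converge uniformly to `x` and `y`, so the
  -- relation survives in the limit.
  let S : ℕ → (ℝ → ℝ) × (ℝ → ℝ) := fun n => Nat.rec (fun _ => xa, fun _ => 0)
    (fun _ p => (fun t => xa + cv a k (fun s => F s (p.1 s) (v s)) t,
      fun t => F a xa (v a) * c₀ + (t - a) ^ (1 - Q) * cv a k (linRhs a Q A B p.1 p.2) t)) n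
  have hS1 : ∀ n t, (S (n + 1)).1 t = xa + cv a k (fun s => F s ((S n).1 s) (v s)) t :=
    fun n t => rfl
  have hS2 : ∀ n t, (S (n + 1)).2 t = F a xa (v a) * c₀
    + (t - a) ^ (1 - Q) * cv a k (linRhs a Q A B (S n).1 (S n).2) t := fun n t => rfl
  have hinv : ∀ n, ContinuousOn (S n).1 (Icc a b) ∧ ContinuousOn (S n).2 (Icc a b) ∧
      ∀ t ∈ Icc a b, (S n).1 t = xa + ∫ s in a..t, (s - a) ^ (Q - 1) * (S n).2 s := by
    intro n
    induction n with
    | zero => exact ⟨continuousOn_const, continuousOn_const, fun t _ => by simp [S]⟩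
    | succ n ih =>
      obtain ⟨h1, h2, h3⟩ := ih
      refine ⟨?_, ?_, fun t ht => ?_⟩
      · have := continuousOn_weighted_cv hα.1 hα.2.le one_pos le_rfl hkc (hks _)
          (hF.singBound hvc le_rfl h1)
        exact continuousOn_const.add (by simpa using this)
      · obtain ⟨D, hD⟩ := exists_singBound_linRhs hQ1 hAc hBc h1 h2
        exact continuousOn_const.add
          (continuousOn_weighted_cv hα.1 hα.2.le hQ0 hQ1 hkc (hks _) hD)
      · rw [hS1, hF.cv_power_eq_integral hα hv hQ0 hQ1 hQ h2 h1 h3 t ht]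
  -- uniform convergence of the states
  obtain ⟨κ, hκ0, hκ⟩ : ∃ κ : ℝ, 0 ≤ κ ∧ IsWeight α 1 a b (|c₀| * Λ) κ :=
    exists_weight hα.1 hα.2.le one_pos (by positivity)
  have hexp : ∀ κ t : ℝ, 0 ≤ κ → t ∈ Icc a b → 1 ≤ Real.exp (κ * (t - a)) := fun κ t h ht =>
    Real.one_le_exp (mul_nonneg h (sub_nonneg.2 ht.1))
  have hexp' : ∀ κ t : ℝ, 0 ≤ κ → t ∈ Icc a b →
      Real.exp (κ * (t - a)) ≤ Real.exp (κ * (b - a)) := fun κ t h ht => by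
    gcongr; exact ht.2
  have hXconv : ∀ ε > 0, ∃ n₀, ∀ n ≥ n₀, ∀ t ∈ Icc a b, |(S n).1 t - x t| ≤ ε := by
    have hP := exists_le_of_halving
      (P := fun n K => ∀ t ∈ Icc a b, |(S n).1 t - x t| ≤ K * Real.exp (κ * (t - a)))
      (fun n K K' hKK' h t ht => (h t ht).trans (by gcongr)) (fun n => ?_) (fun ε hε => ?_)
    · intro ε hε
      obtain ⟨n₀, hn₀⟩ := hP (ε / Real.exp (κ * (b - a))) (by positivity)
      refine ⟨n₀, fun n hn t ht => (hn₀ n hn t ht).trans ?_⟩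
      rw [div_mul_eq_mul_div, div_le_iff₀ (Real.exp_pos _)]
      gcongr
      exact ht.2
    · obtain ⟨K, hK⟩ := isCompact_Icc.exists_bound_of_continuousOn ((hinv n).1.sub hx.cont)
      refine ⟨K, fun t ht => (hK t ht).trans ?_⟩
      exact le_mul_of_one_le_right ((norm_nonneg _).trans (hK t ht)) (hexp κ t hκ0 ht)
    · refine ⟨0, fun n _ K hK h t ht => ?_⟩
      rcases ht.1.eq_or_lt with rfl | hat
      · rw [hS1, hx.eq _ ht, cv_self, cv_self, sub_self, abs_zero]; positivity
      have hsub : Icc a t ⊆ Icc a b := Icc_subset_Icc_right ht.2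
      have h1 : (S (n + 1)).1 t - x t
          = cv a k (fun s => F s ((S n).1 s) (v s) - F s (x s) (v s)) t := by
        rw [cv_sub hα.1 one_pos ht.1 (hks _)
          (hF.singBound hvc ht.2 ((hinv n).1.mono hsub)) (hF.singBound hvc ht.2 (hx.cont.mono hsub)),
          hS1, hx.eq t ht]
        ring
      have h2 := hκ.abs_cv_le (K := K) (p := k)
        (w := fun s => F s ((S n).1 s) (v s) - F s (x s) (v s)) hat ht.2 hK
        (fun s hs => by simpa using (hks (t - a)).bound s hs)
        (fun s hs => by
          have hs' : s ∈ Icc a b := ⟨hs.1.le, hs.2.trans ht.2⟩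
          have := hF.lip s hs' ((S n).1 s) (v s) (x s) (v s)
          simp only [sub_self, abs_zero, add_zero] at this
          simp only [sub_self, Real.rpow_zero, mul_one]
          exact this.trans (by gcongr; exact h s hs'))
      rw [h1]
      simp only [sub_self, Real.rpow_zero, one_mul] at h2
      refine h2.trans ?_
      rw [mul_assoc]
      gcongr
      linarith
  -- uniform convergence of the weighted velocities
  obtain ⟨κ', hκ'0, hκ'⟩ : ∃ κ : ℝ, 0 ≤ κ ∧ IsWeight α Q a b (|c₀| * (Λ + 1)) κ :=
    exists_weight hα.1 hα.2.le hQ0 (by positivity)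
  obtain ⟨Y, hY⟩ := isCompact_Icc.exists_bound_of_continuousOn (s := Icc a b) hyc.continuousOn
  have hY0 : 0 ≤ Y := (norm_nonneg _).trans (hY a ⟨le_rfl, hab.le⟩)
  set E : ℝ := (b - a) ^ (1 - Q) with hE
  have hE0 : 0 ≤ E := Real.rpow_nonneg (by linarith) _
  have hYconv : ∀ ε > 0, ∃ n₀, ∀ n ≥ n₀, ∀ t ∈ Icc a b, |(S n).2 t - y t| ≤ ε := by
    have hP := exists_le_of_halving
      (P := fun n K => ∀ t ∈ Icc a b, |(S n).2 t - y t| ≤ K * Real.exp (κ' * (t - a)))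
      (fun n K K' hKK' h t ht => (h t ht).trans (by gcongr)) (fun n => ?_) (fun ε hε => ?_)
    · intro ε hε
      obtain ⟨n₀, hn₀⟩ := hP (ε / Real.exp (κ' * (b - a))) (by positivity)
      refine ⟨n₀, fun n hn t ht => (hn₀ n hn t ht).trans ?_⟩
      rw [div_mul_eq_mul_div, div_le_iff₀ (Real.exp_pos _)]
      gcongr
      exact ht.2
    · obtain ⟨K, hK⟩ := isCompact_Icc.exists_bound_of_continuousOn
        ((hinv n).2.1.sub hyc.continuousOn)
      refine ⟨K, fun t ht => (hK t ht).trans ?_⟩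
      exact le_mul_of_one_le_right ((norm_nonneg _).trans (hK t ht)) (hexp κ' t hκ'0 ht)
    -- An error `η` in both coefficients costs `η (E + Y)` relative to the singular weight: `E`
    -- compares the constant one with the weight, and `Y` bounds the factor of the second
    -- coefficient.
    · set η : ℝ := ε / (E + Y + 1) with hη
      have hη0 : 0 < η := by positivity
      have hηε : η * (E + Y) ≤ ε := by
        rw [hη, div_mul_eq_mul_div, div_le_iff₀ (by positivity)]
        exact mul_le_mul_of_nonneg_left (by linarith) hε.le
      obtain ⟨n₁, hn₁⟩ := eventually_abs_sub_comp_lt hAc hx.cont hXconv η hη0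
      obtain ⟨n₂, hn₂⟩ := eventually_abs_sub_comp_lt hBc hx.cont hXconv η hη0
      refine ⟨max n₁ n₂, fun n hn K hK h t ht => ?_⟩
      rcases ht.1.eq_or_lt with rfl | hat
      · rw [hS2, hy _ ht, cv_self, cv_self, sub_self, abs_zero]; positivity
      have hsub : Icc a t ⊆ Icc a b := Icc_subset_Icc_right ht.2
      obtain ⟨D₁, hD₁⟩ := exists_singBound_linRhs hQ1 hAc hBc ((hinv n).1.mono hsub)
        ((hinv n).2.1.mono hsub)
      obtain ⟨D₂, hD₂⟩ := exists_singBound_linRhs hQ1 hAc hBc (hx.cont.mono hsub)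
        (hyc.continuousOn (s := Icc a t))
      have h1 : (S (n + 1)).2 t - y t = (t - a) ^ (1 - Q)
          * cv a k (fun s => linRhs a Q A B (S n).1 (S n).2 s - linRhs a Q A B x y s) t := by
        rw [cv_sub hα.1 hQ0 ht.1 (hks _) hD₁ hD₂, hS2, hy t ht]
        ring
      have h2 := hκ'.abs_cv_le (K := K + ε) (p := k)
        (w := fun s => linRhs a Q A B (S n).1 (S n).2 s - linRhs a Q A B x y s) hat ht.2
        (by positivity) (fun s hs => by simpa using (hks (t - a)).bound s hs)
        (fun s hs => by
          have hs' : s ∈ Icc a b := ⟨hs.1.le, hs.2.trans ht.2⟩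
          have hsa := sub_pos.2 hs.1
          have e1 := hn₁ n (le_of_max_le_left hn) s hs'
          have e2 := hn₂ n (le_of_max_le_right hn) s hs'
          have e3 := h s hs'
          have e4 := hBΛ s hs' ((S n).1 s)
          have e5 : |y s| ≤ Y := hY s hs'
          have e6 := one_le_rpow_mul hQ1 (show s ∈ Ioc a b from ⟨hs.1, hs'.2⟩)
          set ρ := (s - a) ^ (Q - 1) with hρ
          have hρ0 : 0 < ρ := Real.rpow_pos_of_pos hsa _
          have e7 := hexp κ' s hκ'0 hs'
          have e8 : linRhs a Q A B (S n).1 (S n).2 s - linRhs a Q A B x y s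
              = (A s ((S n).1 s) - A s (x s)) + ρ * ((B s ((S n).1 s) - B s (x s)) * y s)
                + ρ * (B s ((S n).1 s) * ((S n).2 s - y s)) := by
            simp only [linRhs, ← hρ]; ring
          rw [e8]
          calc _ ≤ |A s ((S n).1 s) - A s (x s)| + |ρ * ((B s ((S n).1 s) - B s (x s)) * y s)|
                + |ρ * (B s ((S n).1 s) * ((S n).2 s - y s))| := abs_add_three _ _ _
            _ ≤ η * (E * ρ) + ρ * (η * Y) + ρ * (Λ * (K * Real.exp (κ' * (s - a)))) := by
                rw [abs_mul ρ, abs_mul ρ, abs_mul, abs_mul, abs_of_pos hρ0]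
                gcongr
                exact e1.trans (le_mul_of_one_le_right hη0.le e6)
            _ = ρ * (η * (E + Y)) + ρ * (Λ * (K * Real.exp (κ' * (s - a)))) := by ring
            _ ≤ ρ * ((Λ + 1) * ε * Real.exp (κ' * (s - a)))
                + ρ * ((Λ + 1) * (K * Real.exp (κ' * (s - a)))) := by
                refine add_le_add (mul_le_mul_of_nonneg_left ?_ hρ0.le)
                  (mul_le_mul_of_nonneg_left (mul_le_mul_of_nonneg_right (by linarith)
                    (by positivity)) hρ0.le)
                calc η * (E + Y) ≤ ε := hηε
                  _ ≤ (Λ + 1) * ε := le_mul_of_one_le_left hε.le (by linarith)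
                  _ ≤ _ := le_mul_of_one_le_right (by positivity) e7
            _ = _ := by ring)
      rw [h1, abs_mul, abs_of_nonneg (Real.rpow_nonneg (sub_nonneg.2 ht.1) _)]
      refine h2.trans (le_of_eq ?_)
      ring
  refine ⟨y, hyc, ?_, fun t ht => ?_⟩
  · rw [hy a ⟨le_rfl, hab.le⟩]; simp
  have hyi : ∀ y : ℝ → ℝ, ContinuousOn y (Icc a b) →
      IntervalIntegrable (fun s => (s - a) ^ (Q - 1) * y s) volume a t := by
    intro y hy
    refine (intervalIntegrable_sub_rpow hQ0 ht.1).mul_continuousOn ?_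
    rw [uIcc_of_le ht.1]
    exact hy.mono (Icc_subset_Icc_right ht.2)
  refine eq_of_forall_dist_le fun ε hε => ?_
  set G : ℝ := ∫ s in a..t, (s - a) ^ (Q - 1) with hG
  have hG0 : 0 ≤ G := intervalIntegral.integral_nonneg ht.1 fun s hs =>
    Real.rpow_nonneg (sub_nonneg.2 hs.1) _
  obtain ⟨n₁, hn₁⟩ := hXconv (ε / 2) (by positivity)
  obtain ⟨n₂, hn₂⟩ := hYconv (ε / (2 * (G + 1))) (by positivity)
  set n := max n₁ n₂
  have h1 := hn₁ n (le_max_left _ _) t ht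
  have h2 : |(∫ s in a..t, (s - a) ^ (Q - 1) * (S n).2 s) - ∫ s in a..t, (s - a) ^ (Q - 1) * y s|
      ≤ ε / 2 := by
    rw [← intervalIntegral.integral_sub (hyi _ (hinv n).2.1) (hyi _ hyc.continuousOn)]
    have h3 := intervalIntegral.norm_integral_le_of_norm_le ht.1
      (f := fun s => (s - a) ^ (Q - 1) * (S n).2 s - (s - a) ^ (Q - 1) * y s)
      (g := fun s => (s - a) ^ (Q - 1) * (ε / (2 * (G + 1))))
      (Eventually.of_forall fun s hs => by
        rw [← mul_sub, Real.norm_eq_abs, abs_mul,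
          abs_of_nonneg (Real.rpow_nonneg (sub_nonneg.2 hs.1.le) _)]
        have h0 : (0 : ℝ) ≤ (s - a) ^ (Q - 1) := Real.rpow_nonneg (sub_nonneg.2 hs.1.le) _
        exact mul_le_mul_of_nonneg_left
          (hn₂ n (le_max_right _ _) s ⟨hs.1.le, hs.2.trans ht.2⟩) h0)
      ((intervalIntegrable_sub_rpow hQ0 ht.1).mul_const _)
    rw [intervalIntegral.integral_mul_const, ← hG] at h3
    refine h3.trans ?_
    rw [mul_div_assoc', div_le_div_iff₀ (by positivity) two_pos]
    nlinarith
  rw [(hinv n).2.2 t ht] at h1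
  rw [Real.dist_eq]
  have e1 := abs_le.1 h1
  have e2 := abs_le.1 h2
  rw [abs_le]
  constructor <;> linarith [e1.1, e1.2, e2.1, e2.2]

/-- If `F(a) = 0` the exponent `Q = 1` is allowed and the velocity is continuous at `a` with value
zero. Otherwise it may blow up like `(s-a)^(α-1)`, and `hreg` excludes that regularity at `a` is
demanded. -/
theorem Tame.hasVelocity_power (hα : α ∈ Ioo (0 : ℝ) 1) (hab : a < b) (hF : Tame a b Λ F)
    (hv : ContDiff ℝ 1 v) (hvc : IsControl Bv v) {x : ℝ → ℝ}
    (hx : IsTraj a b xa (fun t => c₀ * t ^ (α - 1)) F x v) (reg : Prop)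
    (hreg : reg → F a xa (v a) = 0) : ∃ z, HasVelocity a b xa 0 reg x z := by
  have key : ∀ (Q : ℝ) (y : ℝ → ℝ), 0 < Q → Q ≤ 1 → Continuous y → (reg → Q = 1 ∧ y a = 0) →
      (∀ t ∈ Icc a b, x t = xa + ∫ s in a..t, (s - a) ^ (Q - 1) * y s) →
      HasVelocity a b xa 0 reg x (fun s => (s - a) ^ (Q - 1) * y s) := by
    intro Q y hQ0 hQ1 hy hr h
    obtain ⟨Y, hY⟩ := isCompact_Icc.exists_bound_of_continuousOn (s := Icc a b) hy.continuousOn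
    refine ⟨⟨Q, Y, hQ0, hQ1, ?_, fun s hs => ?_⟩, fun s hs => ?_, fun hreg => ?_, h⟩
    · exact (((measurable_id.sub_const a).pow_const _).mul hy.measurable).aestronglyMeasurable
    · rw [abs_mul, abs_of_pos (Real.rpow_pos_of_pos (sub_pos.2 hs.1) _), mul_comm]
      gcongr
      · exact Real.rpow_nonneg (sub_pos.2 hs.1).le _
      · exact hY s ⟨hs.1.le, hs.2⟩
    · exact (((Real.continuousAt_rpow_const _ _ (Or.inl (sub_pos.2 hs.1).ne')).comp
        (f := fun t => t - a) (by fun_prop)).mul hy.continuousAt).continuousWithinAt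
    · obtain ⟨rfl, h0⟩ := hr hreg
      simp only [sub_self, Real.rpow_zero, one_mul]
      exact ⟨hy.continuousWithinAt, h0⟩
  by_cases hc : F a xa (v a) = 0
  · obtain ⟨y, hy, hya, h⟩ := hF.exists_velocity_power hα hab hv one_pos le_rfl (Or.inr hc) hvc hx
    exact ⟨_, key 1 y one_pos le_rfl hy (fun _ => ⟨rfl, by rw [hya, hc, zero_mul]⟩) h⟩
  · obtain ⟨y, hy, hya, h⟩ := hF.exists_velocity_power hα hab hv hα.1 hα.2.le (Or.inl rfl) hvc hx
    exact ⟨_, key α y hα.1 hα.2.le hy (fun h => absurd (hreg h) hc) h⟩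

end

/-! ### Approximation of controls by smooth ones -/

/-- Mollification, after the control has been replaced by the constant `c` up to `a + 2 r n`. The
mollifier sees only a window of radius `r n`, so the value at `a` is exactly `c`; this is what
preserves the state equation at the initial instant. -/
theorem IsControl.exists_smooth {B : ℝ} {v : ℝ → ℝ} (hv : IsControl B v) (a : ℝ) {c : ℝ}
    (hc : |c| ≤ B) :
    ∃ V : ℕ → ℝ → ℝ, (∀ n, ContDiff ℝ 1 (V n) ∧ IsControl B (V n) ∧ V n a = c) ∧
      ∀ᵐ t, a < t → Tendsto (fun n => V n t) atTop (𝓝 (v t)) := by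
  have hB : 0 ≤ B := (abs_nonneg _).trans hc
  let r : ℕ → ℝ := fun n => 1 / ((n : ℝ) + 1)
  have hr : ∀ n, 0 < r n := fun n => Nat.one_div_pos_of_nat
  let φ : ℕ → ContDiffBump (0 : ℝ) := fun n => ⟨r n / 2, r n, half_pos (hr n), half_lt_self (hr n)⟩
  let w : ℕ → ℝ → ℝ := fun n t => if t ≤ a + 2 * r n then c else v t
  have hwm : ∀ n, AEStronglyMeasurable (w n) volume := fun n =>
    AEStronglyMeasurable.piecewise (s := Iic (a + 2 * r n)) measurableSet_Iic
      aestronglyMeasurable_const hv.aestronglyMeasurable.restrict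
  have hwb : ∀ n t, |w n t| ≤ B := fun n t => by
    simp only [w]; split_ifs; exacts [hc, hv.bound t]
  let V : ℕ → ℝ → ℝ := fun n =>
    MeasureTheory.convolution ((φ n).normed volume) (w n) (ContinuousLinearMap.lsmul ℝ ℝ) volume
  have hVs : ∀ n, ContDiff ℝ 1 (V n) := fun n => by
    refine (φ n).hasCompactSupport_normed.contDiff_convolution_left _ (φ n).contDiff_normed ?_
    exact (locallyIntegrable_const B).mono (hwm n) (Eventually.of_forall fun t => by
      rw [Real.norm_eq_abs, Real.norm_eq_abs]; exact (hwb n t).trans (le_abs_self B))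
  have hVb : ∀ n t, |V n t| ≤ B := fun n t => by
    have := dist_convolution_le (z₀ := (0 : ℝ)) (x₀ := t) hB (φ n).support_normed_eq.subset
      (φ n).nonneg_normed (φ n).integral_normed (hwm n)
      (fun x _ => by rw [Real.dist_eq, sub_zero]; exact hwb n x)
    rwa [Real.dist_eq, sub_zero] at this
  refine ⟨V, fun n => ⟨hVs n, ⟨hVb n, ∅, fun t _ => (hVs n).continuous.continuousAt⟩, ?_⟩, ?_⟩
  · have := (φ n).normed_convolution_eq_right (μ := volume) (g := w n) (x₀ := a) (fun x hx => by
      have hx' : x < a + r n := by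
        have : |x - a| < r n := by simpa [Real.dist_eq, φ] using hx
        linarith [(abs_lt.1 this).2]
      simp only [w]
      rw [if_pos (by linarith [hr n]), if_pos (by linarith [hr n])])
    simp only [V, this, w]
    rw [if_pos (by linarith [hr n])]
  · obtain ⟨S, hS⟩ := hv.cont
    filter_upwards [compl_mem_ae_iff.2 (S.finite_toSet.measure_zero volume)] with t htS hat
    have hct : ContinuousAt v t := hS t (by simpa using htS)
    rw [Metric.tendsto_atTop]
    intro ε hε
    obtain ⟨δ, hδ, hvδ⟩ := Metric.continuousAt_iff.1 hct (ε / 2) (by positivity)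
    have hlim : Tendsto r atTop (𝓝 0) := tendsto_one_div_add_atTop_nhds_zero_nat
    obtain ⟨n₀, hn₀⟩ := eventually_atTop.1 (hlim.eventually_lt_const
      (show 0 < min δ ((t - a) / 3) from lt_min hδ (by linarith)))
    refine ⟨n₀, fun n hn => ?_⟩
    have h1 := (hn₀ n hn).trans_le (min_le_left _ _)
    have h2 := (hn₀ n hn).trans_le (min_le_right _ _)
    have hwt : w n t = v t := if_neg (by linarith)
    have h3 := (φ n).dist_normed_convolution_le (μ := volume) (x₀ := t) (ε := ε / 2) (hwm n)
      (fun x hx => by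
        have hx' : |x - t| < r n := by simpa [Real.dist_eq, φ] using hx
        have h4 : w n x = v x := if_neg (by linarith [(abs_lt.1 hx').1])
        rw [h4, hwt]
        exact (hvδ (by rw [Real.dist_eq]; linarith)).le)
    rw [hwt] at h3
    exact h3.trans_lt (by linarith)

/-- The integral is split at distance `ρ` from the singularity. Close to `t` only the bound `B` is
used, further away the kernel is at most `ρ^(α-1)`. Hence bounded `L¹` convergence makes the
singular integrals small uniformly in `t`. -/
theorem integral_singular_le {α a b t B ρ : ℝ} {d : ℝ → ℝ} (hα : 0 < α) (hα1 : α ≤ 1)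
    (ht : t ∈ Icc a b) (hρ : 0 < ρ) (hm : AEStronglyMeasurable d (volume.restrict (Ioc a b)))
    (hd0 : ∀ s, 0 ≤ d s) (hdB : ∀ s, d s ≤ B) :
    ∫ s in a..t, (t - s) ^ (α - 1) * d s
      ≤ B * ρ ^ (α / 2) * ((b - a) ^ (α / 2) / (α / 2)) + ρ ^ (α - 1) * ∫ s in a..b, d s := by
  have hα2 : 0 < α / 2 := by linarith
  have hB0 : 0 ≤ B := (hd0 a).trans (hdB a)
  have hab := ht.1.trans ht.2
  have hsing : SingBound 1 a b B d :=
    singBound_one_of_bound hm fun s _ => by rw [abs_of_nonneg (hd0 s)]; exact hdB s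
  have hdi := hsing.intervalIntegrable one_pos hab
  have hsub : uIcc a t ⊆ uIcc a b := by
    rw [uIcc_of_le ht.1, uIcc_of_le hab]; exact Icc_subset_Icc_right ht.2
  have hi1 : IntervalIntegrable (fun s => (t - s) ^ (α - 1) * d s) volume a t :=
    intervalIntegrable_rsub_rpow_mul (B := B) hα ht.1 (hsing.mono ht.2).meas
      fun s _ => by rw [abs_of_nonneg (hd0 s)]; exact hdB s
  have hi2 := (intervalIntegrable_rsub_rpow hα2 ht.1).const_mul (B * ρ ^ (α / 2))
  have hi3 := (hdi.mono_set hsub).const_mul (ρ ^ (α - 1))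
  have h1 : ∫ s in a..t, (t - s) ^ (α - 1) * d s ≤ ∫ s in a..t,
      (B * ρ ^ (α / 2) * (t - s) ^ (α / 2 - 1) + ρ ^ (α - 1) * d s) := by
    refine intervalIntegral.integral_mono_on_of_le_Ioo ht.1 hi1 (hi2.add hi3) fun s hs => ?_
    have hts := sub_pos.2 hs.2
    have hd := hd0 s
    rcases le_total (t - s) ρ with h | h
    · have e : (t - s) ^ (α - 1) = (t - s) ^ (α / 2) * (t - s) ^ (α / 2 - 1) := by
        rw [← Real.rpow_add hts]; ring_nf
      have e2 : (t - s) ^ (α / 2) ≤ ρ ^ (α / 2) := Real.rpow_le_rpow hts.le h hα2.le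
      have e3 := hdB s
      calc (t - s) ^ (α - 1) * d s ≤ ρ ^ (α / 2) * (t - s) ^ (α / 2 - 1) * B := by
            rw [e]; gcongr
        _ = B * ρ ^ (α / 2) * (t - s) ^ (α / 2 - 1) := by ring
        _ ≤ _ := le_add_of_nonneg_right (by positivity)
    · have e : (t - s) ^ (α - 1) ≤ ρ ^ (α - 1) := Real.rpow_le_rpow_of_nonpos hρ h (by linarith)
      calc _ ≤ ρ ^ (α - 1) * d s := by gcongr
        _ ≤ _ := le_add_of_nonneg_left (by positivity)
  rw [intervalIntegral.integral_add hi2 hi3, intervalIntegral.integral_const_mul,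
    intervalIntegral.integral_const_mul, integral_rsub_rpow hα2] at h1
  refine h1.trans ?_
  have h2 : ∫ s in a..t, d s ≤ ∫ s in a..b, d s :=
    intervalIntegral.integral_mono_interval le_rfl ht.1 ht.2 (Eventually.of_forall hd0) hdi
  have h3 : 0 ≤ t - a := sub_nonneg.2 ht.1
  gcongr
  exact ht.2

/-- Bounded a.e. convergence of controls gives uniform smallness of the singular integrals. -/
theorem exists_integral_singular_le {α a b B : ℝ} {V : ℕ → ℝ → ℝ} {v : ℝ → ℝ} (hα : 0 < α)
    (hα1 : α ≤ 1) (hab : a ≤ b) (hV : ∀ n, IsControl B (V n)) (hv : IsControl B v)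
    (hlim : ∀ᵐ t, a < t → Tendsto (fun n => V n t) atTop (𝓝 (v t))) :
    ∀ ε > 0, ∃ n₀, ∀ n ≥ n₀, ∀ t ∈ Icc a b,
      ∫ s in a..t, (t - s) ^ (α - 1) * |V n s - v s| ≤ ε := by
  intro ε hε
  have hB0 : 0 ≤ B := (abs_nonneg _).trans (hv.bound a)
  have hm : ∀ n, AEStronglyMeasurable (fun s => |V n s - v s|) volume := fun n =>
    ((hV n).aestronglyMeasurable.sub hv.aestronglyMeasurable).norm
  have hbd : ∀ n s, |V n s - v s| ≤ B + B := fun n s =>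
    (abs_sub _ _).trans (add_le_add ((hV n).bound s) (hv.bound s))
  have h1 : Tendsto (fun n => ∫ s in a..b, |V n s - v s|) atTop (𝓝 0) := by
    have := intervalIntegral.tendsto_integral_filter_of_dominated_convergence
      (F := fun n s => |V n s - v s|) (f := fun _ => (0 : ℝ)) (μ := volume) (a := a) (b := b)
      (l := atTop) (fun _ => B + B) (Eventually.of_forall fun n => (hm n).restrict)
      (Eventually.of_forall fun n => Eventually.of_forall fun s _ => by
        rw [Real.norm_eq_abs, abs_abs]; exact hbd n s)
      intervalIntegrable_const
      (by
        filter_upwards [hlim] with s hs hs2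
        rw [uIoc_of_le hab] at hs2
        have := (hs hs2.1).sub_const (v s)
        rw [sub_self] at this
        simpa using this.abs)
    simpa using this
  have h2 : Tendsto (fun ρ : ℝ => (B + B) * ρ ^ (α / 2) * ((b - a) ^ (α / 2) / (α / 2)))
      (𝓝[>] 0) (𝓝 0) := by
    have hα2 : 0 < α / 2 := by linarith
    have : Tendsto (fun ρ : ℝ => (B + B) * ρ ^ (α / 2) * ((b - a) ^ (α / 2) / (α / 2))) (𝓝 0)
        (𝓝 ((B + B) * 0 ^ (α / 2) * ((b - a) ^ (α / 2) / (α / 2)))) :=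
      (((Real.continuous_rpow_const hα2.le).tendsto 0).const_mul _).mul_const _
    rw [Real.zero_rpow hα2.ne', mul_zero, zero_mul] at this
    exact this.mono_left nhdsWithin_le_nhds
  -- The radius `ρ` is fixed first, uniformly in `n` and `t`; the `L¹` term is then made small by
  -- taking `n` large.
  obtain ⟨ρ, hρ1, hρ0⟩ := ((h2.eventually_lt_const (half_pos hε)).and self_mem_nhdsWithin).exists
  have hρ0' : 0 < ρ := hρ0
  have h3 := h1.const_mul (ρ ^ (α - 1))
  rw [mul_zero] at h3
  obtain ⟨n₀, hn₀⟩ := eventually_atTop.1 (h3.eventually_lt_const (half_pos hε))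
  refine ⟨n₀, fun n hn t ht => ?_⟩
  have h4 := integral_singular_le (ρ := ρ) hα hα1 ht hρ0' (hm n).restrict
    (fun s => abs_nonneg (V n s - v s)) (hbd n)
  have := hn₀ n hn
  linarith

/-! ### Relaxation to generalized trajectories -/

/-- The fundamental solution together with its explicit structure. -/
structure FundKernel (α M N R C : ℝ) (k : ℝ → ℝ) : Prop extends IsResolvent α M N R C k where
  primitive : M ≠ 0 → ∃ (r : ℝ → ℝ) (C' : ℝ), Measurable r ∧ ContinuousOn r (Ioi 0) ∧
    SingBound (1 - α) 0 R C' r ∧ (N = 0 → r = 0) ∧ Continuous k ∧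
    ∀ t, k t = M⁻¹ + ∫ s in (0 : ℝ)..t, r s
  power : M = 0 → ∃ c₀, k = fun t => c₀ * t ^ (α - 1)

theorem exists_fundKernel {α M N R : ℝ} (hα : α ∈ Ioo (0 : ℝ) 1) (hMN : (M, N) ≠ (0, 0))
    (hR : 0 < R) : ∃ (k : ℝ → ℝ) (C : ℝ), FundKernel α M N R C k := by
  by_cases hM : M = 0
  · subst hM
    have hN : N ≠ 0 := fun h => hMN (by rw [h])
    exact ⟨_, _, isResolvent_of_eq_zero hα hN R, fun h => absurd rfl h, fun _ => ⟨_, rfl⟩⟩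
  · obtain ⟨k, r, C, h, h1, h2, h3, h4, h5, h6⟩ := exists_resolvent_of_ne_zero hα hM N hR
    exact ⟨k, C, h, fun _ => ⟨r, C, h1, h2, h3, h4, h5, h6⟩, fun h => absurd h hM⟩

theorem FundKernel.exists_velocity {α M N a b C Λ B xa : ℝ} {k v x : ℝ → ℝ}
    {F : ℝ → ℝ → ℝ → ℝ} (hk : FundKernel α M N (b - a) C k) (hα : α ∈ Ioo (0 : ℝ) 1) (hab : a < b)
    (hF : Tame a b Λ F) (hv : ContDiff ℝ 1 v) (hvc : IsControl B v) (hx : IsTraj a b xa k F x v)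
    (reg : Prop) (hreg : M = 0 → reg → F a xa (v a) = 0) :
    ∃ z c, HasVelocity a b xa c reg x z ∧ (reg → M * c = F a xa (v a)) := by
  by_cases hM : M = 0
  · obtain ⟨c₀, rfl⟩ := hk.power hM
    obtain ⟨z, hz⟩ := hF.hasVelocity_power hα hab hv hvc hx reg (hreg hM)
    exact ⟨z, 0, hz, fun h => by rw [hreg hM h, mul_zero]⟩
  · obtain ⟨r, C', h1, h2, h3, -, -, h6⟩ := hk.primitive hM
    have hxa : x a = xa := by rw [hx.eq a ⟨le_rfl, hab.le⟩, cv_self, add_zero]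
    refine ⟨_, _, hasVelocity_of_ne_zero (F := fun s => F s (x s) (v s)) hα hab h6 h1 h2 h3 ?_
      hx.eq reg, fun _ => ?_⟩
    · exact hF.smooth.continuousOn_comp (fun s hs => hs.1) hx.cont hv.continuous.continuousOn
    · rw [hxa, mul_inv_cancel_left₀ hM]

/-- Trajectories with smooth controls are admissible. -/
theorem HasVelocity.isAdmissible {α M N a b C Λ B c xa T' : ℝ} {k v x z : ℝ → ℝ}
    {F f : ℝ → ℝ → ℝ → ℝ} {reg : Prop} {D : Finset ℝ} (h : HasVelocity a b xa c reg x z)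
    (hα : α ∈ Ioo (0 : ℝ) 1) (hk : IsResolvent α M N (b - a) C k) (hF : Tame a b Λ F)
    (hv : Continuous v) (hvc : IsControl B v) (hx : IsTraj a b xa k F x v) (hT' : T' ∈ Ioo a b)
    (hD : a ∉ D → reg) (hc : reg → M * c = F a xa (v a))
    (hFf : ∀ t ∈ Icc a T', F t (x t) (v t) = f t (x t) (v t)) :
    IsAdmissible α a M N xa f D (fun t => xa + ∫ s in a..t, z s) v T' := by
  have hα' : 0 < 1 - α := by linarith [hα.2]
  have hab : a < b := hT'.1.trans hT'.2
  obtain ⟨Q, Cz, hQ0, hQ1, hz⟩ := h.sing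
  have hzi := hz.intervalIntegrable hQ0 hab.le
  have hzit : ∀ t ∈ Icc a b, IntervalIntegrable z volume a t := fun t ht => hzi.mono_set (by
    rw [uIcc_of_le ht.1, uIcc_of_le hab.le]; exact Icc_subset_Icc_right ht.2)
  -- The primitive serves as the state. It agrees with the trajectory on `[a,b]`, and because `T' <
  -- b` its derivative at `T'` is two-sided.
  set X : ℝ → ℝ := fun t => xa + ∫ s in a..t, z s with hX
  have hXx : ∀ t ∈ Icc a b, X t = x t := fun t ht => (h.eq t ht).symm
  have hd : ∀ t ∈ Ioo a b, HasDerivAt X (z t) t := by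
    intro t ht
    refine (intervalIntegral.integral_hasDerivAt_right (hzit t ⟨ht.1.le, ht.2.le⟩)
      ((h.cont.mono Ioo_subset_Ioc_self).stronglyMeasurableAtFilter isOpen_Ioo t ht)
      (h.cont.continuousAt (Ioc_mem_nhds ht.1 ht.2))).const_add xa
  have hda : reg → HasDerivWithinAt X (z a) (Ici a) a := by
    intro hr
    refine (intervalIntegral.integral_hasDerivWithinAt_right (s := Ici a) (t := Ioi a) (by simp)
      ?_ ?_).const_add xa
    · refine ⟨Ioc a b, Ioc_mem_nhdsGT hab, ?_⟩
      exact hz.meas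
    · have h1 := (h.cont_left hr).1
      refine h1.mono_of_mem_nhdsWithin ?_
      exact mem_of_superset (Ioc_mem_nhdsGT hab) Ioc_subset_Icc_self
  have hcv : ∀ t ∈ Icc a T', caputoLeft α a X t = cv a (gker α) z t := by
    intro t ht
    rw [caputoLeft_eq_cv]
    exact cv_congr_right ht.1 fun s hs => (hd s ⟨hs.1, hs.2.trans_lt (ht.2.trans_lt hT'.2)⟩).deriv
  have hdw : ∀ t ∈ Icc a T', t ∉ D → HasDerivWithinAt X (z t) (Icc a T') t := by
    intro t ht htD
    rcases ht.1.eq_or_lt with rfl | hat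
    · exact (hda (hD htD)).mono Icc_subset_Ici_self
    · exact (hd t ⟨hat, ht.2.trans_lt hT'.2⟩).hasDerivWithinAt
  have hFc : ContinuousOn (fun s => F s (x s) (v s)) (Icc a b) :=
    hF.smooth.continuousOn_comp (fun s hs => hs.1) hx.cont hv.continuousOn
  have hxa : x a = xa := by rw [hx.eq a ⟨le_rfl, hab.le⟩, cv_self, add_zero]
  refine ⟨hT'.1, ?_, ⟨⟨∅, fun t _ _ => hv.continuousWithinAt⟩,
    fun t _ => ⟨v t, (hv.tendsto t).mono_left nhdsWithin_le_nhds⟩,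
    fun t _ => ⟨v t, (hv.tendsto t).mono_left nhdsWithin_le_nhds⟩⟩, by simp [hX], ?_, ?_, ?_⟩
  · have h1 := (hzit T' ⟨hT'.1.le, hT'.2.le⟩).absolutelyContinuousOnInterval_intervalIntegral
      (c := a) left_mem_uIcc
    have h2 : AbsolutelyContinuousOnInterval (fun _ : ℝ => xa) a T' :=
      ((LipschitzWith.const xa).lipschitzOnWith).absolutelyContinuousOnInterval
    exact h2.add h1
  · exact fun t ht htD => (hdw t ht htD).differentiableWithinAt
  · intro _ t ht _
    have h1 := cv_intervalIntegrable hα' hQ0 ht.1 (singBound_gker hα _)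
      (hz.mono (ht.2.trans hT'.2.le))
    have hΓ : Real.Gamma (1 - α) ≠ 0 := (Real.Gamma_pos_of_pos hα').ne'
    refine (h1.const_mul (Real.Gamma (1 - α))).congr_ae ?_
    rw [uIoc_of_le ht.1]
    filter_upwards [ae_restrict_mem measurableSet_Ioc] with s hs
    rw [(hd s ⟨hs.1, hs.2.trans_lt (ht.2.trans_lt hT'.2)⟩).deriv, gker]
    field_simp
  · intro t ht htD
    rw [(hdw t ht htD).derivWithin (uniqueDiffOn_Icc hT'.1 t ht), hcv t ht,
      hXx t ⟨ht.1, ht.2.trans hT'.2.le⟩, ← hFf t ht]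
    rcases ht.1.eq_or_lt with rfl | hat
    -- At `t = a` the Caputo integral is empty and the system reads `M x'(a) = f(a, xa, v(a))`; this
    -- is the purpose of the condition `hc`.
    · rw [cv_self, mul_zero, add_zero, (h.cont_left (hD htD)).2, hxa, hc (hD htD)]
    · exact hk.dynamics hα le_rfl hQ0 hQ1 (hF.singBound hvc le_rfl hx.cont)
        (hFc.mono Ioc_subset_Icc_self) hx.eq hz h.cont h.eq t ⟨hat, ht.2.trans hT'.2.le⟩

/-- The minimizer also beats all generalized trajectories inside the tube where the truncated
data agree with the original ones. -/
theorem IsMinimizer.cost_le_traj {α a M N xa R C Λ B T : ℝ} {L f F : ℝ → ℝ → ℝ → ℝ}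
    {φ : ℝ → ℝ → ℝ} {D : Finset ℝ} {x u k v y : ℝ → ℝ}
    (hmin : IsMinimizer α a M N xa L f φ D x u T) (hα : α ∈ Ioo (0 : ℝ) 1) (haR : a < R)
    (hk : FundKernel α M N (R - a) C k) (hF : Tame a R Λ F)
    (hFf : ∀ t x u, |x| ≤ B → |u| ≤ B → F t x u = f t x u) (hL : SmoothData a L)
    (hφ : DifferentiableOn ℝ (fun p : ℝ × ℝ => φ p.1 p.2) (Ici a ×ˢ univ))
    (hu : |u a| ≤ B) (hv : IsControl B v) (hy : IsTraj a R xa k F y v) {T' : ℝ}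
    (hT' : T' ∈ Ioo a R) (hyB : ∀ t ∈ Icc a T', |y t| < B) :
    cost a L φ x u T ≤ cost a L φ y v T' := by
  obtain ⟨V, hV, hVlim⟩ := hv.exists_smooth a hu
  choose X hXc hX using fun n => hF.exists_traj hα hk.toIsResolvent haR (hV n).2.1 xa
  have hsubT : Icc a T' ⊆ Icc a R := Icc_subset_Icc_right hT'.2.le
  have hya : y a = xa := by rw [hy.eq a ⟨le_rfl, haR.le⟩, cv_self, add_zero]
  have hxaB : |xa| ≤ B := by rw [← hya]; exact (hyB a ⟨le_rfl, hT'.1.le⟩).le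
  -- the regularity condition at `a`
  have hreg : M = 0 → a ∉ D → f a xa (u a) = 0 := by
    intro hM ha
    have := hmin.1.dynamics a ⟨le_rfl, hmin.1.lt.le⟩ ha
    rw [hM, zero_mul, caputoLeft_eq_cv, cv_self, mul_zero, hmin.1.init] at this
    linarith
  -- uniform convergence
  obtain ⟨K, hK, hstab⟩ := hF.exists_stability hα hk.toIsResolvent haR
  have hconv : ∀ ε > 0, ∃ n₀, ∀ n ≥ n₀, ∀ t ∈ Icc a R, |X n t - y t| ≤ ε := by
    intro ε hε
    obtain ⟨n₀, hn₀⟩ := exists_integral_singular_le hα.1 hα.2.le haR.le (fun n => (hV n).2.1) hv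
      hVlim (ε / (K + 1)) (by positivity)
    refine ⟨n₀, fun n hn t ht => ?_⟩
    refine (hstab R B _ xa (X n) (V n) y v le_rfl (hV n).2.1 hv (hX n) hy (hn₀ n hn) t ht).trans ?_
    rw [mul_div_assoc', div_le_iff₀ (by positivity)]
    nlinarith
  -- the approximating states stay in the tube
  obtain ⟨t₁, ht₁, hmax⟩ := isCompact_Icc.exists_isMaxOn (nonempty_Icc.2 hT'.1.le)
    (hy.cont.mono hsubT).abs
  obtain ⟨n₁, hn₁⟩ := hconv (B - |y t₁|) (sub_pos.2 (hyB t₁ ht₁))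
  have hXB : ∀ n ≥ n₁, ∀ t ∈ Icc a T', |X n t| ≤ B := by
    intro n hn t ht
    have h1 := hn₁ n hn t (hsubT ht)
    have h2 : |y t| ≤ |y t₁| := hmax ht
    have h3 := abs_sub_abs_le_abs_sub (X n t) (y t)
    linarith
  -- Inside the tube the truncated and original data agree, so the smooth approximations are
  -- admissible. For `M = 0` and `a ∉ D` this uses `V n a = u a`, since the minimizer's own equation
  -- at `a` forces `f(a, xa, u(a)) = 0`.
  have hle : ∀ n ≥ n₁, cost a L φ x u T ≤ cost a L φ (X n) (V n) T' := by
    intro n hn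
    have hFf' : ∀ t ∈ Icc a T', F t (X n t) (V n t) = f t (X n t) (V n t) := fun t ht =>
      hFf _ _ _ (hXB n hn t ht) ((hV n).2.1.bound t)
    obtain ⟨z, c, hz, hc⟩ := hk.exists_velocity hα haR hF (hV n).1 (hV n).2.1 (hX n) (a ∉ D)
      (fun hM ha => by rw [(hV n).2.2, hFf a xa (u a) hxaB hu, hreg hM ha])
    have hadm := hz.isAdmissible hα hk.toIsResolvent hF (hV n).1.continuous (hV n).2.1 (hX n) hT'
      id hc hFf'
    refine (hmin.2 _ _ _ hadm).trans (le_of_eq ?_)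
    simp only [cost]
    congr 1
    · apply intervalIntegral.integral_congr
      intro s hs
      rw [uIcc_of_le hT'.1.le] at hs
      simp only
      rw [← hz.eq s (hsubT hs)]
    · rw [← hz.eq T' ⟨hT'.1.le, hT'.2.le⟩]
  have hptw : ∀ t ∈ Icc a R, Tendsto (fun n => X n t) atTop (𝓝 (y t)) := by
    intro t ht
    rw [Metric.tendsto_atTop]
    intro ε hε
    obtain ⟨n₀, hn₀⟩ := hconv (ε / 2) (by positivity)
    exact ⟨n₀, fun n hn => (hn₀ n hn t ht).trans_lt (by linarith)⟩
  have hlim : Tendsto (fun n => cost a L φ (X n) (V n) T') atTop (𝓝 (cost a L φ y v T')) := by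
    refine Tendsto.add ?_ ?_
    · obtain ⟨ΛL, -, hLb, -⟩ := hL.exists_bounds R B
      refine intervalIntegral.tendsto_integral_filter_of_dominated_convergence (fun _ => ΛL)
        (Eventually.of_forall fun n => ?_) ?_ intervalIntegrable_const ?_
      · rw [uIoc_of_le hT'.1.le]
        exact (hV n).2.1.aestronglyMeasurable_comp hL.continuousOn (hXc n).continuousOn
      · filter_upwards [eventually_ge_atTop n₁] with n hn
        refine Eventually.of_forall fun s hs => ?_
        rw [uIoc_of_le hT'.1.le] at hs
        have hs' : s ∈ Icc a T' := ⟨hs.1.le, hs.2⟩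
        exact hLb s (hsubT hs') _ _ (hXB n hn s hs') ((hV n).2.1.bound s)
      · filter_upwards [hVlim] with s hs hs2
        rw [uIoc_of_le hT'.1.le] at hs2
        have hs' : s ∈ Icc a T' := ⟨hs2.1.le, hs2.2⟩
        have h1 := hptw s (hsubT hs')
        have h2 := hs hs2.1
        have h3 := (hL.hasFDerivAt_slice hs'.1 (y s) (v s)).continuousAt
        exact h3.tendsto.comp (h1.prodMk_nhds h2)
    · have h1 := hptw T' ⟨hT'.1.le, hT'.2.le⟩
      have h2 : ContinuousAt (fun p : ℝ × ℝ => φ p.1 p.2) (T', y T') :=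
        (hφ.continuousOn).continuousAt (prod_mem_nhds (Ici_mem_nhds hT'.1) univ_mem)
      exact h2.tendsto.comp (tendsto_const_nhds.prodMk_nhds h1)
  exact ge_of_tendsto hlim (eventually_atTop.2 ⟨n₁, hle⟩)

/-! ### The costate in reversed time -/

theorem SingBound.weaken {P Q a R C : ℝ} {w : ℝ → ℝ} (h : SingBound Q a R C w) (hPQ : P ≤ Q) :
    SingBound P a R (C * (R - a) ^ (Q - P)) w := by
  refine ⟨h.meas, fun s hs => (h.bound s hs).trans ?_⟩
  have hC : 0 ≤ C := h.const_nonneg (hs.1.trans_le hs.2)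
  have hs0 : 0 < s - a := sub_pos.2 hs.1
  calc C * (s - a) ^ (Q - 1) = C * (s - a) ^ (Q - P) * (s - a) ^ (P - 1) := by
        rw [mul_assoc, ← Real.rpow_add hs0]; ring_nf
    _ ≤ C * (R - a) ^ (Q - P) * (s - a) ^ (P - 1) := by
        have := hs.2
        have : 0 ≤ Q - P := by linarith
        gcongr

theorem hasDerivWithinAt_integral_Icc {w : ℝ → ℝ} {a b t : ℝ}
    (hw : IntervalIntegrable w volume a b) (ht : t ∈ Icc a b)
    (hc : ContinuousWithinAt w (Icc a b) t) :
    HasDerivWithinAt (fun t => ∫ s in a..t, w s) (w t) (Icc a b) t := by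
  have : Fact (t ∈ Icc a b) := ⟨ht⟩
  have hab : a ≤ b := ht.1.trans ht.2
  refine intervalIntegral.integral_hasDerivWithinAt_right (s := Icc a b) (t := Icc a b) ?_ ?_ hc
  · exact hw.mono_set (by rw [uIcc_of_le ht.1, uIcc_of_le hab]; exact Icc_subset_Icc_right ht.2)
  · refine ⟨Icc a b, self_mem_nhdsWithin, ?_⟩
    have := (intervalIntegrable_iff_integrableOn_Icc_of_le hab).1 hw
    exact this.aestronglyMeasurable

/-- The costate in reversed time: `μ = c k + k * (A + B μ)` on `(0,b]`, with `μ = O(τ^(γ-1))`. -/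
structure IsCostate (M b c γ : ℝ) (k A B μ : ℝ → ℝ) : Prop where
  pos : 0 < γ
  le_one : γ ≤ 1
  eq_one : M ≠ 0 ∨ c = 0 → γ = 1
  sing : ∃ C, SingBound γ 0 b C μ
  cont : ContinuousOn μ (Ioc 0 b)
  cont_zero : M ≠ 0 ∨ c = 0 → ContinuousOn μ (Icc 0 b)
  eq : ∀ τ ∈ Ioc 0 b, μ τ = c * k τ + cv 0 k (fun s => A s + B s * μ s) τ
  zero : M ≠ 0 ∨ c = 0 → μ 0 = c * k 0

theorem FundKernel.exists_costate {α M N b C CA CB : ℝ} {k A B : ℝ → ℝ} (hα : α ∈ Ioo (0 : ℝ) 1)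
    (hb : 0 < b) (hk : FundKernel α M N b C k) (hA : SingBound 1 0 b CA A)
    (hB : SingBound 1 0 b CB B) (c : ℝ) : ∃ γ μ, IsCostate M b c γ k A B μ := by
  -- Only the term `c k` can prevent the costate from being continuous at `0`, and only when `M = 0`
  -- and `c ≠ 0`. In that case `γ = α`, otherwise `γ = 1`; the Volterra equation is solved for `y =
  -- τ^(1-γ) μ`.
  obtain ⟨γ, y₀, hγ0, hγ1, hγ, hy₀, hy₀k, hy₀z⟩ : ∃ (γ : ℝ) (y₀ : ℝ → ℝ), 0 < γ ∧ γ ≤ 1 ∧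
      (M ≠ 0 ∨ c = 0 → γ = 1) ∧ ContinuousOn y₀ (Icc 0 b) ∧
      (∀ τ ∈ Ioc 0 b, τ ^ (γ - 1) * y₀ τ = c * k τ) ∧ (M ≠ 0 ∨ c = 0 → y₀ 0 = c * k 0) := by
    by_cases hc : c = 0
    · exact ⟨1, fun _ => 0, one_pos, le_rfl, fun _ => rfl, continuousOn_const,
        fun τ _ => by simp [hc], fun _ => by simp [hc]⟩
    by_cases hM : M = 0
    · obtain ⟨c₀, rfl⟩ := hk.power hM
      have hn : ¬ (M ≠ 0 ∨ c = 0) := by simp [hM, hc]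
      exact ⟨α, fun _ => c * c₀, hα.1, hα.2.le, fun h => absurd h hn, continuousOn_const,
        fun τ _ => by ring, fun h => absurd h hn⟩
    · obtain ⟨r, C', -, -, -, -, hkc, -⟩ := hk.primitive hM
      exact ⟨1, fun τ => c * k τ, one_pos, le_rfl, fun _ => rfl,
        (continuous_const.mul hkc).continuousOn, fun τ _ => by simp, fun _ => rfl⟩
  have hCB : 0 ≤ CB := hB.const_nonneg hb
  have hpm : Measurable (fun s : ℝ => s ^ (γ - 1)) := measurable_id.pow_const _
  obtain ⟨y, hy, hyeq⟩ := exists_volterra (p := k) (a := 0) (b := b) (P := α) (Q := γ) (C := C)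
    (Λ := CB) (D := CA * b ^ (1 - γ)) (y₀ := y₀) (G := fun s y => A s + B s * (s ^ (γ - 1) * y))
    hb.le hα.1 hα.2.le hγ0 hγ1 (hk.sing.const_nonneg hb) hCB hk.cont (by simpa using hk.sing) hy₀
    (fun y hy => hA.meas.add (hB.meas.mul
      (hpm.aestronglyMeasurable.mul hy.aestronglyMeasurable.restrict)))
    (fun s hs => by simpa using (hA.weaken hγ1).bound s hs)
    (fun s hs y y' => by
      have h1 := hB.bound s hs
      have h2 : 0 < s := hs.1
      rw [sub_self, Real.rpow_zero, mul_one] at h1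
      rw [add_sub_add_left_eq_sub, ← mul_sub, ← mul_sub, abs_mul, abs_mul,
        abs_of_nonneg (Real.rpow_nonneg h2.le _), sub_zero, ← mul_assoc]
      gcongr)
  simp only [sub_zero] at hyeq
  obtain ⟨Y, hY⟩ := isCompact_Icc.exists_bound_of_continuousOn (hy.continuousOn (s := Icc 0 b))
  have hy0 : y 0 = y₀ 0 := by rw [hyeq 0 ⟨le_rfl, hb.le⟩]; simp
  refine ⟨γ, fun τ => τ ^ (γ - 1) * y τ, hγ0, hγ1, hγ, ⟨Y, ?_, fun s hs => ?_⟩, fun s hs => ?_,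
    fun h => ?_, fun τ hτ => ?_, fun h => ?_⟩
  · exact hpm.aestronglyMeasurable.mul hy.aestronglyMeasurable.restrict
  · have h2 : 0 < s := hs.1
    rw [abs_mul, abs_of_nonneg (Real.rpow_nonneg h2.le _), sub_zero, mul_comm]
    have := hY s ⟨h2.le, hs.2⟩
    rw [Real.norm_eq_abs] at this
    gcongr
  · exact ((Real.continuousAt_rpow_const s _ (Or.inl hs.1.ne')).mul
      hy.continuousAt).continuousWithinAt
  · simpa [hγ h] using hy.continuousOn
  · have h1 : τ ^ (γ - 1) * τ ^ (1 - γ) = 1 := by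
      rw [← Real.rpow_add hτ.1]; simp
    rw [hyeq τ ⟨hτ.1.le, hτ.2⟩, mul_add, hy₀k τ hτ, ← mul_assoc, h1, one_mul]
  · rw [← hy₀z h, ← hy0, hγ h]
    simp

section
variable {α M N b c γ C CA CB : ℝ} {k A B μ : ℝ → ℝ}

theorem IsCostate.singBound_rhs (h : IsCostate M b c γ k A B μ)
    (hA : SingBound 1 0 b CA A) (hB : SingBound 1 0 b CB B) :
    ∃ D, SingBound γ 0 b D (fun s => A s + B s * μ s) := by
  obtain ⟨Cμ, hμ⟩ := h.sing
  have hA' := hA.weaken h.le_one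
  refine ⟨CA * (b - 0) ^ (1 - γ) + CB * Cμ, hA'.meas.add (hB.meas.mul hμ.meas),
    fun s hs => (abs_add_le _ _).trans ?_⟩
  have hCB : 0 ≤ CB := hB.const_nonneg (hs.1.trans_le hs.2)
  have h1 := hA'.bound s hs
  have h2 := hB.bound s hs
  have h3 := hμ.bound s hs
  rw [sub_self, Real.rpow_zero, mul_one] at h2
  rw [abs_mul, add_mul, mul_assoc CB]
  gcongr

/-- Apply `M · + N g * ·` to the costate equation and use the resolvent identity on both of its
terms. Differentiating the result gives the adjoint equation, and letting `τ → 0` gives the terminal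
condition on the multiplier. -/
theorem IsCostate.conservation (h : IsCostate M b c γ k A B μ) (hα : α ∈ Ioo (0 : ℝ) 1)
    (hk : FundKernel α M N b C k) (hA : SingBound 1 0 b CA A) (hB : SingBound 1 0 b CB B)
    {τ : ℝ} (hτ : τ ∈ Ioc 0 b) :
    M * μ τ + N * cv 0 (gker α) μ τ = c + ∫ s in (0 : ℝ)..τ, (A s + B s * μ s) := by
  obtain ⟨D, hD⟩ := h.singBound_rhs hA hB
  have hα' : 0 < 1 - α := by linarith [hα.2]
  have hDτ := hD.mono hτ.2
  have h1 : SingBound (α + γ) 0 τ _ (cv 0 k (fun s => A s + B s * μ s)) :=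
    SingBound.cv hα.1 hα.2.le h.pos h.le_one hk.cont (by simpa using hk.sing.mono hτ.2) hDτ
  have h2 : SingBound α 0 τ _ (fun s => c * k s) :=
    ⟨(hk.sing.mono hτ.2).meas.const_mul c, fun s hs => by
      rw [abs_mul]
      exact (mul_le_mul_of_nonneg_left ((hk.sing.mono hτ.2).bound s hs)
        (abs_nonneg c)).trans_eq (mul_assoc _ _ _).symm⟩
  rw [cv_congr_right hτ.1.le fun s hs => h.eq s ⟨hs.1, hs.2.trans hτ.2⟩,
    cv_add hα' hα.1 hτ.1.le (singBound_gker hα _) h2 (h1.weaken (by linarith [h.pos])),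
    cv_const_mul, h.eq τ hτ,
    ← hk.cv_gker_cv hα hτ.1.le (by simpa using hτ.2) h.pos hDτ]
  linear_combination c * hk.eq τ hτ

theorem IsCostate.conservation_zero (h : IsCostate M b c γ k A B μ)
    (hk : FundKernel α M N b C k) (h0 : M ≠ 0 ∨ c = 0) : M * μ 0 = c := by
  rw [h.zero h0]
  by_cases hM : M = 0
  · rw [h0.resolve_left (not_not.2 hM)]; simp
  · obtain ⟨r, C', -, -, -, -, -, h6⟩ := hk.primitive hM
    rw [h6 0]
    simp
    field_simp

theorem IsCostate.conservation_Icc (h : IsCostate M b c γ k A B μ) (hα : α ∈ Ioo (0 : ℝ) 1)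
    (hk : FundKernel α M N b C k) (hA : SingBound 1 0 b CA A) (hB : SingBound 1 0 b CB B)
    (h0 : M ≠ 0 ∨ c = 0) {τ : ℝ} (hτ : τ ∈ Icc 0 b) :
    M * μ τ + N * cv 0 (gker α) μ τ = c + ∫ s in (0 : ℝ)..τ, (A s + B s * μ s) := by
  rcases hτ.1.eq_or_lt with rfl | h1
  · simpa using h.conservation_zero hk h0
  · exact h.conservation hα hk hA hB ⟨h1, hτ.2⟩

/-- For `M = 0` the limit is read off from `conservation`. For `M ≠ 0` the costate is bounded and
its integral of order `1-α` tends to zero. Since `μ 0` is multiplied by `M`, its value in the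
unbounded case does not matter. -/
theorem IsCostate.tendsto_cv (h : IsCostate M b c γ k A B μ) (hα : α ∈ Ioo (0 : ℝ) 1) (hb : 0 < b)
    (hk : FundKernel α M N b C k) (hA : SingBound 1 0 b CA A) (hB : SingBound 1 0 b CB B)
    (hMN : (M, N) ≠ (0, 0)) :
    ∃ ℓ, Tendsto (cv 0 (gker α) μ) (𝓝[>] 0) (𝓝 ℓ) ∧ (M ≠ 0 → ℓ = 0) ∧ M * μ 0 + N * ℓ = c := by
  have hα' : 0 < 1 - α := by linarith [hα.2]
  by_cases hM : M = 0
  · have hN : N ≠ 0 := fun h => hMN (by rw [hM, h])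
    refine ⟨N⁻¹ * c, ?_, fun h => absurd hM h, by rw [hM]; field_simp; ring⟩
    obtain ⟨D, hD⟩ := h.singBound_rhs hA hB
    have hi := hD.intervalIntegrable h.pos hb.le
    have h1 : ContinuousWithinAt (fun τ => ∫ s in (0 : ℝ)..τ, (A s + B s * μ s)) (Icc 0 b) 0 := by
      have := intervalIntegral.continuousOn_primitive_interval' hi left_mem_uIcc
      rw [uIcc_of_le hb.le] at this
      exact this 0 ⟨le_rfl, hb.le⟩
    have h2 : Tendsto (fun τ => N⁻¹ * (c + ∫ s in (0 : ℝ)..τ, (A s + B s * μ s))) (𝓝[>] 0)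
        (𝓝 (N⁻¹ * c)) := by
      rw [ContinuousWithinAt, intervalIntegral.integral_same] at h1
      have h3 : 𝓝[>] (0 : ℝ) ≤ 𝓝[Icc 0 b] 0 := by
        rw [← nhdsWithin_Ioc_eq_nhdsGT hb]; exact nhdsWithin_mono _ Ioc_subset_Icc_self
      simpa using ((h1.mono_left h3).const_add c).const_mul N⁻¹
    refine h2.congr' ?_
    filter_upwards [Ioc_mem_nhdsGT hb] with τ hτ
    have := h.conservation hα hk hA hB hτ
    rw [← this, hM]
    field_simp
    ring
  · have hγ := h.eq_one (Or.inl hM)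
    obtain ⟨Cμ, hμ⟩ := h.sing
    rw [hγ] at hμ
    refine ⟨0, ?_, fun _ => rfl, by rw [h.conservation_zero hk (Or.inl hM)]; ring⟩
    have h1 := continuousOn_weighted_cv hα' (by linarith [hα.1]) one_pos le_rfl (continuousOn_gker α)
      (singBound_gker hα _) hμ 0 ⟨le_rfl, hb.le⟩
    simp only [sub_self, Real.rpow_zero, one_mul, ContinuousWithinAt, cv_self] at h1
    refine h1.mono_left ?_
    rw [← nhdsWithin_Ioc_eq_nhdsGT hb]; exact nhdsWithin_mono _ Ioc_subset_Icc_self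

/-- With `w = A + B μ` and `k` a primitive of `r`, differentiating `c k + k * w` gives `ψ = c r +
M⁻¹ w + r * w`. The term `c r` may be singular at `τ = 0`, hence the side condition in the last
clause. -/
theorem IsCostate.exists_primitive (h : IsCostate M b c γ k A B μ) (hα : α ∈ Ioo (0 : ℝ) 1)
    (hk : FundKernel α M N b C k) (hA : SingBound 1 0 b CA A) (hB : SingBound 1 0 b CB B)
    (hb : 0 < b) (hM : M ≠ 0) :
    ∃ ψ, IntervalIntegrable ψ volume 0 b ∧
      (∀ τ ∈ Icc 0 b, μ τ = M⁻¹ * c + ∫ s in (0 : ℝ)..τ, ψ s) ∧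
      (N = 0 → ∀ τ, ψ τ = M⁻¹ * (A τ + B τ * μ τ)) ∧
      ∀ τ ∈ Icc 0 b, (0 < τ ∨ N = 0 ∨ c = 0) →
        ContinuousWithinAt (fun s => A s + B s * μ s) (Icc 0 b) τ →
          ContinuousWithinAt ψ (Icc 0 b) τ := by
  obtain ⟨r, C', hrm, hrc, hr, hr0, hkc, hkr⟩ := hk.primitive hM
  have hα' : 0 < 1 - α := by linarith [hα.2]
  obtain ⟨D, hD⟩ := h.singBound_rhs hA hB
  rw [h.eq_one (Or.inl hM)] at hD
  have hr' : SingBound (1 - α) 0 (b - 0) C' r := by simpa using hr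
  set w : ℝ → ℝ := fun s => A s + B s * μ s with hw
  have hcv : ContinuousOn (cv 0 r w) (Icc 0 b) := by
    simpa using continuousOn_weighted_cv hα' (by linarith [hα.1]) one_pos le_rfl hrc hr' hD
  have hri := hr.intervalIntegrable hα' hb.le
  have hi2 : IntervalIntegrable (fun s => M⁻¹ * w s + cv 0 r w s) volume 0 b :=
    ((hD.intervalIntegrable one_pos hb.le).const_mul _).add
      (hcv.intervalIntegrable_of_Icc hb.le)
  have hsub : ∀ τ ∈ Icc 0 b, uIcc 0 τ ⊆ uIcc 0 b := fun τ hτ => by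
    rw [uIcc_of_le hτ.1, uIcc_of_le hb.le]; exact Icc_subset_Icc_right hτ.2
  refine ⟨fun s => c * r s + (M⁻¹ * w s + cv 0 r w s), (hri.const_mul c).add hi2, fun τ hτ => ?_,
    fun hN τ => ?_, fun τ hτ h0 hc => ?_⟩
  · have e : μ τ = c * k τ + cv 0 k w τ := by
      rcases hτ.1.eq_or_lt with rfl | h1
      · rw [cv_self, add_zero, h.zero (Or.inl hM)]
      · exact h.eq τ ⟨h1, hτ.2⟩
    rw [e, intervalIntegral.integral_add ((hri.const_mul c).mono_set (hsub τ hτ))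
      (hi2.mono_set (hsub τ hτ)), hkr,
      cv_eq_integral hα hkr hrm hrc hr hτ.1 (by simpa using hτ.2) (hD.mono hτ.2),
      intervalIntegral.integral_const_mul]
    ring
  · simp [hr0 hN, cv, hw]
  · refine ContinuousWithinAt.add ?_ ((hc.const_mul _).add (hcv τ hτ))
    rcases h0 with h0 | h0 | h0
    · exact ((hrc.continuousAt (Ioi_mem_nhds h0)).const_mul c).continuousWithinAt
    · rw [hr0 h0]; simpa using continuousWithinAt_const
    · rw [h0]; simpa using continuousWithinAt_const

/-- In the conservation law the integral of `A + B μ` is differentiable, and so is `M μ`; solving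
for the fractional integral makes it differentiable too. At `τ = 0` the condition `N = 0 ∨ c = 0`
excludes the singularities of `ψ` and, for `M = 0`, of `μ` itself. -/
theorem IsCostate.exists_deriv (h : IsCostate M b c γ k A B μ) (hα : α ∈ Ioo (0 : ℝ) 1)
    (hk : FundKernel α M N b C k) (hA : SingBound 1 0 b CA A) (hB : SingBound 1 0 b CB B)
    (hb : 0 < b) (hMN : (M, N) ≠ (0, 0)) {τ : ℝ} (hτ : τ ∈ Icc 0 b) (h0 : 0 < τ ∨ N = 0 ∨ c = 0)
    (hAc : ContinuousWithinAt A (Icc 0 b) τ) (hBc : ContinuousWithinAt B (Icc 0 b) τ) :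
    ∃ m d, (M ≠ 0 → HasDerivWithinAt μ m (Icc 0 b) τ) ∧
      (N ≠ 0 → HasDerivWithinAt (cv 0 (gker α) μ) d (Icc 0 b) τ) ∧
      M * m + N * d = A τ + B τ * μ τ := by
  have hNM : N = 0 → M ≠ 0 := fun hN hM => hMN (by rw [hM, hN])
  have hμc : ContinuousWithinAt μ (Icc 0 b) τ := by
    rcases hτ.1.eq_or_lt with rfl | h1
    · have : M ≠ 0 ∨ c = 0 := (h0.resolve_left (lt_irrefl _)).imp_left hNM
      exact h.cont_zero this 0 hτ
    · refine (h.cont τ ⟨h1, hτ.2⟩).mono_of_mem_nhdsWithin ?_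
      filter_upwards [self_mem_nhdsWithin, nhdsWithin_le_nhds (Ioi_mem_nhds h1)] with s hs hs'
      exact ⟨hs', hs.2⟩
  have hwc : ContinuousWithinAt (fun s => A s + B s * μ s) (Icc 0 b) τ := hAc.add (hBc.mul hμc)
  obtain ⟨D, hD⟩ := h.singBound_rhs hA hB
  have hwi := hD.intervalIntegrable h.pos hb.le
  have hwd := hasDerivWithinAt_integral_Icc hwi hτ hwc
  obtain ⟨m, hm, hm0⟩ : ∃ m, (M ≠ 0 → HasDerivWithinAt μ m (Icc 0 b) τ) ∧
      (N = 0 → M * m = A τ + B τ * μ τ) := by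
    by_cases hM : M = 0
    · exact ⟨0, fun h => absurd hM h, fun h => absurd hM (hNM h)⟩
    · obtain ⟨ψ, hψi, hψ, hψN, hψc⟩ := h.exists_primitive hα hk hA hB hb hM
      refine ⟨ψ τ, fun _ => ?_, fun hN => by rw [hψN hN]; field_simp⟩
      exact ((hasDerivWithinAt_integral_Icc hψi hτ (hψc τ hτ h0 hwc)).const_add (M⁻¹ * c)).congr
        (fun s hs => hψ s hs) (hψ τ hτ)
  by_cases hN : N = 0
  · exact ⟨m, 0, hm, fun h => absurd hN h, by rw [hm0 hN]; ring⟩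
  refine ⟨m, N⁻¹ * (A τ + B τ * μ τ - M * m), hm, fun _ => ?_, by field_simp; ring⟩
  have hMμ : HasDerivWithinAt (fun s => M * μ s) (M * m) (Icc 0 b) τ := by
    by_cases hM : M = 0
    · simpa [hM] using hasDerivWithinAt_const τ (Icc 0 b) (0 : ℝ)
    · exact (hm hM).const_mul M
  have h2 := ((hwd.const_add c).sub hMμ).const_mul N⁻¹
  have heq : ∀ s ∈ Icc 0 b, (0 < s ∨ M ≠ 0 ∨ c = 0) → cv 0 (gker α) μ s
      = N⁻¹ * ((c + ∫ s in (0 : ℝ)..s, (A s + B s * μ s)) - M * μ s) := by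
    intro s hs h1
    have : M * μ s + N * cv 0 (gker α) μ s = c + ∫ s in (0 : ℝ)..s, (A s + B s * μ s) := by
      rcases h1 with h1 | h1
      · exact h.conservation hα hk hA hB ⟨h1, hs.2⟩
      · exact h.conservation_Icc hα hk hA hB h1 hs
    rw [← this]; field_simp; ring
  have h0' : 0 < τ ∨ M ≠ 0 ∨ c = 0 := h0.imp_right fun h => h.imp_left hNM
  refine h2.congr_of_eventuallyEq ?_ (heq τ hτ h0')
  rcases h0' with h1 | h1
  · filter_upwards [self_mem_nhdsWithin, nhdsWithin_le_nhds (Ioi_mem_nhds h1)] with s hs hs'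
    exact heq s hs (Or.inl hs')
  · filter_upwards [self_mem_nhdsWithin] with s hs
    exact heq s hs (Or.inr h1)

end

/-! ### Duality, first variation and stationarity -/

theorem IsControl.mono {B B' : ℝ} {v : ℝ → ℝ} (hv : IsControl B v) (h : B ≤ B') : IsControl B' v :=
  ⟨fun t => (hv.bound t).trans h, hv.cont⟩

theorem FundKernel.mono {α M N R R' C : ℝ} {k : ℝ → ℝ} (h : FundKernel α M N R C k) (hR : R' ≤ R) :
    FundKernel α M N R' C k where
  meas := h.meas
  cont := h.cont
  sing := h.sing.mono hR
  eq t ht := h.eq t ⟨ht.1, ht.2.trans hR⟩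
  primitive hM := by
    obtain ⟨r, C', h1, h2, h3, h4⟩ := h.primitive hM
    exact ⟨r, C', h1, h2, h3.mono hR, h4⟩
  power := h.power

theorem continuousWithinAt_rsub {A : ℝ → ℝ} {a T τ : ℝ}
    (hA : ContinuousWithinAt A (Icc a T) (T - τ)) :
    ContinuousWithinAt (fun s => A (T - s)) (Icc 0 (T - a)) τ :=
  ContinuousWithinAt.comp (f := fun s => T - s) hA (by fun_prop)
    fun s hs => ⟨by linarith [hs.2], by linarith [hs.1]⟩

/-- Duality between the trajectories and the costate. -/
theorem IsCostate.integral_mul_eq {α M N a T c γ C CA CB Cw : ℝ} {k A B μ w : ℝ → ℝ}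
    (h : IsCostate M (T - a) c γ k (fun s => A (T - s)) (fun s => B (T - s)) μ)
    (hα : α ∈ Ioo (0 : ℝ) 1) (haT : a < T) (hk : FundKernel α M N (T - a) C k)
    (hA : SingBound 1 0 (T - a) CA (fun s => A (T - s)))
    (hB : SingBound 1 0 (T - a) CB (fun s => B (T - s))) (hw : SingBound 1 a T Cw w) :
    ∫ t in a..T, μ (T - t) * w t
      = c * cv a k w T + ∫ t in a..T, (A t + B t * μ (T - t)) * cv a k w t := by
  obtain ⟨D, hD⟩ := h.singBound_rhs hA hB
  have e1 : ∫ t in a..T, (A t + B t * μ (T - t)) * cv a k w t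
      = cv a (fun s => A (T - s) + B (T - s) * μ s) (cv a k w) T := by
    simp [cv]
  obtain ⟨E, h1⟩ : ∃ E, SingBound (γ + α) 0 (T - a) E
      (cv 0 (fun s => A (T - s) + B (T - s) * μ s) k) := by
    refine ⟨C * D * ProbabilityTheory.beta α γ, ?_⟩
    have := SingBound.cv hα.1 hα.2.le h.pos h.le_one hk.cont (by simpa using hk.sing) hD
    have e : cv 0 (fun s => A (T - s) + B (T - s) * μ s) k = cv 0 k _ := funext fun t => cv_comm _ _ _
    rw [e, add_comm γ]
    exact this
  -- All terms are convolutions at `T`. With `ρ = A + B μ` in reversed time, duality is the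
  -- associativity `(c k + k * ρ) * w = c (k * w) + ρ * (k * w)`.
  rw [e1, cv_assoc h.pos hα.1 haT.le hD hk.meas hk.sing hw.meas ?_]
  · have e2 : ∫ t in a..T, μ (T - t) * w t = cv a μ w T := rfl
    rw [e2, cv_congr_left haT.le h.eq, ← cv_const_mul_left]
    have h2 := cv_intervalIntegrable hα.1 one_pos haT.le hk.sing hw
    rw [cv, cv, cv, ← intervalIntegral.integral_add]
    · congr 1; ext t; rw [cv_comm k]; ring
    · simpa [mul_assoc] using h2.const_mul c
    · exact cv_intervalIntegrable (by linarith [h.pos, hα.1]) one_pos haT.le h1 hw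
  · have hp : 0 < γ + α := by linarith [h.pos, hα.1]
    refine intervalIntegrable_rsub_rpow_mul (B := Cw) hp haT.le hw.meas.norm fun s hs => ?_
    simpa using hw.bound s hs

/-- A minimizer for bounded Lipschitz data, in Volterra form. -/
structure TameMinimizer (α a M N xa R C ΛL ΛF B T : ℝ) (L F : ℝ → ℝ → ℝ → ℝ) (φ : ℝ → ℝ → ℝ)
    (k x v : ℝ → ℝ) : Prop where
  order : α ∈ Ioo (0 : ℝ) 1
  lt : a < T
  lt_right : T < R
  kernel : FundKernel α M N (R - a) C k
  tame_cost : Tame a R ΛL L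
  tame_dyn : Tame a R ΛF F
  diff : DifferentiableOn ℝ (fun p : ℝ × ℝ => φ p.1 p.2) (Ici a ×ˢ univ)
  control : IsControl (B - 1) v
  traj : IsTraj a R xa k F x v
  bound : ∀ t ∈ Icc a T, |x t| < B
  min : ∀ (v' y : ℝ → ℝ) (T' : ℝ), IsControl B v' → IsTraj a R xa k F y v' → T' ∈ Ioo a R →
    (∀ t ∈ Icc a T', |y t| < B) → cost a L φ x v T ≤ cost a L φ y v' T'

section
variable {α a M N xa R C ΛL ΛF B T : ℝ} {L F : ℝ → ℝ → ℝ → ℝ} {φ : ℝ → ℝ → ℝ} {k x v : ℝ → ℝ}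

/-- Trajectories of perturbed controls. -/
theorem TameMinimizer.exists_variation
    (h : TameMinimizer α a M N xa R C ΛL ΛF B T L F φ k x v) {η : ℝ → ℝ} (hη : Continuous η)
    {E : ℝ} (hE : ∀ t, |η t| ≤ E) :
    ∃ (y : ℝ → ℝ → ℝ) (K : ℝ), 0 ≤ K ∧ ∀ ε, |ε| * E ≤ 1 →
      IsControl B (fun t => v t + ε * η t) ∧ IsTraj a R xa k F (y ε) (fun t => v t + ε * η t) ∧
        ∀ t ∈ Icc a R, |y ε t - x t| ≤ K * |ε| := by
  have haR := h.lt.trans h.lt_right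
  have hE0 : 0 ≤ E := (abs_nonneg _).trans (hE a)
  -- The bound `B - 1` on `v` leaves exactly one unit for the perturbation `ε η`.
  have hc : ∀ ε, |ε| * E ≤ 1 → IsControl B (fun t => v t + ε * η t) := fun ε hε => by
    obtain ⟨S, hS⟩ := h.control.cont
    refine ⟨fun t => ?_, S, fun t ht => (hS t ht).add (by fun_prop)⟩
    have h1 := h.control.bound t
    have h2 : |ε * η t| ≤ 1 := by
      rw [abs_mul]
      exact (mul_le_mul_of_nonneg_left (hE t) (abs_nonneg _)).trans hε
    linarith [abs_add_le (v t) (ε * η t)]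
  have hex : ∀ ε, ∃ y, |ε| * E ≤ 1 → IsTraj a R xa k F y (fun t => v t + ε * η t) := fun ε => by
    by_cases hε : |ε| * E ≤ 1
    · obtain ⟨y, -, hy⟩ := h.tame_dyn.exists_traj h.order h.kernel.toIsResolvent haR (hc ε hε) xa
      exact ⟨y, fun _ => hy⟩
    · exact ⟨0, fun h => absurd h hε⟩
  choose y hy using hex
  obtain ⟨K, hK, hst⟩ := h.tame_dyn.exists_stability h.order h.kernel.toIsResolvent haR
  refine ⟨y, K * (E * ((R - a) ^ α / α)), ?_, fun ε hε => ⟨hc ε hε, hy ε hε, fun t ht => ?_⟩⟩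
  · have := h.order.1
    have : 0 ≤ R - a := by linarith
    positivity
  refine (hst R B (|ε| * E * ((R - a) ^ α / α)) xa (y ε) _ x v le_rfl (hc ε hε)
    (h.control.mono (by linarith)) (hy ε hε) h.traj (fun t ht => ?_) t ht).trans_eq (by ring)
  have hm : ∀ s, |v s + ε * η s - v s| ≤ |ε| * E := fun s => by
    rw [add_sub_cancel_left, abs_mul]
    exact mul_le_mul_of_nonneg_left (hE s) (abs_nonneg _)
  have hi1 : IntervalIntegrable (fun s => (t - s) ^ (α - 1) * |v s + ε * η s - v s|) volume a t := by
    refine intervalIntegrable_rsub_rpow_mul (B := |ε| * E) h.order.1 ht.1 ?_ fun s _ => by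
      rw [abs_abs]; exact hm s
    simp only [add_sub_cancel_left]
    exact (by fun_prop : Continuous fun s => |ε * η s|).aestronglyMeasurable
  calc ∫ s in a..t, (t - s) ^ (α - 1) * |v s + ε * η s - v s|
      ≤ ∫ s in a..t, (t - s) ^ (α - 1) * (|ε| * E) := by
        refine intervalIntegral.integral_mono_on ht.1 hi1
          ((intervalIntegrable_rsub_rpow h.order.1 ht.1).mul_const _) fun s hs => ?_
        have := sub_nonneg.2 hs.2
        have := hm s
        gcongr
    _ = |ε| * E * ((t - a) ^ α / α) := by
        rw [intervalIntegral.integral_mul_const, integral_rsub_rpow h.order.1]; ring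
    _ ≤ _ := by
        have := h.order.1
        have := ht.2
        have := sub_nonneg.2 ht.1
        gcongr

/-- Bounded partial derivatives of tame data along a process. -/
theorem Tame.singBound_pd {a R Λ B b : ℝ} {F : ℝ → ℝ → ℝ → ℝ} {x v : ℝ → ℝ} (hF : Tame a R Λ F)
    (hv : IsControl B v) (hbR : b ≤ R) (hx : ContinuousOn x (Icc a b)) (w : ℝ × ℝ × ℝ)
    (hw : ∀ t ∈ Icc a R, ∀ x u, |pd a F w t x u| ≤ Λ) :
    SingBound 1 a b Λ (fun t => pd a F w t (x t) (v t)) :=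
  singBound_one_of_bound (hv.aestronglyMeasurable_comp (continuousOn_pd hF.smooth w) hx)
    fun s hs => hw s ⟨hs.1.le, hs.2.trans hbR⟩ _ _

/-- Time reversal carries `(a,T]` to `[0,T-a)`, so the value at `a`, now attained at the right end,
has to be bounded separately. -/
theorem SingBound.rsub {a T Λ : ℝ} {A : ℝ → ℝ} (h : SingBound 1 a T Λ A) (hA : |A a| ≤ Λ) :
    SingBound 1 0 (T - a) Λ (fun s => A (T - s)) := by
  refine singBound_one_of_bound ?_ fun s hs => ?_
  · have h1 : MeasurePreserving (fun s : ℝ => T - s) (volume.restrict (Ico 0 (T - a)))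
        (volume.restrict (Ioc a T)) := by
      have := (Measure.measurePreserving_sub_left volume T).restrict_preimage
        (measurableSet_Ioc (a := a) (b := T))
      have h2 : (fun s : ℝ => T - s) ⁻¹' Ioc a T = Ico 0 (T - a) := by
        ext s
        simp only [mem_preimage, mem_Ioc, mem_Ico]
        constructor <;> intro h <;> constructor <;> linarith [h.1, h.2]
      rwa [h2] at this
    have h3 := h.meas.comp_measurePreserving h1
    rwa [Measure.restrict_congr_set Ico_ae_eq_Ioc] at h3
  · rcases hs.2.eq_or_lt with rfl | h1
    · simpa using hA
    · simpa using h.bound (T - s) ⟨by linarith, by linarith [hs.1]⟩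

theorem SingBound.mul_one {a b C₁ C₂ : ℝ} {w₁ w₂ : ℝ → ℝ} (h₁ : SingBound 1 a b C₁ w₁)
    (h₂ : SingBound 1 a b C₂ w₂) : SingBound 1 a b (C₁ * C₂) (fun t => w₁ t * w₂ t) :=
  singBound_one_of_bound (h₁.meas.mul h₂.meas) fun s hs => by
    have e1 := h₁.bound s hs
    have e2 := h₂.bound s hs
    simp only [sub_self, Real.rpow_zero, _root_.mul_one] at e1 e2
    rw [abs_mul]
    exact mul_le_mul e1 e2 (abs_nonneg _) ((abs_nonneg _).trans e1)

theorem SingBound.sub {P a b C₁ C₂ : ℝ} {w₁ w₂ : ℝ → ℝ} (h₁ : SingBound P a b C₁ w₁)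
    (h₂ : SingBound P a b C₂ w₂) : SingBound P a b (C₁ + C₂) (fun t => w₁ t - w₂ t) :=
  ⟨h₁.meas.sub h₂.meas, fun s hs => by
    rw [add_mul]
    exact (abs_sub _ _).trans (add_le_add (h₁.bound s hs) (h₂.bound s hs))⟩

/-- The pointwise first order expansion of tame data under a variation. -/
theorem Tame.tendsto_expansion {Λ : ℝ} (hF : Tame a R Λ F) {t x₀ v₀ η₀ K : ℝ} (ht : t ∈ Icc a R)
    {δ : ℝ → ℝ} (hδ : ∀ᶠ ε in 𝓝[≠] (0 : ℝ), |δ ε| ≤ K * |ε|) :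
    Tendsto (fun ε => ε⁻¹ * (F t (x₀ + δ ε) (v₀ + ε * η₀) - F t x₀ v₀
      - pd a F (0, 1, 0) t x₀ v₀ * δ ε)) (𝓝[≠] 0) (𝓝 (pd a F (0, 0, 1) t x₀ v₀ * η₀)) := by
  -- The state increment `δ` need only be `O(ε)`: its contribution is subtracted rather than
  -- expanded, so no derivative of the state in `ε` is required.
  have h1 := hF.smooth.hasFDerivAt_slice ht.1 x₀ v₀
  have hδ0 : Tendsto δ (𝓝[≠] 0) (𝓝 0) := by
    refine squeeze_zero_norm' hδ ?_
    have : Continuous fun ε : ℝ => K * |ε| := by fun_prop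
    simpa using (this.tendsto 0).mono_left nhdsWithin_le_nhds
  have hlim : Tendsto (fun ε => (x₀ + δ ε, v₀ + ε * η₀)) (𝓝[≠] 0) (𝓝 (x₀, v₀)) := by
    refine Tendsto.prodMk_nhds (by simpa using hδ0.const_add x₀) ?_
    have : Continuous fun ε : ℝ => v₀ + ε * η₀ := by fun_prop
    simpa using (this.tendsto 0).mono_left nhdsWithin_le_nhds
  have h2 := h1.isLittleO.comp_tendsto hlim
  have h3 : (fun ε => (x₀ + δ ε, v₀ + ε * η₀) - (x₀, v₀)) =O[𝓝[≠] 0] (fun ε : ℝ => ε) := by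
    refine Asymptotics.IsBigO.of_bound (max K |η₀|) ?_
    filter_upwards [hδ] with ε hε
    rw [Prod.norm_def]
    refine max_le ?_ ?_
    · simpa using hε.trans (mul_le_mul_of_nonneg_right (le_max_left _ _) (abs_nonneg ε))
    · simp only [Prod.snd_sub, add_sub_cancel_left, norm_mul, Real.norm_eq_abs]
      rw [mul_comm]
      exact mul_le_mul_of_nonneg_right (le_max_right _ _) (abs_nonneg ε)
  have h4 := (h2.trans_isBigO h3).tendsto_inv_smul_nhds_zero
  have h5 := h4.add_const (pd a F (0, 0, 1) t x₀ v₀ * η₀)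
  rw [zero_add] at h5
  refine h5.congr' ?_
  filter_upwards [self_mem_nhdsWithin] with ε hε
  have hε' : ε ≠ 0 := hε
  simp
  field_simp
  ring

theorem TameMinimizer.singBound_state (h : TameMinimizer α a M N xa R C ΛL ΛF B T L F φ k x v)
    {Λ : ℝ} {G : ℝ → ℝ → ℝ → ℝ} (hG : Tame a R Λ G) :
    SingBound 1 a T Λ (fun t => pd a G (0, 1, 0) t (x t) (v t)) :=
  hG.singBound_pd h.control h.lt_right.le (h.traj.mono h.lt_right.le).cont _
    fun _ ht => hG.abs_pd_state_le ht

theorem TameMinimizer.singBound_state_rsub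
    (h : TameMinimizer α a M N xa R C ΛL ΛF B T L F φ k x v)
    {Λ : ℝ} {G : ℝ → ℝ → ℝ → ℝ} (hG : Tame a R Λ G) :
    SingBound 1 0 (T - a) Λ (fun s => pd a G (0, 1, 0) (T - s) (x (T - s)) (v (T - s))) :=
  (h.singBound_state hG).rsub (hG.abs_pd_state_le ⟨le_rfl, (h.lt.trans h.lt_right).le⟩ _ _)

/-- The first variation vanishes. -/
theorem TameMinimizer.integral_eq_zero (h : TameMinimizer α a M N xa R C ΛL ΛF B T L F φ k x v)
    {c γ : ℝ} {μ : ℝ → ℝ} (hφ : HasDerivAt (φ T) c (x T))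
    (hμ : IsCostate M (T - a) c γ k
      (fun s => pd a L (0, 1, 0) (T - s) (x (T - s)) (v (T - s)))
      (fun s => pd a F (0, 1, 0) (T - s) (x (T - s)) (v (T - s))) μ)
    {η : ℝ → ℝ} (hη : Continuous η) {E : ℝ} (hE : ∀ t, |η t| ≤ E) :
    ∫ t in a..T, (pd a L (0, 0, 1) t (x t) (v t) * η t
      + μ (T - t) * (pd a F (0, 0, 1) t (x t) (v t) * η t)) = 0 := by
  have haT := h.lt
  have hTR := h.lt_right
  have haR := haT.trans hTR
  have hE0 : 0 ≤ E := (abs_nonneg _).trans (hE a)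
  have hsub : Icc a T ⊆ Icc a R := Icc_subset_Icc_right hTR.le
  have hxc := (h.traj.mono hTR.le).cont
  obtain ⟨Cμ, hμs⟩ := hμ.sing
  obtain ⟨y, K, hK, hy⟩ := h.exists_variation hη hE
  have hcB : IsControl B v := h.control.mono (by linarith)
  have hev1 : ∀ᶠ ε in 𝓝[≠] (0 : ℝ), |ε| * E ≤ 1 := by
    have : Continuous fun ε : ℝ => |ε| * E := by fun_prop
    have := (this.tendsto 0).eventually (gt_mem_nhds (show |(0 : ℝ)| * E < 1 by simp))
    exact (this.filter_mono nhdsWithin_le_nhds).mono fun _ h => h.le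
  have hLx := h.singBound_state h.tame_cost
  have hFx := h.singBound_state h.tame_dyn
  set δ : ℝ → ℝ → ℝ := fun ε t => y ε t - x t with hδ
  set ΔL : ℝ → ℝ → ℝ := fun ε t => L t (y ε t) (v t + ε * η t) - L t (x t) (v t) with hΔL
  set ΔF : ℝ → ℝ → ℝ := fun ε t => F t (y ε t) (v t + ε * η t) - F t (x t) (v t) with hΔF
  set Lx : ℝ → ℝ := fun t => pd a L (0, 1, 0) t (x t) (v t) with hLxd
  set Fx : ℝ → ℝ := fun t => pd a F (0, 1, 0) t (x t) (v t) with hFxd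
  have hyc : ∀ ε, |ε| * E ≤ 1 → ContinuousOn (y ε) (Icc a T) := fun ε hε =>
    ((hy ε hε).2.1.mono hTR.le).cont
  have hδs : ∀ ε, |ε| * E ≤ 1 → ∃ D, SingBound 1 a T D (δ ε) := fun ε hε =>
    exists_singBound_one_of_continuousOn ((hyc ε hε).sub hxc)
  have hΔLs : ∀ ε, |ε| * E ≤ 1 → SingBound 1 a T (ΛL + ΛL) (ΔL ε) := fun ε hε =>
    (h.tame_cost.singBound (hy ε hε).1 hTR.le (hyc ε hε)).sub
      (h.tame_cost.singBound hcB hTR.le hxc)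
  have hΔFs : ∀ ε, |ε| * E ≤ 1 → SingBound 1 a T (ΛF + ΛF) (ΔF ε) := fun ε hε =>
    (h.tame_dyn.singBound (hy ε hε).1 hTR.le (hyc ε hε)).sub
      (h.tame_dyn.singBound hcB hTR.le hxc)
  have hμi : ∀ {w : ℝ → ℝ} {D : ℝ}, SingBound 1 a T D w →
      IntervalIntegrable (fun t => μ (T - t) * w t) volume a T := fun hw =>
    cv_intervalIntegrable hμ.pos one_pos haT.le hμs hw
  -- convergence of the first order quotients
  have hlim : Tendsto (fun ε => ∫ t in a..T, (ε⁻¹ * (ΔL ε t - Lx t * δ ε t)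
      + μ (T - t) * (ε⁻¹ * (ΔF ε t - Fx t * δ ε t)))) (𝓝[≠] 0)
      (𝓝 (∫ t in a..T, (pd a L (0, 0, 1) t (x t) (v t) * η t
        + μ (T - t) * (pd a F (0, 0, 1) t (x t) (v t) * η t)))) := by
    refine intervalIntegral.tendsto_integral_filter_of_dominated_convergence
      (fun t => ΛL * (2 * K + E) + |μ (T - t) * (ΛF * (2 * K + E))|) ?_ ?_ ?_ ?_
    · filter_upwards [hev1] with ε hε
      rw [uIoc_of_le haT.le]
      obtain ⟨D, hD⟩ := hδs ε hε
      have h1 := (((hΔLs ε hε).sub (hLx.mul_one hD)).intervalIntegrable one_pos haT.le).const_mul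
        ε⁻¹
      have h2 := (hμi ((hΔFs ε hε).sub (hFx.mul_one hD))).const_mul ε⁻¹
      have h3 := h1.add h2
      rw [intervalIntegrable_iff_integrableOn_Ioc_of_le haT.le] at h3
      refine h3.aestronglyMeasurable.congr (Eventually.of_forall fun t => ?_)
      simp only
      ring
    · filter_upwards [hev1, self_mem_nhdsWithin] with ε hε hε0
      refine Eventually.of_forall fun t ht => ?_
      rw [uIoc_of_le haT.le] at ht
      have htR : t ∈ Icc a R := ⟨ht.1.le, ht.2.trans hTR.le⟩
      have hε0' : 0 < |ε| := abs_pos.2 hε0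
      have key : ∀ {Λ : ℝ} {G : ℝ → ℝ → ℝ → ℝ}, Tame a R Λ G →
          |ε⁻¹ * (G t (y ε t) (v t + ε * η t) - G t (x t) (v t)
            - pd a G (0, 1, 0) t (x t) (v t) * δ ε t)| ≤ Λ * (2 * K + E) := by
        intro Λ G hG
        have h1 := hG.lip t htR (y ε t) (v t + ε * η t) (x t) (v t)
        have h2 := hG.abs_pd_state_le htR (x t) (v t)
        have h3 := (hy ε hε).2.2 t htR
        have h4 : |v t + ε * η t - v t| ≤ |ε| * E := by
          rw [add_sub_cancel_left, abs_mul]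
          exact mul_le_mul_of_nonneg_left (hE t) (abs_nonneg _)
        have hΛ := hG.nonneg
        rw [abs_mul, abs_inv, inv_mul_le_iff₀ hε0']
        calc _ ≤ Λ * (|y ε t - x t| + |v t + ε * η t - v t|)
              + |pd a G (0, 1, 0) t (x t) (v t)| * |δ ε t| := by
              refine (abs_sub _ _).trans ?_
              rw [abs_mul]
              gcongr
          _ ≤ Λ * (K * |ε| + |ε| * E) + Λ * (K * |ε|) := by gcongr
          _ = _ := by ring
      refine (norm_add_le _ _).trans (add_le_add (key h.tame_cost) ?_)
      rw [norm_mul, abs_mul]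
      have hΛ := h.tame_dyn.nonneg
      rw [abs_of_nonneg (show 0 ≤ ΛF * (2 * K + E) by positivity)]
      exact mul_le_mul_of_nonneg_left (key h.tame_dyn) (norm_nonneg _)
    · refine intervalIntegrable_const.add (hμi (D := |ΛF * (2 * K + E)|) ?_).abs
      exact singBound_one_of_bound aestronglyMeasurable_const fun _ _ => le_rfl
    · refine Eventually.of_forall fun t ht => ?_
      rw [uIoc_of_le haT.le] at ht
      have htR : t ∈ Icc a R := ⟨ht.1.le, ht.2.trans hTR.le⟩
      have hδε : ∀ᶠ ε in 𝓝[≠] (0 : ℝ), |δ ε t| ≤ K * |ε| := by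
        filter_upwards [hev1] with ε hε using (hy ε hε).2.2 t htR
      have e : ∀ ε, x t + δ ε t = y ε t := fun ε => by simp [hδ]
      have h1 := h.tame_cost.tendsto_expansion (x₀ := x t) (v₀ := v t) (η₀ := η t) htR hδε
      have h2 := h.tame_dyn.tendsto_expansion (x₀ := x t) (v₀ := v t) (η₀ := η t) htR hδε
      simp only [e] at h1 h2
      exact h1.add (h2.const_mul _)
  -- the increment of the cost
  have hcost : ∀ ε, ε ≠ 0 → |ε| * E ≤ 1 →
      ε⁻¹ * (cost a L φ (y ε) (fun t => v t + ε * η t) T - cost a L φ x v T)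
      = (∫ t in a..T, (ε⁻¹ * (ΔL ε t - Lx t * δ ε t)
        + μ (T - t) * (ε⁻¹ * (ΔF ε t - Fx t * δ ε t))))
        + ε⁻¹ * (φ T (y ε T) - φ T (x T) - (y ε T - x T) * c) := by
    intro ε hε0 hε
    obtain ⟨D, hD⟩ := hδs ε hε
    -- Duality is applied to the exact increment `ΔF ε`, whose convolution with `k` is the exact
    -- state increment. It trades the terms containing `Lx` and `Fx` for `μ ΔF` and the end point
    -- term.
    have hdual := hμ.integral_mul_eq (A := Lx) (B := Fx) h.order haT (h.kernel.mono (by linarith))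
      (h.singBound_state_rsub h.tame_cost) (h.singBound_state_rsub h.tame_dyn) (hΔFs ε hε)
    have hcv : ∀ t ∈ Icc a T, cv a k (ΔF ε) t = δ ε t := fun t ht => by
      have hk : SingBound α 0 (t - a) C k := h.kernel.sing.mono (by linarith [ht.2])
      rw [hΔF, cv_sub h.order.1 one_pos ht.1 hk
        ((h.tame_dyn.singBound (hy ε hε).1 hTR.le (hyc ε hε)).mono ht.2)
        ((h.tame_dyn.singBound hcB hTR.le hxc).mono ht.2), hδ]
      have e1 := (hy ε hε).2.1.eq t (hsub ht)
      have e2 := h.traj.eq t (hsub ht)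
      linarith
    have hint : ∫ t in a..T, (Lx t + Fx t * μ (T - t)) * cv a k (ΔF ε) t
        = ∫ t in a..T, (Lx t * δ ε t + μ (T - t) * (Fx t * δ ε t)) := by
      refine intervalIntegral.integral_congr fun t ht => ?_
      rw [uIcc_of_le haT.le] at ht
      simp only [hcv t ht]
      ring
    have i1 := (hΔLs ε hε).intervalIntegrable one_pos haT.le
    have i2 := (hLx.mul_one hD).intervalIntegrable one_pos haT.le
    have i3 := hμi (hΔFs ε hε)
    have i4 := hμi (hFx.mul_one hD)
    rw [hint, hcv T ⟨haT.le, le_rfl⟩, intervalIntegral.integral_add i2 i4] at hdual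
    have j1 := (h.tame_cost.singBound (hy ε hε).1 hTR.le (hyc ε hε)).intervalIntegrable one_pos
      haT.le
    have j2 := (h.tame_cost.singBound hcB hTR.le hxc).intervalIntegrable one_pos haT.le
    have e1 : ∫ t in a..T, (ε⁻¹ * (ΔL ε t - Lx t * δ ε t)
        + μ (T - t) * (ε⁻¹ * (ΔF ε t - Fx t * δ ε t)))
        = ε⁻¹ * (((∫ t in a..T, ΔL ε t) - ∫ t in a..T, Lx t * δ ε t)
          + ((∫ t in a..T, μ (T - t) * ΔF ε t) - ∫ t in a..T, μ (T - t) * (Fx t * δ ε t))) := by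
      rw [← intervalIntegral.integral_sub i1 i2, ← intervalIntegral.integral_sub i3 i4,
        ← intervalIntegral.integral_add (i1.sub i2) (i3.sub i4),
        ← intervalIntegral.integral_const_mul]
      congr 1; ext t; ring
    rw [e1, hdual, cost, cost, hΔL, intervalIntegral.integral_sub j1 j2]
    simp only [hδ]
    ring
  have hφlim : Tendsto (fun ε => ε⁻¹ * (φ T (y ε T) - φ T (x T) - (y ε T - x T) * c)) (𝓝[≠] 0)
      (𝓝 0) := by
    have hb : ∀ᶠ ε in 𝓝[≠] (0 : ℝ), |y ε T - x T| ≤ K * |ε| := by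
      filter_upwards [hev1] with ε hε using (hy ε hε).2.2 T ⟨haT.le, hTR.le⟩
    have hyT : Tendsto (fun ε => y ε T) (𝓝[≠] 0) (𝓝 (x T)) := by
      rw [tendsto_iff_norm_sub_tendsto_zero]
      refine squeeze_zero' (Eventually.of_forall fun _ => norm_nonneg _) hb ?_
      have : Continuous fun ε : ℝ => K * |ε| := by fun_prop
      simpa using (this.tendsto 0).mono_left nhdsWithin_le_nhds
    have h1 := hφ.isLittleO.comp_tendsto hyT
    have h2 : (fun ε => y ε T - x T) =O[𝓝[≠] 0] (fun ε : ℝ => ε) :=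
      Asymptotics.IsBigO.of_bound K (by simpa using hb)
    exact (h1.trans_isBigO h2).tendsto_inv_smul_nhds_zero
  have hfin := hlim.add hφlim
  rw [add_zero] at hfin
  obtain ⟨B₀, hB₀, hxB₀⟩ : ∃ B₀ < B, ∀ t ∈ Icc a T, |x t| ≤ B₀ := by
    obtain ⟨t₀, ht₀, hmax⟩ := isCompact_Icc.exists_isMaxOn (nonempty_Icc.2 haT.le) hxc.abs
    exact ⟨|x t₀|, h.bound t₀ ht₀, fun t ht => hmax ht⟩
  have hev2 : ∀ᶠ ε in 𝓝[≠] (0 : ℝ), K * |ε| < B - B₀ := by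
    have : Continuous fun ε : ℝ => K * |ε| := by fun_prop
    have := (this.tendsto 0).eventually (gt_mem_nhds (show K * |0| < B - B₀ by simpa using hB₀))
    exact this.filter_mono nhdsWithin_le_nhds
  have hmin : ∀ᶠ ε in 𝓝[≠] (0 : ℝ), ε ≠ 0 ∧ |ε| * E ≤ 1 ∧
      0 ≤ cost a L φ (y ε) (fun t => v t + ε * η t) T - cost a L φ x v T := by
    filter_upwards [hev1, hev2, self_mem_nhdsWithin] with ε h1 h2 h3
    refine ⟨h3, h1, sub_nonneg.2 (h.min _ _ T (hy ε h1).1 (hy ε h1).2.1 ⟨haT, hTR⟩ fun t ht => ?_)⟩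
    have := (hy ε h1).2.2 t (hsub ht)
    have h4 := hxB₀ t ht
    have h5 : |y ε t| ≤ |y ε t - x t| + |x t| := by
      simpa using abs_add_le (y ε t - x t) (x t)
    linarith
  refine le_antisymm ?_ ?_
  · have hle : 𝓝[<] (0 : ℝ) ≤ 𝓝[≠] 0 := nhdsWithin_mono _ fun _ h => ne_of_lt h
    refine le_of_tendsto (hfin.mono_left hle) ?_
    filter_upwards [hmin.filter_mono hle, self_mem_nhdsWithin] with ε hε hneg
    rw [← hcost ε hε.1 hε.2.1]
    exact mul_nonpos_of_nonpos_of_nonneg (inv_nonpos.2 (le_of_lt hneg)) hε.2.2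
  · have hle : 𝓝[>] (0 : ℝ) ≤ 𝓝[≠] 0 := nhdsWithin_mono _ fun _ h => ne_of_gt h
    refine ge_of_tendsto (hfin.mono_left hle) ?_
    filter_upwards [hmin.filter_mono hle, self_mem_nhdsWithin] with ε hε hpos
    rw [← hcost ε hε.1 hε.2.1]
    exact mul_nonneg (inv_nonneg.2 (le_of_lt hpos)) hε.2.2

/-- A set of full measure is dense, so a point of continuity relative to `[a,T]` inherits the value
zero. This upgrades almost everywhere stationarity to pointwise stationarity, end points included.
-/
theorem eq_zero_of_ae_eq_zero {g : ℝ → ℝ} {a T t : ℝ} (haT : a < T) (ht : t ∈ Icc a T)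
    (hg : ContinuousWithinAt g (Icc a T) t) (h : ∀ᵐ s, s ∈ Ioo a T → g s = 0) : g t = 0 := by
  have hd : Dense {s | s ∈ Ioo a T → g s = 0} := Measure.dense_of_ae h
  have h1 : t ∈ closure (Ioo a T ∩ {s | s ∈ Ioo a T → g s = 0}) := by
    rw [← closure_Ioo haT.ne] at ht
    exact closure_minimal (hd.open_subset_closure_inter isOpen_Ioo) isClosed_closure ht
  have : (𝓝[Ioo a T ∩ {s | s ∈ Ioo a T → g s = 0}] t).NeBot :=
    mem_closure_iff_nhdsWithin_neBot.1 h1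
  have h2 := hg.mono_left (nhdsWithin_mono t
    (inter_subset_left.trans Ioo_subset_Icc_self :
      Ioo a T ∩ {s | s ∈ Ioo a T → g s = 0} ⊆ Icc a T))
  refine tendsto_nhds_unique h2 (tendsto_const_nhds.congr' ?_)
  filter_upwards [self_mem_nhdsWithin] with s hs
  exact (hs.2 hs.1).symm

/-- The stationarity condition almost everywhere. -/
theorem TameMinimizer.stationary_ae (h : TameMinimizer α a M N xa R C ΛL ΛF B T L F φ k x v)
    {c γ : ℝ} {μ : ℝ → ℝ} (hφ : HasDerivAt (φ T) c (x T))
    (hμ : IsCostate M (T - a) c γ k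
      (fun s => pd a L (0, 1, 0) (T - s) (x (T - s)) (v (T - s)))
      (fun s => pd a F (0, 1, 0) (T - s) (x (T - s)) (v (T - s))) μ) :
    ∀ᵐ t, t ∈ Ioo a T → pd a L (0, 0, 1) t (x t) (v t)
      + μ (T - t) * pd a F (0, 0, 1) t (x t) (v t) = 0 := by
  have haT := h.lt
  have hxc := (h.traj.mono h.lt_right.le).cont
  obtain ⟨Cμ, hμs⟩ := hμ.sing
  have hLu := h.tame_cost.singBound_pd h.control h.lt_right.le hxc (0, 0, 1)
    fun _ ht => h.tame_cost.abs_pd_control_le ht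
  have hFu := h.tame_dyn.singBound_pd h.control h.lt_right.le hxc (0, 0, 1)
    fun _ ht => h.tame_dyn.abs_pd_control_le ht
  have hi : IntervalIntegrable (fun t => pd a L (0, 0, 1) t (x t) (v t)
      + μ (T - t) * pd a F (0, 0, 1) t (x t) (v t)) volume a T :=
    (hLu.intervalIntegrable one_pos haT.le).add
      (cv_intervalIntegrable hμ.pos one_pos haT.le hμs hFu)
  rw [intervalIntegrable_iff_integrableOn_Ioo_of_le haT.le] at hi
  refine isOpen_Ioo.ae_eq_zero_of_integral_contDiff_smul_eq_zero hi.locallyIntegrableOn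
    fun g hg hgc hgs => ?_
  obtain ⟨E, hE⟩ := hgc.exists_bound_of_continuous hg.continuous
  have h0 := h.integral_eq_zero hφ hμ hg.continuous hE
  rw [intervalIntegral.integral_of_le haT.le, integral_Ioc_eq_integral_Ioo] at h0
  rw [← setIntegral_eq_integral_of_forall_compl_eq_zero (s := Ioo a T)]
  · refine Eq.trans ?_ h0
    congr 1; ext t; simp only [smul_eq_mul]; ring
  · intro t ht
    rw [image_eq_zero_of_notMem_tsupport fun h => ht (hgs h), zero_smul]

end

/-! ### Increments of the kernel `τ^(-α)` against functions with small primitive -/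

section
variable {α h σ ρ ε b : ℝ} {v w : ℝ → ℝ}

theorem hasDerivAt_kernel_diff (hh : 0 < h) {τ : ℝ} (hτ : 0 < τ) :
    HasDerivAt (fun τ : ℝ => τ ^ (-α) - (τ + h) ^ (-α))
      (-α * (τ ^ (-α - 1) - (τ + h) ^ (-α - 1))) τ := by
  have h1 := Real.hasDerivAt_rpow_const (x := τ) (p := -α) (Or.inl hτ.ne')
  have h2 := ((hasDerivAt_id τ).add_const h).rpow_const (p := -α) (Or.inl (by simp; positivity))
  convert! h1.sub h2 using 1
  simp
  ring

theorem kernel_diff_nonneg (hα : 0 ≤ α) (hh : 0 < h) {τ : ℝ} (hτ : 0 < τ) :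
    0 ≤ τ ^ (-α) - (τ + h) ^ (-α) :=
  sub_nonneg.2 (Real.rpow_le_rpow_of_nonpos hτ (by linarith) (by linarith))

/-- Integration by parts against the primitive of `v`. The kernel increment is nonnegative and
decreasing in `τ`, so the boundary term at `ρ` and the new integral have a favourable sign; only the
boundary term at `σ` is lost. -/
theorem neg_le_integral_kernel_diff (hα : 0 ≤ α) (hh : 0 < h) (hσ : 0 < σ) (hσρ : σ ≤ ρ)
    (hv : IntervalIntegrable v volume 0 ρ) (hV : ∀ τ ∈ Icc 0 ρ, 0 ≤ ∫ s in (0 : ℝ)..τ, v s) :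
    -((σ ^ (-α) - (σ + h) ^ (-α)) * ∫ s in (0 : ℝ)..σ, v s)
      ≤ ∫ τ in σ..ρ, (τ ^ (-α) - (τ + h) ^ (-α)) * v τ := by
  have hρ : 0 < ρ := hσ.trans_le hσρ
  set q : ℝ → ℝ := fun τ => τ ^ (-α) - (τ + h) ^ (-α) with hq
  have hqc : ContDiffOn ℝ 1 q (uIcc σ ρ) := by
    rw [uIcc_of_le hσρ]
    refine ContDiffOn.sub ?_ ?_
    · exact contDiffOn_id.rpow_const_of_ne fun τ hτ => (hσ.trans_le hτ.1).ne'
    · exact (contDiffOn_id.add contDiffOn_const).rpow_const_of_ne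
        fun τ hτ => (add_pos (hσ.trans_le hτ.1) hh).ne'
  have hVac : AbsolutelyContinuousOnInterval (fun τ => ∫ s in (0 : ℝ)..τ, v s) σ ρ :=
    (hv.absolutelyContinuousOnInterval_intervalIntegral left_mem_uIcc).mono (by
      rw [uIcc_of_le hσρ, uIcc_of_le hρ.le]; exact Icc_subset_Icc_left hσ.le)
  have hibp := hqc.absolutelyContinuousOnInterval.integral_mul_deriv_eq_deriv_mul hVac
  have e1 : ∫ τ in σ..ρ, q τ * deriv (fun τ => ∫ s in (0 : ℝ)..τ, v s) τ
      = ∫ τ in σ..ρ, q τ * v τ := by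
    apply intervalIntegral.integral_congr_ae
    filter_upwards [hv.ae_hasDerivAt_integral] with τ hτ hτ2
    rw [uIoc_of_le hσρ] at hτ2
    rw [uIcc_of_le hρ.le] at hτ
    rw [(hτ ⟨hσ.le.trans hτ2.1.le, hτ2.2⟩ 0 ⟨le_rfl, hρ.le⟩).deriv]
  have e2 : ∫ τ in σ..ρ, deriv q τ * ∫ s in (0 : ℝ)..τ, v s ≤ 0 := by
    rw [← neg_nonneg, ← intervalIntegral.integral_neg]
    refine intervalIntegral.integral_nonneg hσρ fun τ hτ => neg_nonneg.2 ?_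
    have hτ0 : 0 < τ := hσ.trans_le hτ.1
    refine mul_nonpos_of_nonpos_of_nonneg ?_ (hV τ ⟨hτ0.le, hτ.2⟩)
    rw [(hasDerivAt_kernel_diff hh hτ0).deriv, neg_mul, neg_nonpos]
    exact mul_nonneg hα (sub_nonneg.2
      (Real.rpow_le_rpow_of_nonpos hτ0 (by linarith) (by linarith)))
  rw [← e1, hibp]
  have e3 := mul_nonneg (kernel_diff_nonneg (α := α) hα hh hρ) (hV ρ ⟨hρ.le, le_rfl⟩)
  simp only [hq] at e2 ⊢
  linarith

/-- Let `σ → 0` in the previous bound: as the primitive is at most `E σ`, the lost boundary term is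
at most `E σ^(1-α)`. -/
theorem integral_kernel_diff_nonneg (hα : α ∈ Ioo (0 : ℝ) 1) (hh : 0 < h) (hρ : 0 < ρ)
    (hv : IntervalIntegrable v volume 0 ρ)
    (hqv : IntervalIntegrable (fun τ => (τ ^ (-α) - (τ + h) ^ (-α)) * v τ) volume 0 ρ)
    (hV : ∀ τ ∈ Icc 0 ρ, 0 ≤ ∫ s in (0 : ℝ)..τ, v s) {E : ℝ}
    (hVE : ∀ τ ∈ Icc 0 ρ, ∫ s in (0 : ℝ)..τ, v s ≤ E * τ) :
    0 ≤ ∫ τ in (0 : ℝ)..ρ, (τ ^ (-α) - (τ + h) ^ (-α)) * v τ := by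
  have hα' : 0 < 1 - α := by linarith [hα.2]
  have hle : 𝓝[>] (0 : ℝ) ≤ 𝓝[Icc 0 ρ] 0 := by
    rw [← nhdsWithin_Ioc_eq_nhdsGT hρ]; exact nhdsWithin_mono _ Ioc_subset_Icc_self
  have h1 : Tendsto (fun σ => ∫ τ in σ..ρ, (τ ^ (-α) - (τ + h) ^ (-α)) * v τ) (𝓝[>] 0)
      (𝓝 (∫ τ in (0 : ℝ)..ρ, (τ ^ (-α) - (τ + h) ^ (-α)) * v τ)) := by
    have h2 := intervalIntegral.continuousOn_primitive_interval' hqv.symm right_mem_uIcc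
    rw [uIcc_comm, uIcc_of_le hρ.le] at h2
    have h3 := intervalIntegral.continuousOn_primitive_interval' hqv right_mem_uIcc
    rw [uIcc_of_le hρ.le] at h3
    have h4 := ((h3 0 ⟨le_rfl, hρ.le⟩).mono_left hle).neg
    simp only [← intervalIntegral.integral_symm] at h4
    exact h4
  have h5 : Tendsto (fun σ : ℝ => -(E * σ ^ (1 - α))) (𝓝[>] 0) (𝓝 0) := by
    have : Continuous fun σ : ℝ => -(E * σ ^ (1 - α)) :=
      (continuous_const.mul (Real.continuous_rpow_const hα'.le)).neg
    have := (this.tendsto 0).mono_left (nhdsWithin_le_nhds (s := Ioi (0 : ℝ)))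
    simpa [Real.zero_rpow hα'.ne'] using this
  refine le_of_tendsto_of_tendsto h5 h1 ?_
  filter_upwards [Ioc_mem_nhdsGT hρ] with σ hσ
  refine le_trans ?_ (neg_le_integral_kernel_diff hα.1.le hh hσ.1 hσ.2 hv hV)
  rw [neg_le_neg_iff]
  have hσI : σ ∈ Icc 0 ρ := ⟨hσ.1.le, hσ.2⟩
  have h6 : σ ^ (-α) - (σ + h) ^ (-α) ≤ σ ^ (-α) :=
    sub_le_self _ (Real.rpow_nonneg (by linarith [hσ.1]) _)
  calc _ ≤ σ ^ (-α) * (E * σ) := by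
        refine mul_le_mul h6 (hVE σ hσI) (hV σ hσI) (Real.rpow_nonneg hσ.1.le _)
    _ = E * σ ^ (1 - α) := by
        rw [show 1 - α = -α + 1 by ring, Real.rpow_add hσ.1, Real.rpow_one]; ring

theorem intervalIntegrable_add_rpow (hh : 0 < h) (hρ : 0 ≤ ρ) (p : ℝ) :
    IntervalIntegrable (fun τ : ℝ => (τ + h) ^ p) volume 0 ρ := by
  refine ContinuousOn.intervalIntegrable_of_Icc hρ fun τ hτ => ?_
  exact (ContinuousAt.rpow_const (by fun_prop)
    (Or.inl (by linarith [hτ.1]))).continuousWithinAt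

theorem intervalIntegrable_rpow_neg (hα : α < 1) (ρ : ℝ) :
    IntervalIntegrable (fun τ : ℝ => τ ^ (-α)) volume 0 ρ :=
  intervalIntegral.intervalIntegrable_rpow' (by linarith)

theorem integral_kernel_diff_le (hα : α ∈ Ioo (0 : ℝ) 1) (hh : 0 < h) (hρ : 0 ≤ ρ) :
    ∫ τ in (0 : ℝ)..ρ, (τ ^ (-α) - (τ + h) ^ (-α)) ≤ h ^ (1 - α) / (1 - α) := by
  have hα' : 0 < 1 - α := by linarith [hα.2]
  rw [intervalIntegral.integral_sub (intervalIntegrable_rpow_neg hα.2 ρ)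
    (intervalIntegrable_add_rpow hh hρ _), integral_rpow (Or.inl (by linarith [hα.2])),
    intervalIntegral.integral_comp_add_right (fun τ => τ ^ (-α)) h,
    integral_rpow (Or.inl (by linarith [hα.2])), show -α + 1 = 1 - α by ring, zero_add,
    Real.zero_rpow hα'.ne', sub_zero, ← sub_div]
  have : ρ ^ (1 - α) ≤ (ρ + h) ^ (1 - α) := Real.rpow_le_rpow hρ (by linarith) hα'.le
  gcongr
  linarith

/-- The positivity lemma is applied to `ε + w` and `ε - w`. Only the primitive of `w` is small,
which is all that differentiability of the state at one point provides; `w` itself may oscillate. -/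
theorem abs_integral_kernel_diff_le (hα : α ∈ Ioo (0 : ℝ) 1) (hh : 0 < h) (hρ : 0 < ρ)
    (hw : IntervalIntegrable w volume 0 ρ)
    (hqw : IntervalIntegrable (fun τ => (τ ^ (-α) - (τ + h) ^ (-α)) * w τ) volume 0 ρ)
    (hε : 0 ≤ ε) (hW : ∀ τ ∈ Icc 0 ρ, |∫ s in (0 : ℝ)..τ, w s| ≤ ε * τ) :
    |∫ τ in (0 : ℝ)..ρ, (τ ^ (-α) - (τ + h) ^ (-α)) * w τ| ≤ ε * (h ^ (1 - α) / (1 - α)) := by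
  have hq : IntervalIntegrable (fun τ : ℝ => τ ^ (-α) - (τ + h) ^ (-α)) volume 0 ρ :=
    (intervalIntegrable_rpow_neg hα.2 ρ).sub (intervalIntegrable_add_rpow hh hρ.le _)
  have hle := mul_le_mul_of_nonneg_left (integral_kernel_diff_le hα hh hρ.le) hε
  have key : ∀ w : ℝ → ℝ, IntervalIntegrable w volume 0 ρ →
      IntervalIntegrable (fun τ => (τ ^ (-α) - (τ + h) ^ (-α)) * w τ) volume 0 ρ →
      (∀ τ ∈ Icc 0 ρ, |∫ s in (0 : ℝ)..τ, w s| ≤ ε * τ) →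
      0 ≤ (∫ τ in (0 : ℝ)..ρ, (τ ^ (-α) - (τ + h) ^ (-α)) * w τ)
        + ε * ∫ τ in (0 : ℝ)..ρ, (τ ^ (-α) - (τ + h) ^ (-α)) := by
    intro w hw hqw hW
    have hprim : ∀ τ ∈ Icc 0 ρ, ∫ s in (0 : ℝ)..τ, (w s + ε) = (∫ s in (0 : ℝ)..τ, w s) + ε * τ := by
      intro τ hτ
      rw [intervalIntegral.integral_add (hw.mono_set (by
        rw [uIcc_of_le hτ.1, uIcc_of_le hρ.le]; exact Icc_subset_Icc_right hτ.2))
        intervalIntegrable_const, intervalIntegral.integral_const]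
      simp [mul_comm]
    have h1 := integral_kernel_diff_nonneg (v := fun τ => w τ + ε) (E := 2 * ε) hα hh hρ
      (hw.add intervalIntegrable_const)
      (by simpa [mul_add] using hqw.add (hq.mul_const ε))
      (fun τ hτ => by rw [hprim τ hτ]; linarith [neg_abs_le (∫ s in (0 : ℝ)..τ, w s), hW τ hτ])
      (fun τ hτ => by rw [hprim τ hτ]; linarith [le_abs_self (∫ s in (0 : ℝ)..τ, w s), hW τ hτ])
    simp only [mul_add] at h1
    rw [intervalIntegral.integral_add hqw (hq.mul_const ε), intervalIntegral.integral_mul_const]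
      at h1
    linarith
  have h1 := key w hw hqw hW
  have h2 := key (fun τ => -w τ) hw.neg (by simp only [mul_neg]; exact hqw.neg)
    (fun τ hτ => by simpa using hW τ hτ)
  simp only [mul_neg, intervalIntegral.integral_neg] at h2
  rw [abs_le]
  constructor <;> linarith

theorem kernel_diff_le (hα : α ∈ Ioo (0 : ℝ) 1) (hh : 0 < h) (hρ : 0 < ρ) {τ : ℝ} (hτ : ρ ≤ τ) :
    τ ^ (-α) - (τ + h) ^ (-α) ≤ ρ ^ (-α - 1) * h := by
  have hτ0 : 0 < τ := hρ.trans_le hτ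
  have hτh : 0 < τ + h := by linarith
  have h1 : τ / (τ + h) ≤ (τ / (τ + h)) ^ α := by
    have := Real.rpow_le_rpow_of_exponent_ge (x := τ / (τ + h)) (by positivity)
      ((div_le_one hτh).2 (by linarith)) hα.2.le
    rwa [Real.rpow_one] at this
  have h2 : (τ + h) ^ (-α) = τ ^ (-α) * (τ / (τ + h)) ^ α := by
    rw [Real.div_rpow hτ0.le hτh.le, Real.rpow_neg hτ0.le, Real.rpow_neg hτh.le]
    have := (Real.rpow_pos_of_pos hτ0 α).ne'
    field_simp
  have h3 : 0 ≤ τ ^ (-α) := Real.rpow_nonneg hτ0.le _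
  calc τ ^ (-α) - (τ + h) ^ (-α) ≤ τ ^ (-α) - τ ^ (-α) * (τ / (τ + h)) := by
        rw [h2]; gcongr
    _ = τ ^ (-α) * (h / (τ + h)) := by field_simp; ring
    _ ≤ τ ^ (-α) * (h / τ) := by gcongr; linarith
    _ = τ ^ (-α - 1) * h := by rw [Real.rpow_sub_one hτ0.ne']; ring
    _ ≤ ρ ^ (-α - 1) * h := by
        have := Real.rpow_le_rpow_of_nonpos hρ hτ (show -α - 1 ≤ 0 by linarith [hα.1])
        gcongr

/-- The increments of the kernel `τ^(-α)` are negligible against functions with small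
primitive. -/
theorem eventually_integral_kernel_diff_le (hα : α ∈ Ioo (0 : ℝ) 1) (hb : 0 < b)
    (hw : IntervalIntegrable w volume 0 b)
    (hpw : IntervalIntegrable (fun τ => τ ^ (-α) * w τ) volume 0 b)
    (hW : ∀ ε > 0, ∃ ρ > 0, ∀ τ ∈ Icc 0 ρ, |∫ s in (0 : ℝ)..τ, w s| ≤ ε * τ) (hε : 0 < ε) :
    ∀ᶠ h in 𝓝[>] 0, |∫ τ in (0 : ℝ)..b, (τ ^ (-α) - (τ + h) ^ (-α)) * w τ| ≤ ε * h ^ (1 - α) := by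
  have hα' : 0 < 1 - α := by linarith [hα.2]
  -- On `[0,ρ]` the small primitive yields `(ε/2) h^(1-α)`. Beyond `ρ` the kernel increment is
  -- `O(h)`, which is negligible against `h^(1-α)`.
  obtain ⟨ρ', hρ', hWρ⟩ := hW (ε * (1 - α) / 2) (by positivity)
  set ρ := min ρ' b with hρd
  have hρ : 0 < ρ := lt_min hρ' hb
  have hρb : ρ ≤ b := min_le_right _ _
  set I : ℝ := ∫ τ in (0 : ℝ)..b, |w τ| with hI
  have hev : ∀ᶠ h in 𝓝[>] (0 : ℝ), ρ ^ (-α - 1) * I * h ^ α ≤ ε / 2 := by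
    have h1 : Continuous fun h : ℝ => ρ ^ (-α - 1) * I * h ^ α :=
      continuous_const.mul (Real.continuous_rpow_const hα.1.le)
    have h2 := (h1.tendsto 0).eventually
      (gt_mem_nhds (show ρ ^ (-α - 1) * I * (0 : ℝ) ^ α < ε / 2 by
        rw [Real.zero_rpow hα.1.ne', mul_zero]; positivity))
    exact (h2.filter_mono nhdsWithin_le_nhds).mono fun _ h => h.le
  filter_upwards [hev, self_mem_nhdsWithin] with h hh0 hh
  have hh : 0 < h := hh
  have hqw : IntervalIntegrable (fun τ => (τ ^ (-α) - (τ + h) ^ (-α)) * w τ) volume 0 b := by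
    simp only [sub_mul]
    refine hpw.sub (hw.continuousOn_mul ?_)
    rw [uIcc_of_le hb.le]
    exact fun τ hτ => (ContinuousAt.rpow_const (by fun_prop)
      (Or.inl (by linarith [hτ.1]))).continuousWithinAt
  have hs1 : uIcc 0 ρ ⊆ uIcc 0 b := by
    rw [uIcc_of_le hρ.le, uIcc_of_le hb.le]; exact Icc_subset_Icc_right hρb
  have hs2 : uIcc ρ b ⊆ uIcc 0 b := by
    rw [uIcc_of_le hρb, uIcc_of_le hb.le]; exact Icc_subset_Icc_left hρ.le
  rw [← intervalIntegral.integral_add_adjacent_intervals (hqw.mono_set hs1) (hqw.mono_set hs2)]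
  have n1 := abs_integral_kernel_diff_le hα hh hρ (hw.mono_set hs1) (hqw.mono_set hs1)
    (by positivity) fun τ hτ => hWρ τ ⟨hτ.1, hτ.2.trans (min_le_left _ _)⟩
  have n2 : |∫ τ in ρ..b, (τ ^ (-α) - (τ + h) ^ (-α)) * w τ| ≤ ρ ^ (-α - 1) * h * I := by
    calc _ ≤ ∫ τ in ρ..b, ρ ^ (-α - 1) * h * |w τ| := by
          rw [← Real.norm_eq_abs]
          refine intervalIntegral.norm_integral_le_of_norm_le hρb
            (Eventually.of_forall fun τ hτ => ?_) ((hw.mono_set hs2).abs.const_mul _)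
          have hτ0 : 0 < τ := hρ.trans hτ.1
          rw [Real.norm_eq_abs, abs_mul, abs_of_nonneg (kernel_diff_nonneg hα.1.le hh hτ0)]
          gcongr
          exact kernel_diff_le hα hh hρ hτ.1.le
      _ = ρ ^ (-α - 1) * h * ∫ τ in ρ..b, |w τ| := by rw [intervalIntegral.integral_const_mul]
      _ ≤ _ := by
          gcongr
          rw [hI, ← intervalIntegral.integral_add_adjacent_intervals (hw.abs.mono_set hs1)
            (hw.abs.mono_set hs2)]
          have : 0 ≤ ∫ τ in (0 : ℝ)..ρ, |w τ| :=
            intervalIntegral.integral_nonneg hρ.le fun _ _ => abs_nonneg _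
          linarith
  have e1 : ε * (1 - α) / 2 * (h ^ (1 - α) / (1 - α)) = ε / 2 * h ^ (1 - α) := by field_simp
  have e2 : ρ ^ (-α - 1) * h * I = ρ ^ (-α - 1) * I * h ^ α * h ^ (1 - α) := by
    rw [mul_assoc _ (h ^ α), ← Real.rpow_add hh]; simp; ring
  have n3 : ρ ^ (-α - 1) * I * h ^ α * h ^ (1 - α) ≤ ε / 2 * h ^ (1 - α) :=
    mul_le_mul_of_nonneg_right hh0 (Real.rpow_nonneg hh.le _)
  calc _ ≤ _ := abs_add_le _ _
    _ ≤ ε / 2 * h ^ (1 - α) + ε / 2 * h ^ (1 - α) := by linarith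
    _ = _ := by ring

end

/-! ### Differentiability at `T` of the continued state -/

theorem eventually_le_mul_rpow {α ε : ℝ} (hα : 0 < α) (K : ℝ) (hε : 0 < ε) :
    ∀ᶠ h in 𝓝[>] (0 : ℝ), K * h ≤ ε * h ^ (1 - α) := by
  have h1 : Continuous fun h : ℝ => K * h ^ α :=
    continuous_const.mul (Real.continuous_rpow_const hα.le)
  have h2 := (h1.tendsto 0).eventually
    (gt_mem_nhds (show K * (0 : ℝ) ^ α < ε by rwa [Real.zero_rpow hα.ne', mul_zero]))
  filter_upwards [h2.filter_mono nhdsWithin_le_nhds, self_mem_nhdsWithin] with h hh hh0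
  have hh0 : 0 < h := hh0
  calc K * h = K * h ^ α * h ^ (1 - α) := by
        rw [mul_assoc, ← Real.rpow_add hh0]; simp
    _ ≤ ε * h ^ (1 - α) := by
        have := Real.rpow_nonneg hh0.le (1 - α)
        gcongr

theorem add_rpow_sub_le {b h p : ℝ} (hb : 0 < b) (hh : 0 ≤ h) (hp1 : p ≤ 1) :
    (b + h) ^ p - b ^ p ≤ b ^ (p - 1) * h := by
  have h1 : (1 + h / b) ^ p ≤ 1 + h / b := by
    have := Real.rpow_le_rpow_of_exponent_le (x := 1 + h / b)
      (le_add_of_nonneg_right (by positivity)) hp1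
    rwa [Real.rpow_one] at this
  have h2 : (b + h) ^ p = b ^ p * (1 + h / b) ^ p := by
    rw [← Real.mul_rpow hb.le (by positivity)]; congr 1; field_simp
  have h3 : 0 ≤ b ^ p := Real.rpow_nonneg hb.le _
  rw [h2, Real.rpow_sub_one hb.ne']
  calc _ ≤ b ^ p * (1 + h / b) - b ^ p := by gcongr
    _ = _ := by ring

section
variable {α a T m : ℝ} {y : ℝ → ℝ}

theorem intervalIntegrable_reflect {g : ℝ → ℝ} (hg : IntervalIntegrable g volume a T) :
    IntervalIntegrable (fun τ => g (T - τ)) volume 0 (T - a) := by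
  have := (hg.comp_sub_left T).symm
  simpa using this

/-- The Caputo derivative of a function continued linearly beyond `T`. -/
theorem cv_gker_linear_extension (hα : α ∈ Ioo (0 : ℝ) 1) (haT : a < T)
    (hy : IntervalIntegrable y volume a T) (hyT : ∀ s, T < s → y s = m)
    (hCap : IntervalIntegrable (fun s => (T - s) ^ (-α) * y s) volume a T) {h : ℝ} (hh : 0 < h) :
    Real.Gamma (1 - α) * (cv a (gker α) y (T + h) - cv a (gker α) y T)
      = -(∫ τ in (0 : ℝ)..T - a, (τ ^ (-α) - (τ + h) ^ (-α)) * (y (T - τ) - m))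
        + m * (((T - a + h) ^ (1 - α) - (T - a) ^ (1 - α)) / (1 - α)) := by
  have hα' : 0 < 1 - α := by linarith [hα.2]
  have hΓ : Real.Gamma (1 - α) ≠ 0 := (Real.Gamma_pos_of_pos hα').ne'
  have hb : 0 < T - a := sub_pos.2 haT
  have hy' := intervalIntegrable_reflect hy
  have hp : IntervalIntegrable (fun τ : ℝ => τ ^ (-α)) volume 0 (T - a) :=
    intervalIntegrable_rpow_neg hα.2 _
  have hph : IntervalIntegrable (fun τ : ℝ => (τ + h) ^ (-α)) volume 0 (T - a) :=
    intervalIntegrable_add_rpow hh hb.le _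
  have hpy : IntervalIntegrable (fun τ => τ ^ (-α) * y (T - τ)) volume 0 (T - a) := by
    simpa using intervalIntegrable_reflect hCap
  have hphy : IntervalIntegrable (fun τ => (τ + h) ^ (-α) * y (T - τ)) volume 0 (T - a) := by
    refine hy'.continuousOn_mul ?_
    rw [uIcc_of_le hb.le]
    exact fun τ hτ => (ContinuousAt.rpow_const (by fun_prop)
      (Or.inl (by linarith [hτ.1]))).continuousWithinAt
  have e0 : ∀ t, Real.Gamma (1 - α) * cv a (gker α) y t = ∫ s in a..t, (t - s) ^ (-α) * y s := by
    intro t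
    rw [cv, ← intervalIntegral.integral_const_mul]
    congr 1; ext s; rw [gker]; field_simp
  have e1 : ∫ s in a..T, (T - s) ^ (-α) * y s
      = ∫ τ in (0 : ℝ)..T - a, τ ^ (-α) * y (T - τ) := by
    have := intervalIntegral.integral_comp_sub_left (a := 0) (b := T - a)
      (fun s => (T - s) ^ (-α) * y s) T
    simpa using this.symm
  have e2 : ∫ s in a..T, (T + h - s) ^ (-α) * y s
      = ∫ τ in (0 : ℝ)..T - a, (τ + h) ^ (-α) * y (T - τ) := by
    have := intervalIntegral.integral_comp_sub_left (a := 0) (b := T - a)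
      (fun s => (T + h - s) ^ (-α) * y s) T
    simp only [sub_sub_cancel, sub_zero] at this
    rw [← this]
    congr 1; ext τ; congr 2; ring
  have i3 : IntervalIntegrable (fun s => (T + h - s) ^ (-α) * y s) volume a T := by
    refine hy.continuousOn_mul ?_
    rw [uIcc_of_le haT.le]
    exact fun s hs => (ContinuousAt.rpow_const (by fun_prop)
      (Or.inl (by linarith [hs.2]))).continuousWithinAt
  have i4' : IntervalIntegrable (fun s => (T + h - s) ^ (-α)) volume T (T + h) := by
    simpa using intervalIntegrable_rsub_rpow (P := 1 - α) hα' (a := T) (t := T + h) (by linarith)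
  have hcongr : EqOn (fun s => (T + h - s) ^ (-α) * m) (fun s => (T + h - s) ^ (-α) * y s)
      (uIoc T (T + h)) := by
    intro s hs
    rw [uIoc_of_le (by linarith)] at hs
    simp only [hyT s hs.1]
  have i4 : IntervalIntegrable (fun s => (T + h - s) ^ (-α) * y s) volume T (T + h) :=
    (i4'.mul_const m).congr hcongr
  have e3 : ∫ s in T..T + h, (T + h - s) ^ (-α) * y s = m * (h ^ (1 - α) / (1 - α)) := by
    have h1 := integral_rsub_rpow (P := 1 - α) hα' (a := T) (t := T + h)
    rw [← intervalIntegral.integral_congr_ae (Eventually.of_forall fun s hs => hcongr hs), intervalIntegral.integral_mul_const]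
    simp only [show 1 - α - 1 = -α by ring, add_sub_cancel_left] at h1
    rw [h1, mul_comm]
  rw [mul_sub, e0, e0, ← intervalIntegral.integral_add_adjacent_intervals i3 i4, e1, e2, e3]
  -- Subtracting `m` isolates the part of `y` whose primitive will be small; the constant part
  -- contributes explicit powers.
  have e4 : ∫ τ in (0 : ℝ)..T - a, (τ ^ (-α) - (τ + h) ^ (-α)) * (y (T - τ) - m)
      = (∫ τ in (0 : ℝ)..T - a, τ ^ (-α) * y (T - τ))
        - (∫ τ in (0 : ℝ)..T - a, (τ + h) ^ (-α) * y (T - τ))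
        - m * ((∫ τ in (0 : ℝ)..T - a, τ ^ (-α)) - ∫ τ in (0 : ℝ)..T - a, (τ + h) ^ (-α)) := by
    rw [← intervalIntegral.integral_sub hpy hphy, ← intervalIntegral.integral_sub hp hph,
      ← intervalIntegral.integral_const_mul,
      ← intervalIntegral.integral_sub (hpy.sub hphy) ((hp.sub hph).const_mul m)]
    congr 1; ext τ; ring
  rw [e4, integral_rpow (Or.inl (by linarith [hα.2])),
    intervalIntegral.integral_comp_add_right (fun τ => τ ^ (-α)) h,
    integral_rpow (Or.inl (by linarith [hα.2])), show -α + 1 = 1 - α by ring, zero_add,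
    Real.zero_rpow hα'.ne']
  field_simp
  ring

/-- In `cv_gker_linear_extension` the integral is negligible by the kernel estimate and the explicit
powers are `O(h)`. The order `o(h^(1-α))` is what convolution with `t^(α-1)` turns into `o(h)`. -/
theorem eventually_cv_gker_sub_le (hα : α ∈ Ioo (0 : ℝ) 1) (haT : a < T)
    (hy : IntervalIntegrable y volume a T) (hyT : ∀ s, T < s → y s = m)
    (hCap : IntervalIntegrable (fun s => (T - s) ^ (-α) * y s) volume a T)
    (hW : ∀ ε > 0, ∃ ρ > 0, ∀ τ ∈ Icc 0 ρ, |∫ s in (0 : ℝ)..τ, (y (T - s) - m)| ≤ ε * τ)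
    {ε : ℝ} (hε : 0 < ε) :
    ∀ᶠ h in 𝓝[>] 0, |cv a (gker α) y (T + h) - cv a (gker α) y T| ≤ ε * h ^ (1 - α) := by
  have hα' : 0 < 1 - α := by linarith [hα.2]
  have hΓ : 0 < Real.Gamma (1 - α) := Real.Gamma_pos_of_pos hα'
  have hb : 0 < T - a := sub_pos.2 haT
  have h1 := eventually_integral_kernel_diff_le (w := fun τ => y (T - τ) - m) hα hb
    ((intervalIntegrable_reflect hy).sub intervalIntegrable_const)
    (by
      have := intervalIntegrable_reflect hCap
      simp only [sub_sub_cancel] at this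
      simpa [mul_sub] using this.sub ((intervalIntegrable_rpow_neg hα.2 _).mul_const m)) hW
    (show 0 < Real.Gamma (1 - α) * ε / 2 by positivity)
  have h2 := eventually_le_mul_rpow hα.1 (|m| * (T - a) ^ (1 - α - 1) / (1 - α))
    (show 0 < Real.Gamma (1 - α) * ε / 2 by positivity)
  filter_upwards [h1, h2, self_mem_nhdsWithin] with h n1 n2 hh
  have hh : 0 < h := hh
  have e := cv_gker_linear_extension hα haT hy hyT hCap hh
  refine le_of_mul_le_mul_left ?_ hΓ
  rw [← abs_of_pos hΓ, ← abs_mul, abs_of_pos hΓ, e]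
  refine (abs_add_le _ _).trans ?_
  rw [abs_neg, abs_mul]
  have h3 : 0 ≤ (T - a + h) ^ (1 - α) - (T - a) ^ (1 - α) :=
    sub_nonneg.2 (Real.rpow_le_rpow hb.le (by linarith) hα'.le)
  have h4 := add_rpow_sub_le (p := 1 - α) hb hh.le (by linarith [hα.1])
  rw [abs_of_nonneg (div_nonneg h3 hα'.le)]
  have h5 : |m| * (((T - a + h) ^ (1 - α) - (T - a) ^ (1 - α)) / (1 - α))
      ≤ |m| * ((T - a) ^ (1 - α - 1) * h / (1 - α)) := by gcongr
  have h6 : |m| * ((T - a) ^ (1 - α - 1) * h / (1 - α))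
      = |m| * (T - a) ^ (1 - α - 1) / (1 - α) * h := by ring
  linarith

/-- Beyond `T` the Caputo derivative of the continued function is continuous. -/
theorem continuousOn_cv_gker_extension (hα : α ∈ Ioo (0 : ℝ) 1) (haT : a < T)
    (hy : IntervalIntegrable y volume a T) (hyT : ∀ s, T < s → y s = m)
    (hCap : IntervalIntegrable (fun s => (T - s) ^ (-α) * y s) volume a T) :
    ContinuousOn (cv a (gker α) y) (Ici T) := by
  have hα' : 0 < 1 - α := by linarith [hα.2]
  have hΓ : 0 < Real.Gamma (1 - α) := Real.Gamma_pos_of_pos hα'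
  have hfirst : ContinuousOn (fun t => ∫ s in a..T, gker α (t - s) * y s) (Ici T) := by
    intro t₀ ht₀
    refine intervalIntegral.continuousWithinAt_of_dominated_interval
      (bound := fun s => (Real.Gamma (1 - α))⁻¹ * |(T - s) ^ (-α) * y s|) ?_ ?_
      (hCap.abs.const_mul _) ?_
    · rw [intervalIntegrable_iff_integrableOn_Ioc_of_le haT.le] at hy
      rw [uIoc_of_le haT.le]
      exact Eventually.of_forall fun t => ((measurable_gker α).comp
        (measurable_const.sub measurable_id)).aestronglyMeasurable.mul hy.aestronglyMeasurable
    · filter_upwards [self_mem_nhdsWithin] with t ht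
      filter_upwards [compl_mem_ae_iff.2 (measure_singleton T)] with s hsT hs
      rw [uIoc_of_le haT.le] at hs
      have ht : T ≤ t := ht
      have hs' : 0 < T - s := sub_pos.2 (lt_of_le_of_ne hs.2 hsT)
      have h1 := Real.rpow_le_rpow_of_nonpos hs' (show T - s ≤ t - s by linarith)
        (show -α ≤ 0 by linarith [hα.1])
      have h2 : 0 ≤ (t - s) ^ (-α) := Real.rpow_nonneg (by linarith) _
      rw [gker, norm_mul, norm_mul, Real.norm_eq_abs, Real.norm_eq_abs, Real.norm_eq_abs, abs_mul,
        abs_of_nonneg h2, abs_of_pos (inv_pos.2 hΓ), abs_of_nonneg (h2.trans h1), mul_assoc]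
      gcongr
    · filter_upwards [compl_mem_ae_iff.2 (measure_singleton T)] with s hsT hs
      rw [uIoc_of_le haT.le] at hs
      have ht₀ : T ≤ t₀ := ht₀
      have hs' : 0 < T - s := sub_pos.2 (lt_of_le_of_ne hs.2 hsT)
      refine ContinuousWithinAt.mul ?_ continuousWithinAt_const
      have h1 : ContinuousAt (gker α) (t₀ - s) :=
        (continuousOn_gker α).continuousAt (Ioi_mem_nhds (by linarith))
      exact (h1.comp (f := fun t => t - s) (by fun_prop)).continuousWithinAt
  have hsecond : ContinuousOn (fun t => (Real.Gamma (1 - α))⁻¹ * m * ((t - T) ^ (1 - α) / (1 - α)))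
      (Ici T) := by
    refine Continuous.continuousOn ?_
    exact continuous_const.mul
      (((Real.continuous_rpow_const hα'.le).comp (by fun_prop)).div_const _)
  refine (hfirst.add hsecond).congr fun t ht => ?_
  have ht : T ≤ t := ht
  have hg : ∀ {b c}, b ≤ c → c ≤ t → IntervalIntegrable (fun s => gker α (t - s)) volume b c := by
    intro b c hbc hct
    have := intervalIntegrable_rsub_rpow (P := 1 - α) hα' (a := b) (t := t) (hbc.trans hct)
    have := (this.const_mul (Real.Gamma (1 - α))⁻¹).mono_set (c := b) (d := c) (by
      rw [uIcc_of_le hbc, uIcc_of_le (hbc.trans hct)]; exact Icc_subset_Icc_right hct)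
    simpa [gker] using this
  have hcongr : EqOn (fun s => gker α (t - s) * m) (fun s => gker α (t - s) * y s)
      (uIoc T t) := by
    intro s hs
    rw [uIoc_of_le ht] at hs
    simp only [hyT s hs.1]
  have i2 : IntervalIntegrable (fun s => gker α (t - s) * y s) volume T t :=
    ((hg ht le_rfl).mul_const m).congr hcongr
  have i1 : IntervalIntegrable (fun s => gker α (t - s) * y s) volume a T := by
    have h1 := hCap.abs.const_mul (Real.Gamma (1 - α))⁻¹
    rw [intervalIntegrable_iff_integrableOn_Ioc_of_le haT.le] at h1 hy ⊢
    refine Integrable.mono' h1 (((measurable_gker α).comp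
        (measurable_const.sub measurable_id)).aestronglyMeasurable.mul hy.aestronglyMeasurable) ?_
    filter_upwards [ae_restrict_mem measurableSet_Ioc,
      ae_restrict_of_ae (compl_mem_ae_iff.2 (measure_singleton T))] with s hs hsT
    have hs' : 0 < T - s := sub_pos.2 (lt_of_le_of_ne hs.2 hsT)
    have h1 := Real.rpow_le_rpow_of_nonpos hs' (show T - s ≤ t - s by linarith)
      (show -α ≤ 0 by linarith [hα.1])
    have h2 : 0 ≤ (t - s) ^ (-α) := Real.rpow_nonneg (by linarith) _
    rw [gker, norm_mul, norm_mul, Real.norm_eq_abs, Real.norm_eq_abs, Real.norm_eq_abs, abs_mul,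
      abs_of_nonneg h2, abs_of_pos (inv_pos.2 hΓ), abs_of_nonneg (h2.trans h1), mul_assoc]
    gcongr
  have e1 : ∫ s in T..t, gker α (t - s) * y s
      = (Real.Gamma (1 - α))⁻¹ * m * ((t - T) ^ (1 - α) / (1 - α)) := by
    have h1 := integral_rsub_rpow (P := 1 - α) hα' (a := T) (t := t)
    rw [← intervalIntegral.integral_congr_ae (Eventually.of_forall fun s hs => hcongr hs), intervalIntegral.integral_mul_const]
    simp only [show 1 - α - 1 = -α by ring] at h1
    simp only [gker]
    rw [intervalIntegral.integral_const_mul, h1]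
    ring
  rw [Pi.add_apply, cv, ← intervalIntegral.integral_add_adjacent_intervals i1 i2, e1]

end

/-- Right differentiability at `T` of a trajectory continued with a constant control, when the
equation has no classical derivative. -/
theorem hasDerivWithinAt_Ici_of_power {α N a T R C Λ B xa c₀ m : ℝ} {x v y : ℝ → ℝ}
    {F : ℝ → ℝ → ℝ → ℝ} (hα : α ∈ Ioo (0 : ℝ) 1) (haT : a < T) (hTR : T < R)
    (hk : IsResolvent α 0 N (R - a) C (fun t => c₀ * t ^ (α - 1))) (hF : Tame a R Λ F)
    (hv : IsControl B v) (hvT : ∀ s, T ≤ s → v s = v T)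
    (hx : IsTraj a R xa (fun t => c₀ * t ^ (α - 1)) F x v)
    (hy : IntervalIntegrable y volume a T) (hyT : ∀ s, T < s → y s = m)
    (hxy : ∀ t ∈ Icc a T, x t = xa + ∫ s in a..t, y s)
    (hCap : IntervalIntegrable (fun s => (T - s) ^ (-α) * y s) volume a T)
    (hG : ∀ᵐ s, s ∈ Ioo a T → N * cv a (gker α) y s = F s (x s) (v s))
    (hGT : N * cv a (gker α) y T = F T (x T) (v T))
    (hd : HasDerivWithinAt x m (Icc a T) T) : HasDerivWithinAt x m (Ici T) T := by
  have hα' : 0 < 1 - α := by linarith [hα.2]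
  have haR := haT.trans hTR
  have hC : 0 ≤ C := hk.sing.const_nonneg (by linarith)
  set k : ℝ → ℝ := fun t => c₀ * t ^ (α - 1) with hkd
  set Φ : ℝ → ℝ := fun s => F s (x s) (v s) with hΦ
  set G : ℝ → ℝ := fun s => N * cv a (gker α) y s with hGd
  -- the derivative of the linear continuation
  have hyR : ∀ t ∈ Icc T R, IntervalIntegrable y volume T t := fun t ht => by
    refine (intervalIntegrable_const (c := m)).congr fun s hs => ?_
    rw [uIoc_of_le ht.1] at hs
    exact (hyT s hs.1).symm
  have hya : ∀ t ∈ Icc T R, IntervalIntegrable y volume a t := fun t ht => hy.trans (hyR t ht)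
  have hX : ∀ t ∈ Icc T R, xa + ∫ s in a..t, y s = x T + m * (t - T) := by
    intro t ht
    rw [← intervalIntegral.integral_add_adjacent_intervals hy (hyR t ht),
      hxy T ⟨haT.le, le_rfl⟩]
    have : ∫ s in T..t, y s = ∫ s in T..t, m :=
      intervalIntegral.integral_congr_ae (Eventually.of_forall fun s hs => by
        rw [uIoc_of_le ht.1] at hs; exact hyT s hs.1)
    rw [this, intervalIntegral.integral_const, smul_eq_mul]
    ring
  -- Left differentiability of `x` at `T` with derivative `m` says that the primitive of `y - m`,
  -- measured backwards from `T`, is `o(τ)`.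
  have hW : ∀ ε > 0, ∃ ρ > 0, ∀ τ ∈ Icc 0 ρ, |∫ s in (0 : ℝ)..τ, (y (T - s) - m)| ≤ ε * τ := by
    intro ε hε
    have h1 := (hasDerivWithinAt_iff_isLittleO.1 hd).bound hε
    obtain ⟨r, hr, hrb⟩ := Metric.mem_nhdsWithin_iff.1 h1
    refine ⟨min (r / 2) (T - a), lt_min (half_pos hr) (sub_pos.2 haT), fun τ hτ => ?_⟩
    have hτr : τ ≤ r / 2 := hτ.2.trans (min_le_left _ _)
    have hτa : τ ≤ T - a := hτ.2.trans (min_le_right _ _)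
    have hmem : T - τ ∈ Icc a T := ⟨by linarith, by linarith [hτ.1]⟩
    have h2 := hrb ⟨by simp [abs_of_nonneg hτ.1]; linarith, hmem⟩
    simp only [mem_ofPred_eq, smul_eq_mul, Real.norm_eq_abs] at h2
    have hi := (hy.mono_set (c := T - τ) (d := T) (by
      rw [uIcc_of_le hmem.2, uIcc_of_le haT.le]; exact Icc_subset_Icc_left hmem.1))
    have hi' : IntervalIntegrable (fun s => y (T - s)) volume 0 τ := by
      simpa using intervalIntegrable_reflect hi
    have h3 : ∫ s in (0 : ℝ)..τ, y (T - s) = x T - x (T - τ) := by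
      rw [intervalIntegral.integral_comp_sub_left (fun s => y s) T, sub_zero, hxy _ hmem,
        hxy T ⟨haT.le, le_rfl⟩, ← intervalIntegral.integral_add_adjacent_intervals
          (b := T - τ) (c := T) (hy.mono_set (c := a) (d := T - τ) (by
            rw [uIcc_of_le hmem.1, uIcc_of_le haT.le]; exact Icc_subset_Icc_right hmem.2)) hi]
      ring
    rw [intervalIntegral.integral_sub hi' intervalIntegrable_const, h3,
      intervalIntegral.integral_const, smul_eq_mul, sub_zero, abs_sub_comm]
    rw [show T - τ - T = -τ by ring, abs_neg, abs_of_nonneg hτ.1] at h2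
    convert! h2 using 2
    ring
  -- the modified right hand side
  have hΦs : SingBound 1 a R Λ Φ := hF.singBound hv le_rfl hx.cont
  have hGc : ContinuousOn G (Icc T R) :=
    continuousOn_const.mul ((continuousOn_cv_gker_extension hα haT hy hyT hCap).mono fun s hs => hs.1)
  obtain ⟨BG, hBG⟩ := isCompact_Icc.exists_bound_of_continuousOn hGc
  set Ψ : ℝ → ℝ := fun s => if s ≤ T then Φ s else G s with hΨ
  have hΨs : SingBound 1 a R (max Λ BG) Ψ := by
    refine singBound_one_of_bound ?_ fun s hs => ?_
    · have h1 : AEStronglyMeasurable Ψ (volume.restrict (Ioc a T ∪ Ioc T R)) := by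
        refine aestronglyMeasurable_union_iff.2 ⟨?_, ?_⟩
        · refine (hΦs.mono hTR.le).meas.congr ?_
          filter_upwards [ae_restrict_mem measurableSet_Ioc] with s hs
          simp [hΨ, hs.2]
        · refine ((hGc.mono Ioc_subset_Icc_self).aestronglyMeasurable measurableSet_Ioc).congr ?_
          filter_upwards [ae_restrict_mem measurableSet_Ioc] with s hs
          simp [hΨ, hs.1]
      rwa [Ioc_union_Ioc_eq_Ioc haT.le hTR.le] at h1
    · by_cases hsT : s ≤ T
      · simp only [hΨ, hsT, if_true]
        exact (hF.bound s ⟨hs.1.le, hs.2⟩ _ _).trans (le_max_left _ _)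
      · simp only [hΨ, hsT, if_false]
        exact (hBG s ⟨(not_le.1 hsT).le, hs.2⟩).trans (le_max_right _ _)
  -- The linear continuation solves the Volterra equation with right-hand side `Ψ`: `k * (N g * y)`
  -- is rebracketed as `(N k * g) * y = 1 * y`.
  have hcvG : ∀ t ∈ Icc T R, cv a k Ψ t = ∫ s in a..t, y s := by
    intro t ht
    have hat : a ≤ t := haT.le.trans ht.1
    have hkt : SingBound α 0 (t - a) C k := hk.sing.mono (by linarith [ht.2])
    have hyt := hya t ht
    have hym := (intervalIntegrable_iff_integrableOn_Ioc_of_le hat).1 hyt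
    have e1 : cv a k Ψ t = cv a k G t := by
      apply intervalIntegral.integral_congr_ae
      filter_upwards [hG, compl_mem_ae_iff.2 (measure_singleton T)] with s hs hsT hs2
      rw [uIoc_of_le hat] at hs2
      by_cases h : s ≤ T
      · simp only [hΨ, h, if_true]
        rw [hGd, hΦ]
        simp only
        rw [hs ⟨hs2.1, lt_of_le_of_ne h hsT⟩]
      · simp only [hΨ, h, if_false]
    rw [e1, hGd, cv_const_mul, cv_assoc hα.1 hα' hat hkt (measurable_gker α) (singBound_gker hα _)
      hym.aestronglyMeasurable (intervalIntegrable_rpow_mul (by linarith) hyt),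
      ← cv_const_mul_left, ← cv_one]
    refine cv_congr_left hat fun s hs => ?_
    have := hk.eq s ⟨hs.1, hs.2.trans (by linarith [ht.2])⟩
    rw [cv_comm]
    linarith
  -- The deviation of the true trajectory from its tangent line, to be shown `o(t - T)`. The
  -- right-hand sides agree up to `T`, so only the interval `[T,t]` contributes.
  set e : ℝ → ℝ := fun t => x t - (x T + m * (t - T)) with he
  have hediff : ∀ t ∈ Icc T R, e t = cv T k (fun s => Φ s - G s) t := by
    intro t ht
    have hat : a ≤ t := haT.le.trans ht.1
    have hkt : SingBound α 0 (t - a) C k := hk.sing.mono (by linarith [ht.2])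
    have h1 : e t = cv a k (fun s => Φ s - Ψ s) t := by
      rw [cv_sub hα.1 one_pos hat hkt (hΦs.mono ht.2) (hΨs.mono ht.2), hcvG t ht, he]
      simp only
      rw [← hX t ht, hx.eq t ⟨hat, ht.2⟩]
      ring
    have hi := cv_intervalIntegrable hα.1 one_pos hat hkt ((hΦs.sub hΨs).mono ht.2)
    rw [h1, cv, ← intervalIntegral.integral_add_adjacent_intervals (b := T)
      (hi.mono_set (by rw [uIcc_of_le haT.le, uIcc_of_le hat]; exact Icc_subset_Icc_right ht.1))
      (hi.mono_set (by rw [uIcc_of_le ht.1, uIcc_of_le hat]; exact Icc_subset_Icc_left haT.le))]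
    have z1 : ∫ s in a..T, k (t - s) * (Φ s - Ψ s) = 0 := by
      rw [intervalIntegral.integral_congr_ae (g := fun _ => (0 : ℝ)) (Eventually.of_forall
        fun s hs => ?_)]
      · simp
      · rw [uIoc_of_le haT.le] at hs
        simp [hΨ, hs.2]
    rw [z1, zero_add]
    refine cv_congr_right ht.1 fun s hs => ?_
    simp [hΨ, hs.1]
  -- local bounds
  have hxT : ContinuousWithinAt x (Ici T) T := by
    have h1 := (hx.cont T ⟨haT.le, hTR.le⟩).mono (Icc_subset_Icc_left haT.le)
    refine h1.mono_of_mem_nhdsWithin (Icc_mem_nhdsGE hTR)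
  obtain ⟨A, hA⟩ := ((hF.smooth.hasFDerivWithinAt (x := x T) (u := v T) haT.le).hasFDerivAt
    (prod_mem_nhds (Ici_mem_nhds haT) univ_mem)).isBigO_sub.bound
  have hΦT : ∀ᶠ t in 𝓝[≥] T, |Φ t - Φ T| ≤ |A| * ((1 + |m|) * (t - T) + |e t|) := by
    have hlim : Tendsto (fun t => (t, x t, v T)) (𝓝[≥] T) (𝓝 (T, x T, v T)) :=
      (tendsto_id.mono_left nhdsWithin_le_nhds).prodMk_nhds
        (hxT.tendsto.prodMk_nhds tendsto_const_nhds)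
    filter_upwards [hlim.eventually hA, self_mem_nhdsWithin] with t ht htT
    have htT : T ≤ t := htT
    rw [hΦ]
    simp only
    rw [hvT t htT]
    refine ht.trans (mul_le_mul (le_abs_self A) ?_ (norm_nonneg _) (abs_nonneg _))
    have h0 : 0 ≤ t - T := sub_nonneg.2 htT
    have h1 : |x t - x T| ≤ |e t| + |m| * (t - T) := by
      have : x t - x T = e t + m * (t - T) := by rw [he]; ring
      rw [this]
      exact (abs_add_le _ _).trans (by rw [abs_mul, abs_of_nonneg h0])
    simp only [Prod.mk_sub_mk, sub_self, Prod.norm_def, Real.norm_eq_abs, norm_zero]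
    rw [abs_of_nonneg h0, max_le_iff, max_le_iff]
    have := abs_nonneg (e t)
    have := mul_nonneg (abs_nonneg m) h0
    refine ⟨?_, ?_, ?_⟩ <;> nlinarith
  rw [hasDerivWithinAt_iff_isLittleO, Asymptotics.isLittleO_iff]
  intro ε hε
  set β := ProbabilityTheory.beta α (2 - α) with hβ
  have hβ0 : 0 < β := ProbabilityTheory.beta_pos hα.1 (by linarith [hα.2])
  -- Chosen so that `2 C ε₁ β ≤ ε/2`, where `β` arises from `∫ (t-s)^(α-1) (s-T)^(1-α) ds = β (t -
  -- T)`.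
  set ε₁ : ℝ := ε / (2 * (C + 1) * β) / 2 with hε₁
  have hε₁0 : 0 < ε₁ := by positivity
  have ev1 : ∀ᶠ h in 𝓝[>] (0 : ℝ), |G (T + h) - G T| ≤ ε₁ * h ^ (1 - α) := by
    have := eventually_cv_gker_sub_le hα haT hy hyT hCap hW
      (show 0 < ε₁ / (|N| + 1) by positivity)
    filter_upwards [this, self_mem_nhdsWithin] with h hh hh0
    have hh0 : 0 < h := hh0
    have hp : 0 ≤ h ^ (1 - α) := Real.rpow_nonneg hh0.le _
    rw [hGd]
    simp only
    rw [← mul_sub, abs_mul]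
    calc _ ≤ (|N| + 1) * (ε₁ / (|N| + 1) * h ^ (1 - α)) := by gcongr; linarith
      _ = _ := by field_simp
  have ev2 := eventually_le_mul_rpow hα.1 (|A| * (1 + |m|)) hε₁0
  have ev3 : ∀ᶠ h in 𝓝[>] (0 : ℝ), C * |A| * (h ^ α / α) ≤ 1 / 2 := by
    have h1 : Continuous fun h : ℝ => C * |A| * (h ^ α / α) :=
      continuous_const.mul ((Real.continuous_rpow_const hα.1.le).div_const _)
    have h2 := (h1.tendsto 0).eventually
      (gt_mem_nhds (show C * |A| * ((0 : ℝ) ^ α / α) < 1 / 2 by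
        rw [Real.zero_rpow hα.1.ne']; norm_num))
    exact (h2.filter_mono nhdsWithin_le_nhds).mono fun _ h => h.le
  obtain ⟨r₁, hr₁, h₁⟩ := mem_nhdsGT_iff_exists_Ioo_subset.1 (ev1.and (ev2.and ev3))
  obtain ⟨r₂, hr₂, h₂⟩ := mem_nhdsGE_iff_exists_Ico_subset.1 hΦT
  have hr₁ : 0 < r₁ := hr₁
  have hr₂ : T < r₂ := hr₂
  have hnear : ∀ t, T < t → t < T + r₁ → t < r₂ →
      |Φ t - G t| ≤ 2 * ε₁ * (t - T) ^ (1 - α) + |A| * |e t| := by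
    intro t h1 h2 h3
    obtain ⟨n1, n2, -⟩ := h₁ ⟨sub_pos.2 h1, by linarith⟩
    have n3 := h₂ ⟨h1.le, h3⟩
    simp only [add_sub_cancel] at n1
    simp only [mem_ofPred_eq] at n3
    have n4 : Φ t - G t = (Φ t - Φ T) - (G t - G T) := by
      have : G T = Φ T := hGT
      rw [this]; ring
    rw [n4]
    refine (abs_sub _ _).trans ?_
    rw [mul_add] at n3
    linarith
  have hnhds : ∀ᶠ t in 𝓝[≥] T, t ∈ Ico T (min (min (T + r₁) r₂) R) :=
    Ico_mem_nhdsGE (lt_min (lt_min (by linarith) hr₂) hTR)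
  filter_upwards [hnhds] with t ht
  have ht1 : t < T + r₁ := ht.2.trans_le ((min_le_left _ _).trans (min_le_left _ _))
  have ht2 : t < r₂ := ht.2.trans_le ((min_le_left _ _).trans (min_le_right _ _))
  have ht3 : t < R := ht.2.trans_le (min_le_right _ _)
  have hec : ContinuousOn e (Icc T t) :=
    (hx.cont.mono (Icc_subset_Icc haT.le ht3.le)).sub (by fun_prop)
  -- At a maximum point of `|e|` on `[T,t]` the Lipschitz term is at most half of `|e|` and can be
  -- absorbed, a short-time substitute for Gronwall's inequality.
  obtain ⟨t', ht', hmax⟩ := isCompact_Icc.exists_isMaxOn (nonempty_Icc.2 ht.1) hec.abs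
  have hmax' : ∀ s ∈ Icc T t, |e s| ≤ |e t'| := fun s hs => hmax hs
  have hest : |e t'| ≤ ε * (t' - T) := by
    rcases ht'.1.eq_or_lt with h0 | h0
    · rw [← h0]; simp [he]
    have htR : t' ≤ R := ht'.2.trans ht3.le
    have hbnd := abs_cv_le_integral (a := T) (t := t') (P := α) (C := C) (p := k)
      (w := fun s => Φ s - G s)
      (m := fun s => 2 * ε₁ * (s - T) ^ (2 - α - 1) + |A| * |e t'|) h0.le
      (fun s hs => by simpa using hk.sing.bound s ⟨hs.1, hs.2.trans (by linarith)⟩)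
      (fun s hs => (hnear s hs.1 (by linarith [hs.2, ht'.2]) (by linarith [hs.2, ht'.2])).trans (by
        rw [show 2 - α - 1 = 1 - α by ring]
        have := hmax' s ⟨hs.1.le, hs.2.trans ht'.2⟩
        gcongr))
    have i1 : IntervalIntegrable
        (fun s => 2 * ε₁ * ((t' - s) ^ (α - 1) * (s - T) ^ (2 - α - 1))) volume T t' :=
      (intervalIntegrable_beta hα.1 (show 0 < 2 - α by linarith [hα.2]) h0.le).const_mul _
    have i2 : IntervalIntegrable (fun s => (t' - s) ^ (α - 1) * (|A| * |e t'|)) volume T t' :=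
      (intervalIntegrable_rsub_rpow hα.1 h0.le).mul_const _
    have hsum : (fun s => (t' - s) ^ (α - 1) * (2 * ε₁ * (s - T) ^ (2 - α - 1) + |A| * |e t'|))
        = fun s => 2 * ε₁ * ((t' - s) ^ (α - 1) * (s - T) ^ (2 - α - 1))
          + (t' - s) ^ (α - 1) * (|A| * |e t'|) := by ext s; ring
    rw [hsum] at hbnd
    have hb2 := hbnd (i1.add i2)
    rw [intervalIntegral.integral_add i1 i2, intervalIntegral.integral_const_mul,
      intervalIntegral.integral_mul_const, integral_beta hα.1 (by linarith [hα.2]) h0,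
      integral_rsub_rpow hα.1, ← hediff t' ⟨ht'.1, htR⟩,
      show α + (2 - α) - 1 = 1 by ring, Real.rpow_one] at hb2
    obtain ⟨-, -, n3⟩ := h₁ ⟨sub_pos.2 h0, by linarith [ht'.2]⟩
    have n4 : C * |A| * ((t' - T) ^ α / α) * |e t'| ≤ 1 / 2 * |e t'| := by gcongr
    have n5 : C * (2 * ε₁ * ((t' - T) * β)) ≤ ε / 2 * (t' - T) := by
      have h5 : (C + 1) * (2 * ε₁ * ((t' - T) * β)) = ε / 2 * (t' - T) := by
        rw [hε₁]; field_simp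
      rw [← h5]
      have := sub_nonneg.2 h0.le
      gcongr
      linarith
    nlinarith
  have hfin := (hmax' t ⟨ht.1, le_rfl⟩).trans (hest.trans
    (mul_le_mul_of_nonneg_left (sub_le_sub_right ht'.2 T) hε.le))
  rw [Real.norm_eq_abs, Real.norm_eq_abs, abs_of_nonneg (sub_nonneg.2 ht.1), smul_eq_mul]
  convert! hfin using 2
  rw [he]
  ring

theorem FundKernel.exists_hasDerivAt_traj {α M N a T R C Λ B xa : ℝ} {k x v : ℝ → ℝ}
    {F : ℝ → ℝ → ℝ → ℝ} (hk : FundKernel α M N (R - a) C k) (hα : α ∈ Ioo (0 : ℝ) 1)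
    (hT : T ∈ Ioo a R) (hM : M ≠ 0) (hF : Tame a R Λ F) (hv : IsControl B v)
    (hvT : ContinuousAt v T) (hx : IsTraj a R xa k F x v) : ∃ m, HasDerivAt x m T := by
  obtain ⟨r, C', hrm, hrc, hr, -, -, hkr⟩ := hk.primitive hM
  have hα' : 0 < 1 - α := by linarith [hα.2]
  have haR : a < R := hT.1.trans hT.2
  have hTI : T ∈ Icc a R := ⟨hT.1.le, hT.2.le⟩
  have hΦ := hF.singBound hv le_rfl hx.cont
  have hcv := continuousOn_weighted_cv hα' (by linarith [hα.1]) one_pos le_rfl hrc hr hΦ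
  simp only [sub_self, Real.rpow_zero, one_mul] at hcv
  have hΦT : ContinuousWithinAt (fun s => F s (x s) (v s)) (Icc a R) T :=
    hF.smooth.continuousWithinAt_comp (fun s hs => hs.1) hTI (hx.cont T hTI)
      hvT.continuousWithinAt
  have hd := hasDerivWithinAt_integral_Icc
    (((hΦ.intervalIntegrable one_pos haR.le).const_mul M⁻¹).add
      (hcv.intervalIntegrable_of_Icc haR.le)) hTI ((hΦT.const_mul M⁻¹).add (hcv T hTI))
  have he : ∀ t ∈ Icc a R, x t = xa + ∫ s in a..t, (M⁻¹ * F s (x s) (v s)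
      + cv a r (fun s => F s (x s) (v s)) s) := fun t ht => by
    rw [hx.eq t ht, cv_eq_integral hα hkr hrm hrc hr ht.1 (by linarith [ht.2]) (hΦ.mono ht.2)]
  exact ⟨_, ((hd.const_add xa).congr he (he T hTI)).hasDerivAt (Icc_mem_nhds hT.1 hT.2)⟩

/-! ### Optimality of the final time and reduction to truncated data -/

section
variable {α a M N xa R C ΛL ΛF B T : ℝ} {L F : ℝ → ℝ → ℝ → ℝ} {φ : ℝ → ℝ → ℝ} {k x v : ℝ → ℝ}

/-- Optimality with respect to the final time. -/
theorem TameMinimizer.final_time (h : TameMinimizer α a M N xa R C ΛL ΛF B T L F φ k x v)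
    (hvT : ContinuousAt v T) {m : ℝ} (hm : HasDerivAt x m T) :
    L T (x T) (v T) + (deriv (fun t => φ t (x T)) T + deriv (fun ξ => φ T ξ) (x T) * m) = 0 := by
  have haT := h.lt
  have hTR := h.lt_right
  have haR := haT.trans hTR
  have hLs := h.tame_cost.singBound h.control le_rfl h.traj.cont
  have hTI : T ∈ Icc a R := ⟨haT.le, hTR.le⟩
  have h1 : HasDerivAt (fun s => ∫ t in a..s, L t (x t) (v t)) (L T (x T) (v T)) T :=
    (hasDerivWithinAt_integral_Icc (hLs.intervalIntegrable one_pos haR.le) hTI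
      (h.tame_cost.smooth.continuousWithinAt_comp (fun s hs => hs.1) hTI (h.traj.cont T hTI)
        hvT.continuousWithinAt)).hasDerivAt (Icc_mem_nhds haT hTR)
  have h2 : HasFDerivAt (fun p : ℝ × ℝ => φ p.1 p.2)
      (fderiv ℝ (fun p : ℝ × ℝ => φ p.1 p.2) (T, x T)) (T, x T) :=
    ((h.diff (T, x T) ⟨haT.le, mem_univ _⟩).differentiableAt
      (prod_mem_nhds (Ici_mem_nhds haT) univ_mem)).hasFDerivAt
  set φ' := fderiv ℝ (fun p : ℝ × ℝ => φ p.1 p.2) (T, x T) with hφ'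
  have e1 : deriv (fun t => φ t (x T)) T = φ' (1, 0) :=
    (h2.comp_hasDerivAt (f := fun t : ℝ => (t, x T)) T
      ((hasDerivAt_id T).prodMk (hasDerivAt_const T (x T)))).deriv
  have e2 : deriv (fun ξ => φ T ξ) (x T) = φ' (0, 1) :=
    (h2.comp_hasDerivAt (f := fun ξ : ℝ => (T, ξ)) (x T)
      ((hasDerivAt_const (x T) T).prodMk (hasDerivAt_id (x T)))).deriv
  have h3 : HasDerivAt (fun s => φ s (x s)) (φ' (1, m)) T :=
    h2.comp_hasDerivAt (f := fun s : ℝ => (s, x s)) T ((hasDerivAt_id T).prodMk hm)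
  have e3 : φ' (1, m) = φ' (1, 0) + φ' (0, 1) * m := by
    have : ((1, m) : ℝ × ℝ) = (1, 0) + m • (0, 1) := by ext <;> simp
    rw [this, map_add, map_smul, smul_eq_mul, mul_comm]
  have h4 : HasDerivAt (cost a L φ x v) (L T (x T) (v T) + φ' (1, m)) T := h1.add h3
  -- The final time is varied along one and the same continued trajectory, which stays in the tube
  -- for `s` near `T`.
  have hmin : IsLocalMin (cost a L φ x v) T := by
    have hnear : ∀ᶠ s in 𝓝 T, |x s| < B :=
      hm.continuousAt.abs.eventually_lt_const (h.bound T ⟨haT.le, le_rfl⟩)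
    obtain ⟨r, hr, hrB⟩ := Metric.eventually_nhds_iff.1 hnear
    filter_upwards [Ioo_mem_nhds haT hTR, gt_mem_nhds (show T < T + r by linarith)] with s hs hsr
    refine h.min v x s (h.control.mono (by linarith)) h.traj hs fun t ht => ?_
    rcases le_or_gt t T with htT | htT
    · exact h.bound t ⟨ht.1, htT⟩
    · refine hrB ?_
      rw [Real.dist_eq, abs_of_pos (sub_pos.2 htT)]
      linarith [ht.2]
  rw [e1, e2, ← e3]
  exact hmin.hasDerivAt_eq_zero h4

end

section
variable {a T : ℝ} {u : ℝ → ℝ}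

/-- Constant continuation of a control outside `[a,T]`. -/
def clampControl (a T : ℝ) (u : ℝ → ℝ) (t : ℝ) : ℝ := u (max a (min t T))

theorem clampControl_of_mem {t : ℝ} (ht : t ∈ Icc a T) : clampControl a T u t = u t := by
  rw [clampControl, min_eq_left ht.2, max_eq_right ht.1]

theorem clampControl_of_ge (haT : a ≤ T) {t : ℝ} (ht : T ≤ t) : clampControl a T u t = u T := by
  rw [clampControl, min_eq_right ht, max_eq_right haT]

theorem clampControl_of_le (haT : a ≤ T) {t : ℝ} (ht : t ≤ a) : clampControl a T u t = u a := by
  rw [clampControl, min_eq_left (ht.trans haT), max_eq_left ht]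

/-- Clamping sends a full neighbourhood into `[a,T]`, so one-sided continuity of `u` at an end point
becomes two-sided. -/
theorem continuousAt_clampControl (haT : a ≤ T) {t : ℝ} (ht : t ∈ Icc a T)
    (hu : ContinuousWithinAt u (Icc a T) t) : ContinuousAt (clampControl a T u) t := by
  have h1 : Tendsto (fun t => max a (min t T)) (𝓝 t) (𝓝[Icc a T] t) := by
    refine tendsto_nhdsWithin_iff.2 ⟨?_, Eventually.of_forall fun s =>
      ⟨le_max_left _ _, max_le haT (min_le_right _ _)⟩⟩
    have : Continuous fun t => max a (min t T) := by fun_prop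
    have h2 := this.tendsto t
    rwa [min_eq_left ht.2, max_eq_right ht.1] at h2
  rw [ContinuousAt, clampControl_of_mem ht]
  exact hu.tendsto.comp h1

/-- Near each point `u` is bounded by its one-sided limits and its value there; compactness does the
rest. -/
theorem PiecewiseContinuousOn.exists_bound (hu : PiecewiseContinuousOn u a T) :
    ∃ B, ∀ t ∈ Icc a T, |u t| ≤ B := by
  refine isCompact_Icc.induction_on (p := fun s => ∃ B, ∀ t ∈ s, |u t| ≤ B) ⟨0, by simp⟩ ?_ ?_ ?_
  · exact fun s s' hss ⟨B, hB⟩ => ⟨B, fun t ht => hB t (hss ht)⟩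
  · exact fun s s' ⟨B, hB⟩ ⟨B', hB'⟩ => ⟨max B B', fun t ht => ht.elim
      (fun h => (hB t h).trans (le_max_left _ _)) fun h => (hB' t h).trans (le_max_right _ _)⟩
  · intro t ht
    have key : ∀ (l : Filter ℝ) (y : ℝ), Tendsto u l (𝓝 y) → ∃ B, ∀ᶠ s in l, |u s| ≤ B :=
      fun l y h => ⟨|y| + 1, (h.abs.eventually_lt_const (lt_add_one |y|)).mono fun _ h => h.le⟩
    have h1 : ∃ B, ∀ᶠ s in 𝓝[>] t, s ∈ Icc a T → |u s| ≤ B := by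
      rcases ht.2.eq_or_lt with h | h
      · refine ⟨0, ?_⟩
        filter_upwards [self_mem_nhdsWithin] with s hs hs'
        have hs : t < s := hs
        linarith [hs'.2]
      · obtain ⟨y, hy⟩ := hu.2.1 t ⟨ht.1, h⟩
        obtain ⟨B, hB⟩ := key _ y hy
        exact ⟨B, hB.mono fun s hs _ => hs⟩
    have h2 : ∃ B, ∀ᶠ s in 𝓝[<] t, s ∈ Icc a T → |u s| ≤ B := by
      rcases ht.1.eq_or_lt with h | h
      · refine ⟨0, ?_⟩
        filter_upwards [self_mem_nhdsWithin] with s hs hs'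
        have hs : s < t := hs
        linarith [hs'.1]
      · obtain ⟨y, hy⟩ := hu.2.2 t ⟨h, ht.2⟩
        obtain ⟨B, hB⟩ := key _ y hy
        exact ⟨B, hB.mono fun s hs _ => hs⟩
    obtain ⟨B₁, h1⟩ := h1
    obtain ⟨B₂, h2⟩ := h2
    refine ⟨{s | s ∈ Icc a T → |u s| ≤ max |u t| (max B₁ B₂)} ∩ Icc a T, ?_, max |u t| (max B₁ B₂),
      fun s hs => hs.1 hs.2⟩
    refine inter_mem (mem_nhdsWithin_of_mem_nhds ?_) self_mem_nhdsWithin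
    rw [← nhdsNE_sup_pure, ← nhdsLT_sup_nhdsGT]
    refine ⟨⟨?_, ?_⟩, ?_⟩
    · exact h2.mono fun s hs h => (hs h).trans ((le_max_right _ _).trans (le_max_right _ _))
    · exact h1.mono fun s hs h => (hs h).trans ((le_max_left _ _).trans (le_max_right _ _))
    · exact fun _ => le_max_left _ _

theorem PiecewiseContinuousOn.exists_isControl (hu : PiecewiseContinuousOn u a T) (haT : a ≤ T) :
    ∃ B, IsControl B (clampControl a T u) := by
  obtain ⟨B, hB⟩ := hu.exists_bound
  obtain ⟨S, hS⟩ := hu.1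
  refine ⟨B, fun t => hB _ ⟨le_max_left _ _, max_le haT (min_le_right _ _)⟩, S, fun t ht => ?_⟩
  rcases lt_or_ge t a with h | h
  · refine (continuousAt_const (y := u a)).congr ?_
    filter_upwards [gt_mem_nhds h] with s hs using (clampControl_of_le haT (le_of_lt hs)).symm
  rcases lt_or_ge T t with h' | h'
  · refine (continuousAt_const (y := u T)).congr ?_
    filter_upwards [lt_mem_nhds h'] with s hs using (clampControl_of_ge haT (le_of_lt hs)).symm
  · exact continuousAt_clampControl haT ⟨h, h'⟩ (hS t ⟨h, h'⟩ ht)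

end

theorem cost_congr {a T : ℝ} {L L' : ℝ → ℝ → ℝ → ℝ} {φ : ℝ → ℝ → ℝ} {x x' u u' : ℝ → ℝ}
    (haT : a ≤ T) (h : ∀ t ∈ Icc a T, L t (x t) (u t) = L' t (x' t) (u' t)) (hx : x T = x' T) :
    cost a L φ x u T = cost a L' φ x' u' T := by
  rw [cost, cost, hx]
  congr 1
  exact intervalIntegral.integral_congr fun t ht => h t (by rwa [uIcc_of_le haT] at ht)

/-- Truncation of the data reduces the problem to bounded Lipschitz data. -/
theorem IsMinimizer.exists_tameMinimizer {α a M N xa T : ℝ} {L f : ℝ → ℝ → ℝ → ℝ}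
    {φ : ℝ → ℝ → ℝ} {D : Finset ℝ} {x u : ℝ → ℝ} (hmin : IsMinimizer α a M N xa L f φ D x u T)
    (hα : α ∈ Ioo (0 : ℝ) 1) (hMN : (M, N) ≠ (0, 0)) (hL : SmoothData a L) (hf : SmoothData a f)
    (hφ : DifferentiableOn ℝ (fun p : ℝ × ℝ => φ p.1 p.2) (Ici a ×ˢ univ)) :
    ∃ (R C ΛL ΛF B : ℝ) (L' F : ℝ → ℝ → ℝ → ℝ) (k X : ℝ → ℝ),
      TameMinimizer α a M N xa R C ΛL ΛF B T L' F φ k X (clampControl a T u) ∧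
      (∀ t ∈ Icc a T, X t = x t) ∧
      (∀ t ξ w, |ξ| ≤ B → |w| ≤ B → L' t ξ w = L t ξ w) ∧
      ∀ t ξ w, |ξ| ≤ B → |w| ≤ B → F t ξ w = f t ξ w := by
  have haT := hmin.1.lt
  have hxc : ContinuousOn x (Icc a T) := by
    have := hmin.1.absCont.continuousOn
    rwa [uIcc_of_le haT.le] at this
  obtain ⟨Bu, hBu⟩ := hmin.1.control.exists_isControl haT.le
  obtain ⟨Bx, hBx⟩ := isCompact_Icc.exists_bound_of_continuousOn hxc
  set v := clampControl a T u with hv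
  have hBu0 : 0 ≤ Bu := (abs_nonneg _).trans (hBu.bound a)
  -- Strictly above the state and at least one above the control, so that small variations of both
  -- remain where truncated and original data agree.
  set B : ℝ := max Bx Bu + 1 with hB
  have hBuB : Bu ≤ B - 1 := by rw [hB]; linarith [le_max_right Bx Bu]
  have hBxB : Bx < B := by rw [hB]; linarith [le_max_left Bx Bu]
  have hB0 : 0 < B := by linarith
  set R := T + 1 with hR
  have hTR : T < R := by rw [hR]; linarith
  have haR := haT.trans hTR
  obtain ⟨F, ΛF, hF, hFf⟩ := hf.exists_tame R hB0
  obtain ⟨L', ΛL, hL', hLL⟩ := hL.exists_tame R hB0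
  obtain ⟨k, C, hk⟩ := exists_fundKernel hα hMN (sub_pos.2 haR)
  have hvB : IsControl B v := hBu.mono (by linarith)
  obtain ⟨X, -, hX⟩ := hF.exists_traj hα hk.toIsResolvent haR hvB xa
  have hxB : ∀ t ∈ Icc a T, |x t| < B := fun t ht => (hBx t ht).trans_lt hBxB
  have hvu : ∀ t ∈ Icc a T, v t = u t := fun t ht => clampControl_of_mem ht
  have hx : IsTraj a T xa k F x v := ⟨hxc, hmin.1.eq_volterra hα hk.toIsResolvent (by linarith)
    (hF.singBound hvB hTR.le hxc) fun t ht => by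
      rw [hFf t _ _ (hxB t ht).le (hvB.bound t), hvu t ht]⟩
  -- Stability with equal controls is uniqueness, so the trajectory on `[a,R]` extends the
  -- minimizing state.
  have hXx : ∀ t ∈ Icc a T, X t = x t := by
    obtain ⟨K, -, hst⟩ := hF.exists_stability hα hk.toIsResolvent haR
    intro t ht
    have := hst T B 0 xa X v x v hTR.le hvB hvB (hX.mono hTR.le) hx (fun t _ => by simp) t ht
    rw [mul_zero] at this
    exact sub_eq_zero.1 (abs_nonpos_iff.1 this)
  refine ⟨R, C, ΛL, ΛF, B, L', F, k, X, ⟨hα, haT, hTR, hk, hL', hF, hφ, hBu.mono hBuB, hX,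
    fun t ht => by rw [hXx t ht]; exact hxB t ht, fun v' y T' hv' hy hT' hyB => ?_⟩, hXx, hLL, hFf⟩
  have h1 := hmin.cost_le_traj hα haR hk hF hFf hL hφ
    (by rw [← hvu a ⟨le_rfl, haT.le⟩]; exact hvB.bound a) hv' hy hT' hyB
  rw [cost_congr (L' := L) (x' := x) (u' := u) haT.le (fun t ht => ?_) (hXx T ⟨haT.le, le_rfl⟩),
    cost_congr (L := L') (L' := L) (x' := y) (u' := v') hT'.1.le (fun t ht => ?_) rfl]
  · exact h1
  · exact hLL t _ _ (hyB t ht).le (hv'.bound t)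
  · rw [hXx t ht, hLL t _ _ (hxB t ht).le (hvB.bound t), hvu t ht]

/-- The extended trajectory of a minimizer is differentiable at the final time. -/
theorem TameMinimizer.hasDerivAt_final {α a M N xa R C ΛL ΛF B T : ℝ} {L' f F : ℝ → ℝ → ℝ → ℝ}
    {φ : ℝ → ℝ → ℝ} {D : Finset ℝ} {k x u X : ℝ → ℝ}
    (h : TameMinimizer α a M N xa R C ΛL ΛF B T L' F φ k X (clampControl a T u))
    (hadm : IsAdmissible α a M N xa f D x u T) (hMN : (M, N) ≠ (0, 0)) (hTD : T ∉ D)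
    (huT : ContinuousWithinAt u (Icc a T) T) (hXx : ∀ t ∈ Icc a T, X t = x t)
    (hFf : ∀ t ξ w, |ξ| ≤ B → |w| ≤ B → F t ξ w = f t ξ w) :
    HasDerivAt X (derivWithin x (Icc a T) T) T := by
  have haT := h.lt
  have hTI : T ∈ Icc a T := ⟨haT.le, le_rfl⟩
  have hvB : IsControl B (clampControl a T u) := h.control.mono (by linarith)
  have hvT : ContinuousAt (clampControl a T u) T := continuousAt_clampControl haT.le hTI huT
  have hud : UniqueDiffWithinAt ℝ (Icc a T) T := uniqueDiffOn_Icc haT T hTI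
  have hdX : HasDerivWithinAt X (derivWithin x (Icc a T) T) (Icc a T) T :=
    (hadm.differentiable T hTI hTD).hasDerivWithinAt.congr hXx (hXx T hTI)
  by_cases hM : M = 0
  · have hN : N ≠ 0 := fun h => hMN (by rw [hM, h])
    obtain ⟨c₀, rfl⟩ := h.kernel.power hM
    subst hM
    set m := derivWithin x (Icc a T) T with hm
    -- The derivative of the tangent line continuation. Beyond `T` the function `x`, and with it
    -- `deriv x`, is arbitrary and must not be used.
    set y : ℝ → ℝ := fun s => if s ≤ T then deriv x s else m with hy
    have hyx : ∀ s, s ≤ T → y s = deriv x s := fun s hs => by simp [hy, hs]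
    have hcongr : ∀ {t}, t ∈ Icc a T → cv a (gker α) y t = caputoLeft α a x t := fun ht => by
      rw [caputoLeft_eq_cv]
      exact cv_congr_right ht.1 fun s hs => hyx s (hs.2.trans ht.2)
    have hFs : ∀ t ∈ Icc a T, F t (X t) (clampControl a T u t) = f t (x t) (u t) := fun t ht => by
      rw [hFf t _ _ (h.bound t ht).le (hvB.bound t), hXx t ht, clampControl_of_mem ht]
    have hright : HasDerivWithinAt X m (Ici T) T := by
      refine hasDerivWithinAt_Ici_of_power (y := y) h.order haT h.lt_right h.kernel.toIsResolvent
        h.tame_dyn hvB (fun s hs => ?_) h.traj ?_ (fun s hs => ?_) (fun t ht => ?_) ?_ ?_ ?_ hdX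
      · rw [clampControl_of_ge haT.le hs, clampControl_of_ge haT.le le_rfl]
      · refine hadm.absCont.intervalIntegrable_deriv.congr fun s hs => ?_
        rw [uIoc_of_le haT.le] at hs
        exact (hyx s hs.2).symm
      · simp [hy, hs]
      · have h1 : ∫ s in a..t, y s = ∫ s in a..t, deriv x s :=
          intervalIntegral.integral_congr_ae (Eventually.of_forall fun s hs => by
            rw [uIoc_of_le ht.1] at hs; exact hyx s (hs.2.trans ht.2))
        rw [h1, hXx t ht, (hadm.absCont.mono (by
          rw [uIcc_of_le ht.1, uIcc_of_le haT.le]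
          exact Icc_subset_Icc_right ht.2)).integral_deriv_eq_sub, hadm.init]
        ring
      · refine (hadm.caputo hN T hTI hTD).congr fun s hs => ?_
        rw [uIoc_of_le haT.le] at hs
        simp only [hyx s hs.2]
      · filter_upwards [compl_mem_ae_iff.2 (D.finite_toSet.measure_zero volume)] with s hsD hs
        have hs' : s ∈ Icc a T := ⟨hs.1.le, hs.2.le⟩
        rw [hcongr hs', hFs s hs', ← hadm.dynamics s hs' (by simpa using hsD)]
        ring
      · rw [hcongr hTI, hFs T hTI, ← hadm.dynamics T hTI hTD]
        ring
    have hleft : HasDerivWithinAt X m (Iic T) T :=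
      hdX.mono_of_mem_nhdsWithin (Icc_mem_nhdsLE haT)
    have := hleft.union hright
    rwa [Iic_union_Ici, hasDerivWithinAt_univ] at this
  · obtain ⟨m, hm⟩ := h.kernel.exists_hasDerivAt_traj h.order ⟨haT, h.lt_right⟩ hM h.tame_dyn hvB
      hvT h.traj
    rwa [hud.eq_deriv _ hdX hm.hasDerivWithinAt]

/-! ### Return to forward time and assembly -/

theorem AbsolutelyContinuousOnInterval.congr {f g : ℝ → ℝ} {a b : ℝ}
    (hf : AbsolutelyContinuousOnInterval f a b) (h : EqOn f g (uIcc a b)) :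
    AbsolutelyContinuousOnInterval g a b := by
  rw [absolutelyContinuousOnInterval_iff] at hf ⊢
  refine fun ε hε => (hf ε hε).imp fun δ hδ => ⟨hδ.1, fun E hE hEδ => ?_⟩
  refine lt_of_eq_of_lt (Finset.sum_congr rfl fun i hi => ?_) (hδ.2 E hE hEδ)
  rw [h (hE.1 i hi).1, h (hE.1 i hi).2]

section
variable {a T : ℝ} {μ : ℝ → ℝ}

theorem rsub_mem_Icc {t : ℝ} (ht : t ∈ Icc a T) : T - t ∈ Icc 0 (T - a) :=
  ⟨by linarith [ht.2], by linarith [ht.1]⟩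

theorem hasDerivWithinAt_rsub {m t : ℝ} (h : HasDerivWithinAt μ m (Icc 0 (T - a)) (T - t)) :
    HasDerivWithinAt (fun t => μ (T - t)) (-m) (Icc a T) t := by
  have h1 : HasDerivWithinAt (fun t : ℝ => T - t) (-1) (Icc a T) t :=
    ((hasDerivAt_id t).const_sub T).hasDerivWithinAt
  have h2 := h.comp t h1 fun s hs => rsub_mem_Icc hs
  rwa [mul_neg_one] at h2

theorem rlIntegralRight_rsub (α T : ℝ) (μ : ℝ → ℝ) :
    rlIntegralRight (1 - α) T (fun t => μ (T - t)) = fun t => cv 0 (gker α) μ (T - t) := by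
  ext t
  have h1 := intervalIntegral.integral_comp_sub_left (a := t) (b := T)
    (fun s => (T - t - s) ^ (-α) * μ s) T
  rw [sub_self] at h1
  rw [rlIntegralRight, cv]
  simp only [gker, mul_assoc]
  rw [intervalIntegral.integral_const_mul, ← h1]
  congr 2
  ext s
  congr 2
  · ring
  · ring

theorem tendsto_rsub_nhdsLT (T : ℝ) : Tendsto (fun t => T - t) (𝓝[<] T) (𝓝[>] 0) := by
  refine tendsto_nhdsWithin_iff.2 ⟨?_, ?_⟩
  · have : Continuous fun t : ℝ => T - t := by fun_prop
    simpa using (this.tendsto T).mono_left nhdsWithin_le_nhds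
  · filter_upwards [self_mem_nhdsWithin] with t ht
    exact sub_pos.2 (mem_Iio.1 ht)

theorem absolutelyContinuousOnInterval_rsub {ψ : ℝ → ℝ} {c : ℝ} (haT : a ≤ T)
    (hψ : IntervalIntegrable ψ volume 0 (T - a))
    (hμ : ∀ τ ∈ Icc 0 (T - a), μ τ = c + ∫ s in (0 : ℝ)..τ, ψ s) :
    AbsolutelyContinuousOnInterval (fun t => μ (T - t)) a T := by
  have h1 : IntervalIntegrable (fun t => ψ (T - t)) volume a T := by
    simpa using (hψ.comp_sub_left T).symm
  have h2 := h1.absolutelyContinuousOnInterval_intervalIntegral (c := T) right_mem_uIcc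
  have h3 : AbsolutelyContinuousOnInterval (fun _ : ℝ => c) a T :=
    ((LipschitzWith.const c).lipschitzOnWith).absolutelyContinuousOnInterval
  refine AbsolutelyContinuousOnInterval.congr (h3.sub h2) fun t ht => ?_
  rw [uIcc_of_le haT] at ht
  simp only [Pi.sub_apply]
  rw [hμ _ (rsub_mem_Icc ht), intervalIntegral.integral_symm,
    intervalIntegral.integral_comp_sub_left (fun s => ψ s) T]
  simp

end

theorem hasDerivAt_state_of_eqOn {a B t ξ w : ℝ} {L L' : ℝ → ℝ → ℝ → ℝ} (hL' : SmoothData a L')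
    (ht : a ≤ t) (h : ∀ t ξ w, |ξ| ≤ B → |w| ≤ B → L' t ξ w = L t ξ w) (hξ : |ξ| < B)
    (hw : |w| < B) : HasDerivAt (fun ξ => L t ξ w) (pd a L' (0, 1, 0) t ξ w) ξ := by
  refine (hL'.hasDerivAt_state ht ξ w).congr_of_eventuallyEq ?_
  filter_upwards [continuous_abs.continuousAt.eventually_lt_const hξ] with ξ' hξ'
  exact (h t ξ' w hξ'.le hw.le).symm

theorem hasDerivAt_control_of_eqOn {a B t ξ w : ℝ} {L L' : ℝ → ℝ → ℝ → ℝ}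
    (hL' : SmoothData a L') (ht : a ≤ t)
    (h : ∀ t ξ w, |ξ| ≤ B → |w| ≤ B → L' t ξ w = L t ξ w) (hξ : |ξ| < B) (hw : |w| < B) :
    HasDerivAt (fun w => L t ξ w) (pd a L' (0, 0, 1) t ξ w) w := by
  refine (hL'.hasDerivAt_control ht ξ w).congr_of_eventuallyEq ?_
  filter_upwards [continuous_abs.continuousAt.eventually_lt_const hw] with w' hw'
  exact (h t ξ w' hξ.le hw'.le).symm

end FracOC

end

theorem mainTheorem6
    (α a M N xa : ℝ) (hα : α ∈ Set.Ioo (0 : ℝ) 1) (hMN : (M, N) ≠ (0, 0))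
    (L f : ℝ → ℝ → ℝ → ℝ) (φ : ℝ → ℝ → ℝ)
    (hL : ContDiffOn ℝ 1 (fun p : ℝ × ℝ × ℝ => L p.1 p.2.1 p.2.2)
      (Set.Ici a ×ˢ (Set.univ : Set (ℝ × ℝ))))
    (hf : ContDiffOn ℝ 1 (fun p : ℝ × ℝ × ℝ => f p.1 p.2.1 p.2.2)
      (Set.Ici a ×ˢ (Set.univ : Set (ℝ × ℝ))))
    (hφ : DifferentiableOn ℝ (fun p : ℝ × ℝ => φ p.1 p.2)
      (Set.Ici a ×ˢ (Set.univ : Set ℝ)))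
    (D : Finset ℝ) (x u : ℝ → ℝ) (T : ℝ)
    (hmin : FracOC.IsMinimizer α a M N xa L f φ D x u T)
    (hTD : T ∉ D) (huT : ContinuousWithinAt u (Set.Icc a T) T) :
    ∃ (lam : ℝ → ℝ) (ℓ : ℝ),
      -- regularity of the multiplier
      IntervalIntegrable lam MeasureTheory.volume a T ∧
      ContinuousOn lam (Set.Ico a T) ∧
      (M ≠ 0 → AbsolutelyContinuousOnInterval lam a T) ∧
      (deriv (fun ξ => φ T ξ) (x T) = 0 → ContinuousOn lam (Set.Icc a T)) ∧
      -- adjoint equation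
      (∀ t ∈ Set.Icc a T, ContinuousWithinAt u (Set.Icc a T) t →
        (t < T ∨ N = 0 ∨ deriv (fun ξ => φ T ξ) (x T) = 0) →
          (M ≠ 0 → DifferentiableWithinAt ℝ lam (Set.Icc a T) t) ∧
          (N ≠ 0 → FracOC.RLDerivRightExists α a T lam t) ∧
          M * derivWithin lam (Set.Icc a T) t - N * FracOC.rlDerivRight α a T lam t
            = -deriv (fun ξ => FracOC.hamiltonian L f t ξ (u t) (lam t)) (x t)) ∧
      -- state equation
      (∀ t ∈ Set.Icc a T, t ∉ D →
        M * derivWithin x (Set.Icc a T) t + N * FracOC.caputoLeft α a x t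
          = deriv (fun p => FracOC.hamiltonian L f t (x t) (u t) p) (lam t)) ∧
      -- stationarity
      (∀ t ∈ Set.Icc a T, ContinuousWithinAt u (Set.Icc a T) t →
        (t < T ∨ M ≠ 0 ∨ deriv (fun ξ => φ T ξ) (x T) = 0) →
          deriv (fun v => FracOC.hamiltonian L f t (x t) v (lam t)) (u t) = 0) ∧
      -- transversality, where ℓ is the terminal value of the right integral of order 1 - α
      Filter.Tendsto (FracOC.rlIntegralRight (1 - α) T lam) (nhdsWithin T (Set.Iio T)) (nhds ℓ) ∧
      FracOC.hamiltonian L f T (x T) (u T) (lam T)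
          - N * lam T * FracOC.caputoLeft α a x T
          + N * derivWithin x (Set.Icc a T) T * ℓ
          + deriv (fun t => φ t (x T)) T = 0 ∧
      M * lam T + N * ℓ - deriv (fun ξ => φ T ξ) (x T) = 0 := by
  obtain ⟨R, C, ΛL, ΛF, B, L', F, k, X, h, hXx, hLL, hFf⟩ :=
    FracOC.IsMinimizer.exists_tameMinimizer hmin hα hMN hL hf hφ
  have haT := h.lt
  have hb : 0 < T - a := sub_pos.2 haT
  have hTI : T ∈ Icc a T := ⟨haT.le, le_rfl⟩
  have hadm := hmin.1
  set v := FracOC.clampControl a T u with hv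
  have hvu : ∀ t ∈ Icc a T, v t = u t := fun t ht => FracOC.clampControl_of_mem ht
  have hxB : ∀ t ∈ Icc a T, |x t| < B := fun t ht => hXx t ht ▸ h.bound t ht
  have huB : ∀ t ∈ Icc a T, |u t| < B := fun t ht => by
    rw [← hvu t ht]; linarith [h.control.bound t]
  have hXc : ContinuousOn X (Icc a T) := (h.traj.mono h.lt_right.le).cont
  have hvc : ∀ t ∈ Icc a T, ContinuousWithinAt u (Icc a T) t → ContinuousWithinAt v (Icc a T) t :=
    fun t ht hu => (FracOC.continuousAt_clampControl haT.le ht hu).continuousWithinAt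
  set c := deriv (fun ξ => φ T ξ) (x T) with hc
  have hφx : HasDerivAt (φ T) c (X T) := by
    rw [hXx T hTI]
    have h1 : DifferentiableAt ℝ (fun p : ℝ × ℝ => φ p.1 p.2) (T, x T) :=
      (hφ (T, x T) ⟨haT.le, mem_univ _⟩).differentiableAt
        (prod_mem_nhds (Ici_mem_nhds haT) univ_mem)
    exact (h1.comp (f := fun ξ : ℝ => (T, ξ)) (x T) (by fun_prop)).hasDerivAt
  have hk := h.kernel.mono (show T - a ≤ R - a by linarith [h.lt_right])
  have hA := h.singBound_state_rsub h.tame_cost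
  have hB := h.singBound_state_rsub h.tame_dyn
  -- The multiplier will be `λ(t) = μ(T - t)`, with the terminal datum `c = φ_x^T`.
  obtain ⟨γ, μ, hμ⟩ := hk.exists_costate hα hb hA hB c
  obtain ⟨Cμ, hμs⟩ := hμ.sing
  obtain ⟨ℓ, hℓ, -, hℓc⟩ := hμ.tendsto_cv hα hb hk hA hB hMN
  have hfinal := h.hasDerivAt_final hadm hMN hTD huT hXx hFf
  have htime := h.final_time (FracOC.continuousAt_clampControl haT.le hTI huT) hfinal
  have hpd : ∀ {G : ℝ → ℝ → ℝ → ℝ} {Λ : ℝ}, FracOC.Tame a R Λ G → ∀ w, ∀ t ∈ Icc a T,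
      ContinuousWithinAt u (Icc a T) t →
      ContinuousWithinAt (fun t => FracOC.pd a G w t (X t) (v t)) (Icc a T) t :=
    fun hG w t ht hu => FracOC.continuousWithinAt_pd_comp hG.smooth w (fun s hs => hs.1) ht
      (hXc t ht) (hvc t ht hu)
  have hlam : ContinuousOn (fun t => μ (T - t)) (Ico a T) :=
    hμ.cont.comp (f := fun t => T - t) (by fun_prop)
      fun t ht => ⟨by linarith [ht.2], by linarith [ht.1]⟩
  have hlam' : M ≠ 0 ∨ c = 0 → ContinuousOn (fun t => μ (T - t)) (Icc a T) := fun h0 =>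
    (hμ.cont_zero h0).comp (f := fun t => T - t) (by fun_prop)
      fun t ht => FracOC.rsub_mem_Icc ht
  refine ⟨fun t => μ (T - t), ℓ, ?_, hlam, fun hM => ?_, fun h0 => hlam' (Or.inr h0),
    fun t ht hu h0 => ?_, fun t ht htD => ?_, fun t ht hu h0 => ?_, ?_, ?_, ?_⟩
  · simpa using ((hμs.intervalIntegrable hμ.pos hb.le).comp_sub_left T).symm
  · obtain ⟨ψ, hψi, hψ, -⟩ := hμ.exists_primitive hα hk hA hB hb hM
    exact FracOC.absolutelyContinuousOnInterval_rsub haT.le hψi hψ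
  · have ht' := FracOC.rsub_mem_Icc ht
    have hcont : ∀ {G : ℝ → ℝ → ℝ → ℝ} {Λ : ℝ}, FracOC.Tame a R Λ G →
        ContinuousWithinAt (fun s => FracOC.pd a G (0, 1, 0) (T - s) (X (T - s)) (v (T - s)))
          (Icc 0 (T - a)) (T - t) := fun hG =>
      FracOC.continuousWithinAt_rsub (A := fun t => FracOC.pd a _ (0, 1, 0) t (X t) (v t))
        (by rw [sub_sub_cancel]; exact hpd hG _ t ht hu)
    obtain ⟨m, d, hm, hd, hmd⟩ := hμ.exists_deriv hα hk hA hB hb hMN ht'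
      (h0.imp_left fun h => sub_pos.2 h) (hcont h.tame_cost) (hcont h.tame_dyn)
    have hm' : M ≠ 0 → HasDerivWithinAt (fun t => μ (T - t)) (-m) (Icc a T) t := fun hM =>
      FracOC.hasDerivWithinAt_rsub (hm hM)
    have hd' : N ≠ 0 → HasDerivWithinAt (FracOC.rlIntegralRight (1 - α) T (fun t => μ (T - t)))
        (-d) (Icc a T) t := fun hN => by
      rw [FracOC.rlIntegralRight_rsub]
      exact FracOC.hasDerivWithinAt_rsub (hd hN)
    have hud : UniqueDiffWithinAt ℝ (Icc a T) t := uniqueDiffOn_Icc haT t ht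
    refine ⟨fun hM => (hm' hM).differentiableWithinAt,
      fun hN => (hd' hN).differentiableWithinAt, ?_⟩
    have e1 : M * derivWithin (fun t => μ (T - t)) (Icc a T) t = M * -m := by
      by_cases hM : M = 0
      · rw [hM, zero_mul, zero_mul]
      · rw [(hm' hM).derivWithin hud]
    have e2 : N * FracOC.rlDerivRight α a T (fun t => μ (T - t)) t = N * d := by
      by_cases hN : N = 0
      · rw [hN, zero_mul, zero_mul]
      · rw [FracOC.rlDerivRight, (hd' hN).derivWithin hud, neg_neg]
    have e3 : HasDerivAt (fun ξ => FracOC.hamiltonian L f t ξ (u t) (μ (T - t)))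
        (FracOC.pd a L' (0, 1, 0) t (x t) (u t)
          + μ (T - t) * FracOC.pd a F (0, 1, 0) t (x t) (u t)) (x t) :=
      (FracOC.hasDerivAt_state_of_eqOn h.tame_cost.smooth ht.1 hLL (hxB t ht) (huB t ht)).add
        ((FracOC.hasDerivAt_state_of_eqOn h.tame_dyn.smooth ht.1 hFf (hxB t ht)
          (huB t ht)).const_mul _)
    rw [e1, e2, e3.deriv]
    rw [sub_sub_cancel, hXx t ht, hvu t ht] at hmd
    linear_combination -hmd
  · have e1 : HasDerivAt (fun p => FracOC.hamiltonian L f t (x t) (u t) p) (f t (x t) (u t))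
        (μ (T - t)) := by
      simpa [FracOC.hamiltonian] using
        ((hasDerivAt_id (μ (T - t))).mul_const (f t (x t) (u t))).const_add (L t (x t) (u t))
    rw [e1.deriv]
    exact hadm.dynamics t ht htD
  · have e1 : HasDerivAt (fun w => FracOC.hamiltonian L f t (x t) w (μ (T - t)))
        (FracOC.pd a L' (0, 0, 1) t (x t) (u t)
          + μ (T - t) * FracOC.pd a F (0, 0, 1) t (x t) (u t)) (u t) :=
      (FracOC.hasDerivAt_control_of_eqOn h.tame_cost.smooth ht.1 hLL (hxB t ht) (huB t ht)).add
        ((FracOC.hasDerivAt_control_of_eqOn h.tame_dyn.smooth ht.1 hFf (hxB t ht)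
          (huB t ht)).const_mul _)
    rw [e1.deriv]
    have hlc : ContinuousWithinAt (fun t => μ (T - t)) (Icc a T) t := by
      rcases ht.2.eq_or_lt with htT | htT
      · exact hlam' (h0.resolve_left htT.not_lt) t ht
      · refine (hlam t ⟨ht.1, htT⟩).mono_of_mem_nhdsWithin ?_
        filter_upwards [self_mem_nhdsWithin, nhdsWithin_le_nhds (gt_mem_nhds htT)] with s hs hs'
        exact ⟨hs.1, hs'⟩
    have := FracOC.eq_zero_of_ae_eq_zero haT ht
      ((hpd h.tame_cost (0, 0, 1) t ht hu).add (hlc.mul (hpd h.tame_dyn (0, 0, 1) t ht hu)))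
      (h.stationary_ae hφx hμ)
    simpa only [Pi.add_apply, Pi.mul_apply, hXx t ht, hvu t ht] using this
  · rw [FracOC.rlIntegralRight_rsub]
    exact hℓ.comp (FracOC.tendsto_rsub_nhdsLT T)
  · have hdyn := hadm.dynamics T hTI hTD
    have hLT := hLL T (x T) (u T) (hxB T hTI).le (huB T hTI).le
    rw [hXx T hTI, hvu T hTI, hLT, ← hc] at htime
    simp only [sub_self, FracOC.hamiltonian]
    -- The state equation at `T` eliminates `f`, and `M λ(T) + N ℓ = c` accounts for the term `φ_x
    -- x'(T)`. After these substitutions `λ(T)` cancels, so its conventional value in the case of an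
    -- unbounded `λ` is harmless.
    linear_combination htime - μ 0 * hdyn + derivWithin x (Icc a T) T * hℓc
  · simp only [sub_self]
    linear_combination hℓc
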